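/- Let $n\in\mathbb N$, $T>0$, $\mathbb T^n=\mathbb R^n/\mathbb Z^n$, and $Q_\tau=\mathbb T^n\times(\tau,T)$. Let $H=H(x,t,p)$ be measurable on $\mathbb T^n\times(0,T)\times\mathbb R^n$ and $C^2$ in $p$, let $D_pH(\cdot,t,p)$ be bounded in $W^{1,\infty}(\mathbb T^n)$ uniformly in $t\in(0,T)$ and in $p$ on bounded sets, and suppose that for some $\lambda,\Lambda$ with $\lambda\ge 0$ $$\lambda|\xi|^2\le \sum_{i,j}D^2_{p_ip_j}H(x,t,p)\,\xi_i\xi_j\le\Lambda|\xi|^2\qquad\text{for all }x,t,p,\xi .$$ Let $c\in L^1(0,T)$ and $R\ge 0$. Then there is $K\in L^1(0,T)$, depending only on $n,T,H,\lambda,\Lambda,c,R$ (in particular not on the viscosity $\varepsilon$, the data or the solutions), such that the following holds. Let $\varepsilon\ge 0$, $g_1,g_2\in L^1(\mathbb T^n)$, $f_1,f_2\in L^1(Q_0)$, and for $i=1,2$ let $u_i$ be continuous on $\mathbb T^n\times[0,T]$ and $R$-Lipschitz in $x$ for every $t$, with $H(x,t,Du_i)\in L^1(Q_0)$, and solve $$-\partial_t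 u_i-\varepsilon\Delta u_i+H(x,t,Du_i)=f_i\ \text{ in }\mathbb T^n\times(0,T),\qquad u_i(\cdot,T)=g_i\ \text{ a.e.},$$ the equation being understood in the weak sense: for all $\varphi\in C^\infty_c(\mathbb T^n\times(0,T))$, $$\iint_{Q_0}\big(u_i\,\partial_t\varphi+\varepsilon Du_i\cdot D\varphi+H(x,t,Du_i)\varphi\big)\,dx\,dt=\iint_{Q_0}f_i\varphi\,dx\,dt .$$ Assume that $D^2u_i(\cdot,t)\le c(t)I_n$ for a.e. $t\in(0,T)$, that is, $x\mapsto u_i(x,t)-\tfrac{c(t)}2|x|^2$ is concave on $\mathbb R^n$. Then for every $\tau\in[0,T)$ $$\|u_1-u_2\|_{L^\infty(\tau,T;L^1(\mathbb T^n))}\le \exp\Big(\int_\tau^T K(t)\,dt\Big)\Big(\|g_1-g_2\|_{L^1(\mathbb T^n)}+\|f_1-f_2\|_{L^1(Q_\tau)}\Big).$$ -/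

import Mathlib

open MeasureTheory Set
open scoped NNReal ENNReal

namespace HJTorus

/-- Points of `ℝⁿ` with the Euclidean norm. Functions on the torus `ℝⁿ / ℤⁿ` are
represented by `ℤⁿ`-periodic functions on this space. -/
abbrev Space (n : ℕ) : Type := EuclideanSpace ℝ (Fin n)

/-- `ℤⁿ`-periodicity. -/
def IsPeriodic {n : ℕ} (v : Space n → ℝ) : Prop :=
  ∀ (k : Fin n → ℤ) (x : Space n), v (x + WithLp.toLp 2 (fun i => (k i : ℝ))) = v x

/-- The unit cube `[0,1)ⁿ`, a fundamental domain of the torus. -/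
def unitCube (n : ℕ) : Set (Space n) := {x | ∀ i, 0 ≤ x i ∧ x i < 1}

/-- Lebesgue measure on the torus. -/
noncomputable def torusMeasure (n : ℕ) : Measure (Space n) := volume.restrict (unitCube n)

/-- Lebesgue measure on the space-time cylinder `𝕋ⁿ × (τ,T)`; time is the first coordinate. -/
noncomputable def cylMeasure (n : ℕ) (τ T : ℝ) : Measure (ℝ × Space n) :=
  volume.restrict (Ioo τ T ×ˢ unitCube n)

/-- The norm of `L¹(𝕋ⁿ)`. -/
noncomputable def normL1 {n : ℕ} (v : Space n → ℝ) : ℝ≥0∞ := eLpNorm v 1 (torusMeasure n)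

/-- The norm of `L¹(𝕋ⁿ × (τ,T))`. -/
noncomputable def normL1Cyl {n : ℕ} (τ T : ℝ) (f : ℝ → Space n → ℝ) : ℝ≥0∞ :=
  eLpNorm (fun z : ℝ × Space n => f z.1 z.2) 1 (cylMeasure n τ T)

/-- The norm of `L^∞(τ,T; L¹(𝕋ⁿ))`. -/
noncomputable def normLinftyL1 {n : ℕ} (τ T : ℝ) (w : ℝ → Space n → ℝ) : ℝ≥0∞ :=
  essSup (fun t => normL1 (w t)) (volume.restrict (Ioo τ T))

/-- `g ∈ L¹(𝕋ⁿ)`. -/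
def MemL1 {n : ℕ} (g : Space n → ℝ) : Prop :=
  IsPeriodic g ∧ Integrable g (torusMeasure n)

/-- `f ∈ L¹(𝕋ⁿ × (0,T))`. -/
def MemL1Cyl {n : ℕ} (T : ℝ) (f : ℝ → Space n → ℝ) : Prop :=
  (∀ t ∈ Ioo 0 T, IsPeriodic (f t)) ∧
    Integrable (fun z : ℝ × Space n => f z.1 z.2) (cylMeasure n 0 T)

/-- Standing regularity of a Hamiltonian `H(t,x,p)` on `𝕋ⁿ × (0,T)`: it is measurable, periodic
in `x` and `C²` in `p`, and for `p` in bounded sets `D_pH(t,·,p)` is bounded in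
`W^{1,∞}(𝕋ⁿ)`, uniformly in `t`. -/
structure IsHamiltonian {n : ℕ} (T : ℝ) (H : ℝ → Space n → Space n → ℝ) : Prop where
  measurable : Measurable (fun z : ℝ × Space n × Space n => H z.1 z.2.1 z.2.2)
  periodic : ∀ t ∈ Ioo 0 T, ∀ p, IsPeriodic (fun x => H t x p)
  contDiff : ∀ t ∈ Ioo 0 T, ∀ x, ContDiff ℝ 2 (H t x)
  bounded_lipschitz : ∀ R : ℝ≥0, ∃ C : ℝ≥0, ∀ t ∈ Ioo 0 T, ∀ p : Space n, ‖p‖ ≤ R →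
    (∀ x, ‖gradient (H t x) p‖ ≤ C) ∧ LipschitzWith C (fun x => gradient (H t x) p)

/-- `lam |ξ|² ≤ D²_{pp}H(t,x,p) ξ·ξ ≤ Lam |ξ|²`. -/
def HessianBounds {n : ℕ} (T : ℝ) (H : ℝ → Space n → Space n → ℝ) (lam Lam : ℝ) : Prop :=
  ∀ t ∈ Ioo 0 T, ∀ x p ξ : Space n,
    lam * ‖ξ‖ ^ 2 ≤ iteratedFDeriv ℝ 2 (H t x) p ![ξ, ξ] ∧
      iteratedFDeriv ℝ 2 (H t x) p ![ξ, ξ] ≤ Lam * ‖ξ‖ ^ 2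

/-- Test functions on `𝕋ⁿ × (0,T)`: smooth, periodic in space, compactly supported in time. -/
structure IsTest {n : ℕ} (T : ℝ) (φ : ℝ → Space n → ℝ) : Prop where
  smooth : ContDiff ℝ ((⊤ : ℕ∞) : WithTop ℕ∞) (fun z : ℝ × Space n => φ z.1 z.2)
  periodic : ∀ t, IsPeriodic (φ t)
  support : ∃ a b : ℝ, 0 < a ∧ b < T ∧ ∀ t, t ∉ Icc a b → ∀ x, φ t x = 0

/-- `u` is a continuous weak solution on `𝕋ⁿ × [0,T]`, `R`-Lipschitz in space, of
`-∂ₜu - ε Δu + H(t,x,Du) = f`, `u(T) = g`. -/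
structure IsLipschitzSolution {n : ℕ} (T ε : ℝ) (H : ℝ → Space n → Space n → ℝ)
    (f : ℝ → Space n → ℝ) (g : Space n → ℝ) (R : ℝ≥0) (u : ℝ → Space n → ℝ) : Prop where
  periodic : ∀ t ∈ Icc 0 T, IsPeriodic (u t)
  continuousOn : ContinuousOn (fun z : ℝ × Space n => u z.1 z.2) (Icc 0 T ×ˢ univ)
  lipschitz : ∀ t ∈ Icc 0 T, LipschitzWith R (u t)
  integrable_H : Integrable
    (fun z : ℝ × Space n => H z.1 z.2 (gradient (u z.1) z.2)) (cylMeasure n 0 T)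
  weak_eq : ∀ φ : ℝ → Space n → ℝ, IsTest T φ →
    ∫ z : ℝ × Space n, (u z.1 z.2 * deriv (fun s => φ s z.2) z.1
        + ε * inner ℝ (gradient (u z.1) z.2) (gradient (φ z.1) z.2)
        + H z.1 z.2 (gradient (u z.1) z.2) * φ z.1 z.2) ∂(cylMeasure n 0 T)
      = ∫ z : ℝ × Space n, f z.1 z.2 * φ z.1 z.2 ∂(cylMeasure n 0 T)
  terminal : ∀ᵐ x, u T x = g x

/-- `D²u(·,t) ≤ c(t) Iₙ` for almost every `t ∈ (0,T)`. -/
def IsSemiconcave {n : ℕ} (T : ℝ) (c : ℝ → ℝ) (u : ℝ → Space n → ℝ) : Prop :=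
  ∀ᵐ t ∂(volume.restrict (Ioo 0 T)),
    ConcaveOn ℝ univ (fun x : Space n => u t x - c t / 2 * ‖x‖ ^ 2)

end HJTorus

/-! Put `w = u₁ - u₂`. By the fundamental theorem of calculus along the segment from `Du₂` to `Du₁`,
`H(Du₁) - H(Du₂) = b·Dw` with `b = ∫₀¹ D_pH(x,t,θDu₁ + (1-θ)Du₂) dθ`, so formally `w` solves the
backward transport-diffusion equation `-∂ₜw - εΔw + b·Dw = f₁ - f₂`. Multiplying by `sign w` and
integrating, the viscosity term has a favourable sign whatever `ε` is, and the transport term is `-∫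
b·D|w| = ∫ (div b)|w|`. Only an upper bound for `div b` is needed. For each `θ` the function `U =
θu₁ + (1-θ)u₂` is `R`-Lipschitz and semiconcave with constant `c⁺ = max c 0`, and `div D_pH(x,DU)`
is the sum of `(div_x D_pH)(x,DU)` and `tr(D²_{pp}H D²U)`. The first summand is at most `nC`, with
`C` a Lipschitz constant of `D_pH` in `x` for `|p| ≤ R`; the second is at most `nΛc⁺`, because `0 ≤
D²_{pp}H ≤ Λ` and `D²U ≤ c⁺`. Hence `K = nC + nΛc⁺`, and a backward Grönwall inequality concludes.

The transport bound is made rigorous at a fixed time. `neg_integral_inner_gradient_le` integrates by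
parts with difference quotients, `neg_integral_drift_le_of_smooth` computes the divergence for
smooth `U`, and `neg_integral_drift_le` removes smoothness by mollification: semiconcavity is
preserved, and it forces the gradients to converge almost everywhere
(`tendsto_gradient_of_semiconcave`). Fubini in `θ` then gives `neg_integral_sub_mul_le`.

In time the solutions are merely continuous, so the equation cannot be multiplied by `sign w`
directly. With `Φ(s) = √(s² + η²)` and a spatial mollifier `ρ`, the admissible test function is `ρ *
Φ'(ρ * w)` (`regSign`). Self-adjointness of mollification makes it the derivative of `∫ Φ(ρ * w)`,
and it also keeps the sign of the viscosity term. On a short interval `[s,t]` the test function is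
frozen at time `s`; convexity of `Φ` bounds the decrease of the energy by the tested equation, the
error of freezing is uniformly small, and `sub_le_integral_of_local` adds up the pieces. The limits
are taken in the order: time step, mollification scale `δ`, Grönwall, and finally `η`. -/

namespace HJTorus
open Filter Topology
open scoped Pointwise

variable {n : ℕ}

/-! ### Periodic functions and integration over the unit cube -/

/-- The point of `ℤⁿ ⊆ ℝⁿ` with coordinates `k`. -/
def latticePoint (k : Fin n → ℤ) : Space n := WithLp.toLp 2 (fun i => (k i : ℝ))

/-- `ℤⁿ`-periodicity of functions with arbitrary values. -/
def LatticePeriodic {α : Type*} (v : Space n → α) : Prop :=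
  ∀ (k : Fin n → ℤ) (x : Space n), v (x + latticePoint k) = v x

theorem IsPeriodic.latticePeriodic {v : Space n → ℝ} (h : IsPeriodic v) : LatticePeriodic v := h

/-- The standard basis of `ℝⁿ`. -/
noncomputable def stdBasis (n : ℕ) : Module.Basis (Fin n) ℝ (Space n) :=
  (EuclideanSpace.basisFun (Fin n) ℝ).toBasis

theorem unitCube_eq_fundamentalDomain :
    unitCube n = ZSpan.fundamentalDomain (stdBasis n) := by
  ext x
  simp [unitCube, ZSpan.mem_fundamentalDomain, stdBasis]

theorem measurableSet_unitCube : MeasurableSet (unitCube n) := by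
  rw [unitCube_eq_fundamentalDomain]
  exact ZSpan.fundamentalDomain_measurableSet _

theorem volume_unitCube : volume (unitCube n) = 1 := by
  have h2 : unitCube n = (MeasurableEquiv.toLp 2 (Fin n → ℝ)).symm ⁻¹'
      (Set.pi univ fun _ => Ico (0 : ℝ) 1) := by
    ext x
    simp [unitCube]
  rw [h2, (EuclideanSpace.volume_preserving_symm_measurableEquiv_toLp (Fin n)).measure_preimage
    (MeasurableSet.univ_pi fun _ => measurableSet_Ico).nullMeasurableSet]
  simp [volume_pi]

instance : IsProbabilityMeasure (torusMeasure n) :=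
  ⟨by simp [torusMeasure, volume_unitCube]⟩

theorem isAddFundamentalDomain_unitCube :
    IsAddFundamentalDomain (Submodule.span ℤ (range (stdBasis n))).toAddSubgroup (unitCube n)
      (volume : Measure (Space n)) := by
  rw [unitCube_eq_fundamentalDomain]
  exact ZSpan.isAddFundamentalDomain' _ _

theorem exists_latticePoint_eq
    (g : (Submodule.span ℤ (range (stdBasis n))).toAddSubgroup) :
    ∃ k : Fin n → ℤ, (g : Space n) = latticePoint k := by
  obtain ⟨g, hg⟩ := g
  have h := (Module.Basis.mem_span_iff_repr_mem ℤ (stdBasis n) g).1 hg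
  choose k hk using h
  refine ⟨k, ?_⟩
  ext i
  have := hk i
  simp [stdBasis] at this
  simp [latticePoint, this]

/-- A translate of the unit cube is again a fundamental domain of the lattice, and a periodic
function has the same integral over any two of them. -/
theorem LatticePeriodic.integral_add {E : Type*} [NormedAddCommGroup E] [NormedSpace ℝ E]
    {F : Space n → E} (hF : LatticePeriodic F) (a : Space n) :
    ∫ x, F (x + a) ∂torusMeasure n = ∫ x, F x ∂torusMeasure n := by
  have h1 := isAddFundamentalDomain_unitCube (n := n)
  have h2 := h1.vadd_of_comm a
  have : Countable (Submodule.span ℤ (range (stdBasis n))).toAddSubgroup :=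
    inferInstanceAs (Countable (Submodule.span ℤ (range (stdBasis n))))
  have h3 := h1.setIntegral_eq h2 (f := F) (fun g x => by
    obtain ⟨k, hk⟩ := exists_latticePoint_eq g
    have : g +ᵥ x = x + latticePoint k := by
      rw [← hk, add_comm]; rfl
    rw [this, hF])
  rw [torusMeasure, h3]
  have h4 : MeasurePreserving (fun x : Space n => x + a) volume volume :=
    measurePreserving_add_right volume a
  have h5 := h4.setIntegral_preimage_emb (MeasurableEquiv.addRight a).measurableEmbedding F
    (a +ᵥ unitCube n)
  rw [← h5]
  congr 2
  ext x
  simp [Set.mem_vadd_set, add_comm a]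

theorem unitCube_subset_closedBall : unitCube n ⊆ Metric.closedBall 0 (Real.sqrt n) := by
  intro x hx
  rw [mem_closedBall_zero_iff, EuclideanSpace.norm_eq]
  apply Real.sqrt_le_sqrt
  calc ∑ i, ‖x i‖ ^ 2 ≤ ∑ i : Fin n, (1 : ℝ) := Finset.sum_le_sum fun i _ => by
        have := hx i
        rw [Real.norm_eq_abs, sq_abs]; nlinarith
    _ = n := by simp

theorem ae_mem_unitCube : ∀ᵐ x ∂torusMeasure n, x ∈ unitCube n :=
  ae_restrict_mem measurableSet_unitCube

theorem ae_torus_of_ae {p : Space n → Prop} (h : ∀ᵐ x, p x) : ∀ᵐ x ∂torusMeasure n, p x :=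
  ae_restrict_of_ae h

theorem integrable_torus_of_continuous {E : Type*} [NormedAddCommGroup E]
    {F : Space n → E} (hF : Continuous F) : Integrable F (torusMeasure n) :=
  (hF.locallyIntegrable.integrableOn_isCompact
    (isCompact_closedBall 0 (Real.sqrt n))).mono_set unitCube_subset_closedBall

theorem integrable_torus_of_bounded {E : Type*} [NormedAddCommGroup E]
    {F : Space n → E} (hF : AEStronglyMeasurable F (torusMeasure n)) {C : ℝ}
    (hC : ∀ x, ‖F x‖ ≤ C) : Integrable F (torusMeasure n) :=
  Integrable.of_bound hF C (ae_of_all _ hC)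

theorem exists_latticePoint_add_mem (x : Space n) :
    ∃ k : Fin n → ℤ, x + latticePoint k ∈ unitCube n := by
  refine ⟨fun i => -⌊x i⌋, fun i => ?_⟩
  simp only [latticePoint, PiLp.add_apply, Int.cast_neg]
  exact ⟨by linarith [Int.floor_le (x i)], by linarith [Int.lt_floor_add_one (x i)]⟩

theorem LatticePeriodic.exists_bound {E : Type*} [NormedAddCommGroup E]
    {v : Space n → E} (hv : LatticePeriodic v) (hc : Continuous v) : ∃ C, 0 ≤ C ∧ ∀ x, ‖v x‖ ≤ C := by
  obtain ⟨C, hC⟩ := (isCompact_closedBall (0 : Space n) (Real.sqrt n)).exists_bound_of_continuousOn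
    hc.continuousOn
  refine ⟨max C 0, le_max_right _ _, fun x => ?_⟩
  obtain ⟨k, hk⟩ := exists_latticePoint_add_mem x
  rw [← hv k x]
  exact (hC _ (unitCube_subset_closedBall hk)).trans (le_max_left _ _)

theorem LatticePeriodic.fderiv {v : Space n → ℝ} (hv : LatticePeriodic v) :
    LatticePeriodic (fderiv ℝ v) := by
  intro k x
  have : (fun y => v (y + latticePoint k)) = v := funext fun y => hv k y
  rw [← fderiv_comp_add_right, this]

theorem LatticePeriodic.gradient {v : Space n → ℝ} (hv : LatticePeriodic v) :
    LatticePeriodic (gradient v) := by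
  intro k x
  rw [_root_.gradient, _root_.gradient, hv.fderiv]

theorem norm_gradient_eq (v : Space n → ℝ) (x : Space n) : ‖gradient v x‖ = ‖fderiv ℝ v x‖ := by
  simp [gradient]

theorem norm_gradient_le_of_lipschitz {v : Space n → ℝ} {L : ℝ≥0} (hv : LipschitzWith L v)
    (x : Space n) : ‖gradient v x‖ ≤ L := by
  rw [norm_gradient_eq]; exact norm_fderiv_le_of_lipschitz ℝ hv

theorem measurable_gradient (v : Space n → ℝ) : Measurable (gradient v) := by
  unfold gradient
  exact (InnerProductSpace.toDual ℝ (Space n)).symm.continuous.measurable.comp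
    (measurable_fderiv ℝ v)

theorem LatticePeriodic.exists_lipschitz {v : Space n → ℝ} (hv : LatticePeriodic v)
    (hc : ContDiff ℝ 1 v) : ∃ L : ℝ≥0, LipschitzWith L v := by
  obtain ⟨C, hC0, hC⟩ := hv.fderiv.exists_bound (hc.continuous_fderiv (by norm_num))
  refine ⟨⟨C, hC0⟩, lipschitzWith_of_nnnorm_fderiv_le (hc.differentiable (by norm_num)) hC⟩

/-! ### Periodic mollification -/

/-- A smooth even periodic probability density concentrated within distance `δ` of the lattice. -/
structure IsMollifier (δ : ℝ) (ρ : Space n → ℝ) : Prop where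
  smooth : ContDiff ℝ ((⊤ : ℕ∞) : WithTop ℕ∞) ρ
  periodic : LatticePeriodic ρ
  nonneg : ∀ x, 0 ≤ ρ x
  even : ∀ x, ρ (-x) = ρ x
  integral_eq_one : ∫ x, ρ x ∂torusMeasure n = 1
  support : ∀ x, ρ x ≠ 0 → ∃ k : Fin n → ℤ, ‖x + latticePoint k‖ ≤ δ

theorem eight_mul_sq_le_one_sub_cos {y : ℝ} (hy : |y| ≤ 1 / 2) :
    8 * y ^ 2 ≤ 1 - Real.cos (2 * Real.pi * y) := by
  have hpi := Real.pi_pos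
  have h := Real.cos_le_one_sub_mul_cos_sq (x := 2 * Real.pi * y) (by
    rw [abs_mul, abs_of_pos (by positivity)]; nlinarith)
  have : 2 / Real.pi ^ 2 * (2 * Real.pi * y) ^ 2 = 8 * y ^ 2 := by field_simp; ring
  linarith

/-- Instead of periodizing a bump, one composes a smooth step with the trigonometric polynomial `∑
(1 - cos 2πxᵢ)`. It is periodic, even and smooth at once, and it dominates `8` times the squared
distance to the nearest lattice point, hence the threshold `8δ²`. -/
theorem exists_isMollifier (n : ℕ) {δ : ℝ} (hδ : 0 < δ) :
    ∃ ρ : Space n → ℝ, IsMollifier δ ρ := by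
  set s : Space n → ℝ := fun x => ∑ i, (1 - Real.cos (2 * Real.pi * x i)) with hs
  set ρ₀ : Space n → ℝ := fun x => Real.smoothTransition (8 * δ ^ 2 - s x) with hρ₀
  have s_smooth : ContDiff ℝ ((⊤ : ℕ∞) : WithTop ℕ∞) s := by
    refine ContDiff.sum fun i _ => contDiff_const.sub (Real.contDiff_cos.comp
      (contDiff_const.mul ?_))
    exact (EuclideanSpace.proj (𝕜 := ℝ) i).contDiff
  have smooth : ContDiff ℝ ((⊤ : ℕ∞) : WithTop ℕ∞) ρ₀ :=
    Real.smoothTransition.contDiff.comp (contDiff_const.sub s_smooth)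
  have s_per : LatticePeriodic s := by
    intro k x
    refine Finset.sum_congr rfl fun i _ => ?_
    have : 2 * Real.pi * (x + latticePoint k) i = 2 * Real.pi * x i + k i * (2 * Real.pi) := by
      simp [latticePoint]; ring
    rw [this, Real.cos_add_int_mul_two_pi]
  have per : LatticePeriodic ρ₀ := fun k x => by simp only [hρ₀, s_per k x]
  have even : ∀ x, ρ₀ (-x) = ρ₀ x := fun x => by simp [hρ₀, hs]
  have nonneg : ∀ x, 0 ≤ ρ₀ x := fun x => Real.smoothTransition.nonneg _
  have supp : ∀ x, ρ₀ x ≠ 0 → ∃ k : Fin n → ℤ, ‖x + latticePoint k‖ ≤ δ := by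
    intro x hx
    have h1 : s x < 8 * δ ^ 2 := by
      by_contra h
      exact hx (Real.smoothTransition.zero_of_nonpos (by linarith))
    refine ⟨fun i => -round (x i), ?_⟩
    rw [EuclideanSpace.norm_eq, Real.sqrt_le_left hδ.le]
    have h2 : 8 * ∑ i, ‖(x + latticePoint fun i => -round (x i)) i‖ ^ 2 ≤ s x := by
      rw [← s_per (fun i => -round (x i)) x, Finset.mul_sum]
      refine Finset.sum_le_sum fun i _ => ?_
      rw [Real.norm_eq_abs, sq_abs]
      apply eight_mul_sq_le_one_sub_cos
      have := abs_sub_round (x i)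
      simpa [latticePoint, ← sub_eq_add_neg] using this
    linarith
  have pos : 0 < ∫ x, ρ₀ x ∂torusMeasure n := by
    -- The origin, where the density is positive, is a corner of the cube. Translating by the centre
    -- puts it in the interior, where positivity on an open set yields positive measure.
    set a : Space n := WithLp.toLp 2 (fun _ => (1 / 2 : ℝ)) with ha
    rw [← per.integral_add (-a)]
    have hcont : Continuous fun x : Space n => ρ₀ (x + -a) :=
      smooth.continuous.comp (continuous_add_const _)
    rw [integral_pos_iff_support_of_nonneg (fun x => nonneg _)
      (integrable_torus_of_continuous hcont)]
    have hopen : IsOpen (Function.support (fun x : Space n => ρ₀ (x + -a)) ∩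
        {x | ∀ i, 0 < x i ∧ x i < 1}) := by
      refine (hcont.isOpen_support).inter ?_
      simp only [Set.ofPred_forall, Set.ofPred_and]
      refine isOpen_iInter_of_finite fun i => ?_
      have hi : Continuous fun x : Space n => x i := (EuclideanSpace.proj (𝕜 := ℝ) i).continuous
      exact (isOpen_lt continuous_const hi).inter (isOpen_lt hi continuous_const)
    have hne : (Function.support (fun x : Space n => ρ₀ (x + -a)) ∩
        {x | ∀ i, 0 < x i ∧ x i < 1}).Nonempty := by
      refine ⟨a, ?_, fun i => by simp [ha]; norm_num⟩
      have : 0 < 8 * δ ^ 2 := by positivity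
      simp only [Function.mem_support, add_neg_cancel, hρ₀]
      refine (Real.smoothTransition.pos_of_pos ?_).ne'
      simpa [hs] using sq_pos_of_pos hδ
    refine (hopen.measure_pos volume hne).trans_le ?_
    rw [torusMeasure, Measure.restrict_apply' measurableSet_unitCube]
    refine measure_mono (inter_subset_inter_right _ fun x hx i => ⟨(hx i).1.le, (hx i).2⟩)
  refine ⟨fun x => (∫ x, ρ₀ x ∂torusMeasure n)⁻¹ * ρ₀ x, contDiff_const.mul smooth,
    fun k x => by simp only [per k x], fun x => mul_nonneg (inv_nonneg.2 pos.le) (nonneg x),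
    fun x => by simp only [even], ?_, fun x hx => supp x (right_ne_zero_of_mul hx)⟩
  rw [integral_const_mul, inv_mul_cancel₀ pos.ne']

section moll

variable {E : Type*} [NormedAddCommGroup E] [NormedSpace ℝ E]

/-- Averages of translates of `v`, weighted by `ρ`. -/
noncomputable def moll (ρ : Space n → ℝ) (v : Space n → E) (x : Space n) : E :=
  ∫ z, ρ z • v (x + z) ∂torusMeasure n

variable {δ : ℝ} {ρ : Space n → ℝ}

theorem moll_eq_integral_sub (hρ : LatticePeriodic ρ) {v : Space n → E} (hv : LatticePeriodic v)
    (x : Space n) : moll ρ v x = ∫ y, ρ (y - x) • v y ∂torusMeasure n := by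
  have hF : LatticePeriodic fun y => ρ (y - x) • v y := fun k y => by
    simp only [hv k y]
    rw [← hρ k (y - x)]
    congr 2; abel
  rw [← hF.integral_add x, moll]
  simp [add_comm]

theorem LatticePeriodic.moll {v : Space n → E} (hv : LatticePeriodic v) :
    LatticePeriodic (moll ρ v) := by
  intro k x
  simp only [HJTorus.moll]
  congr 1; ext z
  rw [add_right_comm, hv]

namespace IsMollifier

theorem integrable (hρ : IsMollifier δ ρ) : Integrable ρ (torusMeasure n) :=
  integrable_torus_of_continuous hρ.smooth.continuous

theorem integrable_smul (hρ : IsMollifier δ ρ) {v : Space n → E}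
    (hv : Continuous v) (x : Space n) :
    Integrable (fun z => ρ z • v (x + z)) (torusMeasure n) :=
  integrable_torus_of_continuous
    (hρ.smooth.continuous.smul (hv.comp (continuous_const_add x)))

/-- Estimates for the integrand pass to its weighted average. -/
theorem norm_integral_smul_le (hρ : IsMollifier δ ρ) {F : Space n → E} {C : ℝ}
    (hC : ∀ z, ρ z ≠ 0 → ‖F z‖ ≤ C) : ‖∫ z, ρ z • F z ∂torusMeasure n‖ ≤ C := by
  calc ‖∫ z, ρ z • F z ∂torusMeasure n‖ ≤ ∫ z, ρ z * C ∂torusMeasure n := by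
        refine norm_integral_le_of_norm_le (hρ.integrable.mul_const C) (ae_of_all _ fun z => ?_)
        rw [norm_smul, Real.norm_of_nonneg (hρ.nonneg z)]
        by_cases hz : ρ z = 0
        · simp [hz]
        · exact mul_le_mul_of_nonneg_left (hC z hz) (hρ.nonneg z)
    _ = C := by rw [integral_mul_const, hρ.integral_eq_one, one_mul]

theorem norm_moll_le (hρ : IsMollifier δ ρ) {v : Space n → E} {C : ℝ} (hC : ∀ z, ‖v z‖ ≤ C)
    (x : Space n) : ‖moll ρ v x‖ ≤ C :=
  hρ.norm_integral_smul_le fun _ _ => hC _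

theorem moll_sub (hρ : IsMollifier δ ρ) {v w : Space n → E} (hv : Continuous v)
    (hw : Continuous w) (x : Space n) :
    moll ρ (fun y => v y - w y) x = moll ρ v x - moll ρ w x := by
  simp only [moll, smul_sub]
  exact integral_sub (hρ.integrable_smul hv x) (hρ.integrable_smul hw x)

/-- The weight is concentrated near the lattice rather than near `0`, so periodicity is used to
replace `x + z` by a point within `δ` of `x`. -/
theorem norm_moll_sub_le [CompleteSpace E] (hρ : IsMollifier δ ρ) {v : Space n → E} {L : ℝ≥0}
    (hp : LatticePeriodic v) (hv : LipschitzWith L v) (x : Space n) :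
    ‖moll ρ v x - v x‖ ≤ L * δ := by
  have h1 : v x = ∫ z, ρ z • v x ∂torusMeasure n := by
    rw [integral_smul_const, hρ.integral_eq_one, one_smul]
  have h2 : moll ρ v x - v x = ∫ z, ρ z • (v (x + z) - v x) ∂torusMeasure n := by
    conv_lhs => rw [h1]
    rw [moll, ← integral_sub (hρ.integrable_smul hv.continuous x) (hρ.integrable.smul_const _)]
    simp [smul_sub]
  rw [h2]
  refine hρ.norm_integral_smul_le fun z hz => ?_
  obtain ⟨k, hk⟩ := hρ.support z hz
  rw [← hp k (x + z)]
  refine (hv.norm_sub_le _ _).trans (mul_le_mul_of_nonneg_left ?_ L.2)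
  rwa [show x + z + latticePoint k - x = z + latticePoint k by abel]

theorem lipschitz_moll (hρ : IsMollifier δ ρ) {v : Space n → E} {L : ℝ≥0}
    (hv : LipschitzWith L v) : LipschitzWith L (moll ρ v) := by
  refine LipschitzWith.of_dist_le_mul fun x y => ?_
  rw [dist_eq_norm, moll, moll, ← integral_sub (hρ.integrable_smul hv.continuous x)
    (hρ.integrable_smul hv.continuous y)]
  simp only [← smul_sub]
  refine hρ.norm_integral_smul_le fun z _ => ?_
  have := hv.dist_le_mul (x + z) (y + z)
  rwa [dist_add_right, dist_eq_norm] at this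

/-- Near a given point only the values of `ρ` on a bounded set matter, so `ρ` may be multiplied by a
cutoff, and smoothness of convolutions with compactly supported kernels applies. -/
theorem contDiff_moll (hρ : IsMollifier δ ρ) {v : Space n → ℝ} (hv : Continuous v)
    (hp : LatticePeriodic v) : ContDiff ℝ ((⊤ : ℕ∞) : WithTop ℕ∞) (moll ρ v) := by
  rw [contDiff_iff_contDiffAt]
  intro x₀
  -- For `|x - x₀| < 1` and `y` in the cube, `|x - y - x₀| ≤ √n + 1`, so the cutoff equals `1`
  -- wherever the kernel is evaluated.
  set χ : ContDiffBump x₀ := ⟨Real.sqrt n + 1, Real.sqrt n + 2, by positivity, by linarith⟩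
  have h1 : ContDiff ℝ ((⊤ : ℕ∞) : WithTop ℕ∞)
      (convolution v (fun y => χ y * ρ y) (ContinuousLinearMap.mul ℝ ℝ) (torusMeasure n)) :=
    HasCompactSupport.contDiff_convolution_right _ (χ.hasCompactSupport.mul_right)
      (integrable_torus_of_continuous hv).locallyIntegrable (χ.contDiff.mul hρ.smooth)
  refine h1.contDiffAt.congr_of_eventuallyEq ?_
  filter_upwards [Metric.ball_mem_nhds x₀ one_pos] with x hx
  rw [moll_eq_integral_sub hρ.periodic hp, convolution_def]
  refine integral_congr_ae ?_
  filter_upwards [ae_mem_unitCube] with y hy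
  have h2 : χ (x - y) = 1 := by
    apply χ.one_of_mem_closedBall
    have := unitCube_subset_closedBall hy
    rw [mem_closedBall_zero_iff] at this
    rw [Metric.mem_ball, dist_eq_norm] at hx
    rw [Metric.mem_closedBall, dist_eq_norm]
    calc ‖x - y - x₀‖ = ‖(x - x₀) - y‖ := by congr 1; abel
      _ ≤ ‖x - x₀‖ + ‖y‖ := norm_sub_le _ _
      _ ≤ Real.sqrt n + 1 := by linarith
  rw [ContinuousLinearMap.mul_apply', h2, one_mul, ← hρ.even, neg_sub, smul_eq_mul, mul_comm]

/-- Here the increment falls on the kernel, so a sup bound on `v` suffices. This turns uniform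
closeness of two functions into closeness of the gradients of their mollifications. -/
theorem lipschitz_moll_of_bound (hρ : IsMollifier δ ρ) {Lρ : ℝ≥0} (hL : LipschitzWith Lρ ρ)
    {v : Space n → ℝ} (hv : Continuous v) (hp : LatticePeriodic v) {C : ℝ≥0} (hC : ∀ x, |v x| ≤ C) :
    LipschitzWith (Lρ * C) (moll ρ v) := by
  refine LipschitzWith.of_dist_le_mul fun x y => ?_
  have hint : ∀ x, Integrable (fun z => ρ (z - x) • v z) (torusMeasure n) := fun x =>
    integrable_torus_of_continuous ((hρ.smooth.continuous.comp (continuous_sub_right x)).smul hv)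
  rw [dist_eq_norm, moll_eq_integral_sub hρ.periodic hp, moll_eq_integral_sub hρ.periodic hp,
    ← integral_sub (hint x) (hint y)]
  have : ∀ z, ‖ρ (z - x) • v z - ρ (z - y) • v z‖ ≤ Lρ * C * dist x y := fun z => by
    rw [← sub_smul, norm_smul]
    have h1 := hL.dist_le_mul (z - x) (z - y)
    rw [dist_sub_left, dist_eq_norm] at h1
    calc _ ≤ (Lρ * dist x y) * C := mul_le_mul h1 (hC z) (abs_nonneg _) (by positivity)
      _ = _ := by ring
  refine (norm_integral_le_of_norm_le_const (ae_of_all _ this)).trans ?_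
  simp

/-- Rademacher's theorem gives almost every translate of `v` a derivative at `x`, and the Lipschitz
bound dominates the difference quotients; thus differentiation commutes with mollification. -/
theorem hasGradientAt_moll (hρ : IsMollifier δ ρ) {v : Space n → ℝ} {L : ℝ≥0}
    (hv : LipschitzWith L v) (x : Space n) :
    HasGradientAt (moll ρ v) (moll ρ (gradient v) x) x := by
  obtain ⟨C, hC0, hC⟩ := hρ.periodic.exists_bound hρ.smooth.continuous
  have hmeas : AEStronglyMeasurable (fun z => ρ z • fderiv ℝ v (x + z)) (torusMeasure n) :=
    (hρ.smooth.continuous.measurable.smul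
      ((measurable_fderiv ℝ v).comp (measurable_const_add x))).aestronglyMeasurable
  have hdiff : ∀ᵐ z ∂torusMeasure n, DifferentiableAt ℝ v (x + z) :=
    ae_torus_of_ae ((measurePreserving_add_left volume x).quasiMeasurePreserving.ae
      hv.ae_differentiableAt)
  have h := hasFDerivAt_integral_of_dominated_loc_of_lip (μ := torusMeasure n)
    (F := fun x z => ρ z • v (x + z)) (F' := fun z => ρ z • fderiv ℝ v (x + z)) (x₀ := x)
    (bound := fun _ => C * L) (𝕜 := ℝ) univ_mem
    (Eventually.of_forall fun y => (hρ.integrable_smul hv.continuous y).aestronglyMeasurable)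
    (hρ.integrable_smul hv.continuous x) hmeas
    (ae_of_all _ fun z => LipschitzWith.lipschitzOnWith (by
      refine LipschitzWith.of_dist_le_mul fun a b => ?_
      have h1 := hv.dist_le_mul (a + z) (b + z)
      rw [dist_add_right, dist_eq_norm] at h1
      rw [dist_eq_norm, ← smul_sub, norm_smul]
      simp only [Real.coe_nnabs]
      rw [abs_of_nonneg (by positivity)]
      calc _ ≤ C * (L * dist a b) := mul_le_mul (hC z) h1 (norm_nonneg _) hC0
        _ = _ := by ring))
    (integrable_const _)
    (by
      filter_upwards [hdiff] with z hz
      exact ((hasFDerivAt_comp_add_right z).2 hz.hasFDerivAt).const_smul (ρ z))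
  have hint : Integrable (fun z => ρ z • gradient v (x + z)) (torusMeasure n) := by
    refine integrable_torus_of_bounded (C := C * L)
      (hρ.smooth.continuous.measurable.smul ((measurable_gradient v).comp
        (measurable_const_add x))).aestronglyMeasurable fun z => ?_
    rw [norm_smul]
    exact mul_le_mul (hC z) (norm_gradient_le_of_lipschitz hv _) (norm_nonneg _) hC0
  have hdual : InnerProductSpace.toDual ℝ (Space n) (moll ρ (gradient v) x) =
      ∫ z, ρ z • fderiv ℝ v (x + z) ∂torusMeasure n := by
    ext w
    rw [InnerProductSpace.toDual_apply_apply, real_inner_comm, moll, ← integral_inner hint,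
      ContinuousLinearMap.integral_apply h.1]
    congr 1; ext z
    simp [inner_smul_right]
  rw [hasGradientAt_iff_hasFDerivAt, hdual]
  exact h.2

theorem gradient_moll (hρ : IsMollifier δ ρ) {v : Space n → ℝ} {L : ℝ≥0}
    (hv : LipschitzWith L v) : gradient (moll ρ v) = moll ρ (gradient v) :=
  funext fun x => (hρ.hasGradientAt_moll hv x).gradient

end IsMollifier
end moll

/-- Mollification is self-adjoint. -/
theorem IsMollifier.integral_inner_moll {δ : ℝ} {ρ : Space n → ℝ} (hρ : IsMollifier δ ρ)
    {E : Type*} [NormedAddCommGroup E] [InnerProductSpace ℝ E] [CompleteSpace E]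
    {V W : Space n → E} (hV : Integrable V (torusMeasure n))
    (hW : Integrable W (torusMeasure n)) (hVp : LatticePeriodic V) (hWp : LatticePeriodic W) :
    ∫ x, inner ℝ (V x) (moll ρ W x) ∂torusMeasure n =
      ∫ x, inner ℝ (moll ρ V x) (W x) ∂torusMeasure n := by
  obtain ⟨C, hC0, hC⟩ := hρ.periodic.exists_bound hρ.smooth.continuous
  have hcont : ∀ x, Continuous fun y => ρ (y - x) := fun x =>
    hρ.smooth.continuous.comp (continuous_sub_right x)
  have hi : ∀ {F : Space n → E}, Integrable F (torusMeasure n) → ∀ x,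
      Integrable (fun y => ρ (y - x) • F y) (torusMeasure n) := fun hF x =>
    hF.bdd_smul C (hcont x).aestronglyMeasurable (ae_of_all _ fun y => hC _)
  have h1 : ∀ x, inner ℝ (V x) (moll ρ W x) =
      ∫ y, ρ (y - x) * inner ℝ (V x) (W y) ∂torusMeasure n := fun x => by
    rw [moll_eq_integral_sub hρ.periodic hWp, ← integral_inner (hi hW x)]
    simp [inner_smul_right]
  have h2 : ∀ y, inner ℝ (moll ρ V y) (W y) =
      ∫ x, ρ (y - x) * inner ℝ (V x) (W y) ∂torusMeasure n := fun y => by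
    rw [moll_eq_integral_sub hρ.periodic hVp, real_inner_comm, ← integral_inner (hi hV y)]
    congr 1; ext x
    -- Evenness of `ρ` makes the kernel symmetric in `x` and `y`; the rest is Fubini.
    rw [inner_smul_right, real_inner_comm, ← hρ.even, neg_sub]
  simp only [h1, h2]
  refine integral_integral_swap ?_
  have hVW : Integrable (fun z : Space n × Space n => inner ℝ (V z.1) (W z.2))
      ((torusMeasure n).prod (torusMeasure n)) := by
    refine Integrable.mono' (hV.norm.mul_prod hW.norm)
      (hV.aestronglyMeasurable.comp_fst.inner hW.aestronglyMeasurable.comp_snd)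
      (ae_of_all _ fun z => norm_inner_le_norm _ _)
  exact hVW.bdd_mul (c := C)
    (hρ.smooth.continuous.comp (continuous_snd.sub continuous_fst)).aestronglyMeasurable
    (ae_of_all _ fun z => hC _)

/-! ### A trace inequality and semiconcave functions -/

/-- The trace of `AS` may be computed in an eigenbasis of `A`, where it is `∑ μᵢ⟨Sbᵢ,bᵢ⟩` with `0 ≤
μᵢ ≤ Λ`. Nonnegativity of `μᵢ` makes a one-sided bound on `S` enough; nonnegativity of `c` then
allows `μᵢ` to be replaced by `Λ`. -/
theorem sum_inner_comp_le (A S : Space n →L[ℝ] Space n) {Λ c : ℝ} (hc : 0 ≤ c)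
    (hsymm : ∀ ξ ζ, inner ℝ (A ξ) ζ = inner ℝ ξ (A ζ))
    (hA0 : ∀ ξ, 0 ≤ inner ℝ (A ξ) ξ) (hA : ∀ ξ, inner ℝ (A ξ) ξ ≤ Λ * ‖ξ‖ ^ 2)
    (hS : ∀ ξ, inner ℝ (S ξ) ξ ≤ c * ‖ξ‖ ^ 2) :
    ∑ i, inner ℝ (A (S (EuclideanSpace.basisFun (Fin n) ℝ i)))
      (EuclideanSpace.basisFun (Fin n) ℝ i) ≤ n * (Λ * c) := by
  have hsym : (A : Space n →ₗ[ℝ] Space n).IsSymmetric := fun ξ ζ => hsymm ξ ζ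
  have hn : Module.finrank ℝ (Space n) = n := by simp
  set b := hsym.eigenvectorBasis hn
  have h1 := LinearMap.trace_eq_sum_inner
    ((A : Space n →ₗ[ℝ] Space n) ∘ₗ (S : Space n →ₗ[ℝ] Space n)) (EuclideanSpace.basisFun (Fin n) ℝ)
  rw [LinearMap.trace_eq_sum_inner _ b] at h1
  calc _ = ∑ i, inner ℝ (b i) (A (S (b i))) := by
        rw [show (∑ i, inner ℝ (b i) (A (S (b i)))) = _ from h1]
        exact Finset.sum_congr rfl fun i _ => real_inner_comm _ _
    _ ≤ ∑ i : Fin n, Λ * c := Finset.sum_le_sum fun i _ => by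
        have h2 : A (b i) = hsym.eigenvalues hn i • b i := hsym.apply_eigenvectorBasis hn i
        have hb : ‖b i‖ = 1 := b.norm_eq_one i
        have h3 := hA0 (b i)
        have h4 := hA (b i)
        have h5 := hS (b i)
        rw [h2, inner_smul_left, real_inner_self_eq_norm_sq, hb] at h3 h4
        rw [hb] at h5
        simp only [conj_trivial, one_pow, mul_one] at h3 h4 h5
        rw [← hsymm, h2, inner_smul_left, conj_trivial, real_inner_comm]
        calc _ ≤ hsym.eigenvalues hn i * c := mul_le_mul_of_nonneg_left h5 h3
          _ ≤ Λ * c := mul_le_mul_of_nonneg_right h4 hc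
    _ = n * (Λ * c) := by simp

/-- `D²U ≤ c Iₙ`, expressed without derivatives. -/
def SemiconcaveWith (c : ℝ) (U : Space n → ℝ) : Prop :=
  ∀ (x z : Space n) (a b : ℝ), 0 ≤ a → 0 ≤ b → a + b = 1 →
    a * U x + b * U z - U (a • x + b • z) ≤ c / 2 * (a * b) * ‖x - z‖ ^ 2

/-- For `a + b = 1`, `|ax + bz|² = a|x|² + b|z|² - ab|x - z|²`, so the quadratic correction
contributes exactly the right-hand side. -/
theorem semiconcaveWith_of_concaveOn {c : ℝ} {U : Space n → ℝ}
    (h : ConcaveOn ℝ univ fun x : Space n => U x - c / 2 * ‖x‖ ^ 2) : SemiconcaveWith c U := by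
  intro x z a b ha hb hab
  have h1 := h.2 (mem_univ x) (mem_univ z) ha hb hab
  simp only [smul_eq_mul] at h1
  have h2 : ‖a • x + b • z‖ ^ 2 = a * ‖x‖ ^ 2 + b * ‖z‖ ^ 2 - a * b * ‖x - z‖ ^ 2 := by
    rw [norm_add_sq_real, norm_sub_sq_real, norm_smul, norm_smul, inner_smul_left,
      inner_smul_right, mul_pow, mul_pow, Real.norm_eq_abs, Real.norm_eq_abs, sq_abs, sq_abs,
      conj_trivial]
    obtain rfl : b = 1 - a := by linarith
    ring
  rw [h2] at h1
  linarith

namespace SemiconcaveWith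

variable {c : ℝ} {U V : Space n → ℝ}

theorem mono (h : SemiconcaveWith c U) {c' : ℝ} (hc : c ≤ c') : SemiconcaveWith c' U :=
  fun x z a b ha hb hab => (h x z a b ha hb hab).trans (by gcongr)

theorem convexComb (hU : SemiconcaveWith c U) (hV : SemiconcaveWith c V) {θ : ℝ}
    (h0 : 0 ≤ θ) (h1 : θ ≤ 1) : SemiconcaveWith c fun x => θ * U x + (1 - θ) * V x := by
  intro x z a b ha hb hab
  have h2 := mul_le_mul_of_nonneg_left (hU x z a b ha hb hab) h0
  have h3 := mul_le_mul_of_nonneg_left (hV x z a b ha hb hab) (sub_nonneg.2 h1)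
  linarith

theorem moll (hU : SemiconcaveWith c U) (hc : Continuous U) {δ : ℝ} {ρ : Space n → ℝ}
    (hρ : IsMollifier δ ρ) : SemiconcaveWith c (moll ρ U) := by
  intro x z a b ha hb hab
  have hi := fun x => hρ.integrable_smul hc x
  have h1 : a * HJTorus.moll ρ U x + b * HJTorus.moll ρ U z - HJTorus.moll ρ U (a • x + b • z) =
      ∫ y, ρ y * (a * U (x + y) + b * U (z + y) - U (a • x + b • z + y)) ∂torusMeasure n := by
    simp only [HJTorus.moll]
    have hsub := integral_sub (((hi x).const_mul a).add ((hi z).const_mul b))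
      (hi (a • x + b • z))
    simp only [Pi.add_apply] at hsub
    rw [← integral_const_mul, ← integral_const_mul,
      ← integral_add ((hi x).const_mul a) ((hi z).const_mul b), ← hsub]
    congr 1; ext y
    simp only [smul_eq_mul]; ring
  rw [h1]
  calc _ ≤ ∫ y, ρ y * (c / 2 * (a * b) * ‖x - z‖ ^ 2) ∂torusMeasure n := by
        refine integral_mono (integrable_torus_of_continuous (hρ.smooth.continuous.mul
          (by fun_prop))) (hρ.integrable.mul_const _) fun y => ?_
        refine mul_le_mul_of_nonneg_left ?_ (hρ.nonneg y)
        have h2 := hU (x + y) (z + y) a b ha hb hab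
        have h3 : a • (x + y) + b • (z + y) = a • x + b • z + y := by
          rw [smul_add, smul_add, add_add_add_comm, ← add_smul, hab, one_smul]
        rwa [h3, add_sub_add_right_eq_sub] at h2
    _ = _ := by rw [integral_mul_const, hρ.integral_eq_one, one_mul]

theorem sub_le_inner (hU : SemiconcaveWith c U) {x p : Space n} (hp : HasGradientAt U p x)
    (h : Space n) : U (x + h) - U x ≤ inner ℝ p h + c / 2 * ‖h‖ ^ 2 := by
  have h1 := hp.hasFDerivAt.lim (c := fun k : ℕ => (k : ℝ) + 1) h (l := atTop) (by
    simp only [Real.norm_eq_abs]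
    exact tendsto_abs_atTop_atTop.comp (tendsto_atTop_add_const_right _ _
      tendsto_natCast_atTop_atTop))
  rw [InnerProductSpace.toDual_apply_apply] at h1
  have h2 := h1.add_const (c / 2 * ‖h‖ ^ 2)
  have h3 : Tendsto (fun k : ℕ => U (x + h) - U x + c / 2 * ‖h‖ ^ 2 * ((k : ℝ) + 1)⁻¹) atTop
      (𝓝 (U (x + h) - U x + c / 2 * ‖h‖ ^ 2 * 0)) :=
    ((tendsto_inv_atTop_zero.comp (tendsto_atTop_add_const_right _ (1 : ℝ)
      tendsto_natCast_atTop_atTop)).const_mul _).const_add _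
  rw [mul_zero, add_zero] at h3
  refine le_of_tendsto_of_tendsto' h3 h2 fun k => ?_
  have hk : (0 : ℝ) < (k : ℝ) + 1 := by positivity
  have hk1 : ((k : ℝ) + 1)⁻¹ ≤ 1 := inv_le_one_of_one_le₀ (by linarith [Nat.cast_nonneg (α := ℝ) k])
  -- The point at fraction `1/(k+1)` of the segment from `x` to `x + h`; multiplied by `k+1`, the
  -- inequality compares the full increment with a difference quotient at `x`.
  have h4 := hU x (x + h) (1 - ((k : ℝ) + 1)⁻¹) ((k : ℝ) + 1)⁻¹ (by linarith) (by positivity)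
    (by ring)
  have h5 : (1 - ((k : ℝ) + 1)⁻¹) • x + ((k : ℝ) + 1)⁻¹ • (x + h) = x + ((k : ℝ) + 1)⁻¹ • h := by
    module
  rw [h5, sub_add_cancel_left, norm_neg] at h4
  have h6 := mul_le_mul_of_nonneg_left h4 hk.le
  have h7 : ((k : ℝ) + 1) * ((k : ℝ) + 1)⁻¹ = 1 := mul_inv_cancel₀ hk.ne'
  rw [smul_eq_mul]
  set m := (k : ℝ) + 1
  set r := m⁻¹
  set X := U (x + r • h)
  have h8 : m * ((1 - r) * U x + r * U (x + h) - X) = m * (U x - X) + m * r * (U (x + h) - U x) := by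
    ring
  have h9 : m * (c / 2 * ((1 - r) * r) * ‖h‖ ^ 2) = m * r * (c / 2 * (1 - r) * ‖h‖ ^ 2) := by ring
  rw [h8, h9, h7] at h6
  linarith

/-- Adding the one-sided Taylor bounds based at `x` and at `x + h` gives a one-sided Lipschitz
estimate for the gradient, which passes to its derivative. -/
theorem inner_fderiv_gradient_le (hU : SemiconcaveWith c U) (hd : Differentiable ℝ U) {x : Space n}
    (hd2 : DifferentiableAt ℝ (gradient U) x) (ξ : Space n) :
    inner ℝ (fderiv ℝ (gradient U) x ξ) ξ ≤ c * ‖ξ‖ ^ 2 := by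
  have h1 := hd2.hasFDerivAt.lim (c := fun k : ℕ => (k : ℝ) + 1) ξ (l := atTop) (by
    simp only [Real.norm_eq_abs]
    exact tendsto_abs_atTop_atTop.comp (tendsto_atTop_add_const_right _ _
      tendsto_natCast_atTop_atTop))
  have h2 := h1.inner (𝕜 := ℝ) (tendsto_const_nhds (x := ξ))
  refine le_of_tendsto' h2 fun k => ?_
  have hk : (0 : ℝ) < (k : ℝ) + 1 := by positivity
  set m := (k : ℝ) + 1
  set h := m⁻¹ • ξ with hh
  have h3 := hU.sub_le_inner (hd x).hasGradientAt h
  have h4 := hU.sub_le_inner (hd (x + h)).hasGradientAt (-h)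
  rw [add_neg_cancel_right, norm_neg, inner_neg_right] at h4
  have h5 : inner ℝ (gradient U (x + h) - gradient U x) h ≤ c * ‖h‖ ^ 2 := by
    rw [inner_sub_left]; linarith
  have h6 : ξ = m • h := by rw [hh, smul_smul, mul_inv_cancel₀ hk.ne', one_smul]
  rw [h6, inner_smul_left, inner_smul_right, norm_smul, mul_pow, Real.norm_of_nonneg hk.le,
    conj_trivial]
  calc _ = m ^ 2 * inner ℝ (gradient U (x + h) - gradient U x) h := by ring
    _ ≤ m ^ 2 * (c * ‖h‖ ^ 2) := by gcongr
    _ = _ := by ring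

end SemiconcaveWith

/-- Gradients of uniformly semiconcave functions converge where the uniform limit is
differentiable. -/
theorem tendsto_gradient_of_semiconcave {c : ℝ} (hc : 0 ≤ c) {U : Space n → ℝ}
    {V : ℕ → Space n → ℝ} (hV : ∀ k, SemiconcaveWith c (V k)) {r : ℕ → ℝ}
    (hr : Tendsto r atTop (𝓝 0)) (hVU : ∀ k x, |V k x - U x| ≤ r k) {x : Space n}
    (hd : ∀ k, DifferentiableAt ℝ (V k) x) (hU : DifferentiableAt ℝ U x) :
    Tendsto (fun k => gradient (V k) x) atTop (𝓝 (gradient U x)) := by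
  rw [Metric.tendsto_atTop]
  intro η hη
  have h2 := (Asymptotics.isLittleO_iff.1 (hasFDerivAt_iff_isLittleO_nhds_zero.1
    hU.hasGradientAt.hasFDerivAt)) (show (0 : ℝ) < η / 4 by positivity)
  obtain ⟨s₀, hs₀, hs⟩ := Metric.eventually_nhds_iff.1 h2
  -- The step length keeps both the differentiability remainder of `U` and the semiconcavity term
  -- below `ηs/4`. It is fixed before `k`, so the sup distance `r k` can afterwards be made smaller
  -- than `ηs/8`.
  set s := min (s₀ / 2) (η / (2 * (c + 1)))
  have hs_pos : 0 < s := by positivity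
  have hs1 : s < s₀ := (min_le_left _ _).trans_lt (by linarith)
  have hs2 : c / 2 * s ≤ η / 4 := by
    have : s ≤ η / (2 * (c + 1)) := min_le_right _ _
    calc c / 2 * s ≤ c / 2 * (η / (2 * (c + 1))) := by gcongr
      _ = η / 4 * (c / (c + 1)) := by field_simp; ring
      _ ≤ η / 4 * 1 := by
        gcongr
        rw [div_le_one (by positivity)]; linarith
      _ = η / 4 := mul_one _
  obtain ⟨N, hN⟩ := (Metric.tendsto_atTop.1 hr) (η / 8 * s) (by positivity)
  refine ⟨N, fun k hk => ?_⟩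
  have hrk : r k < η / 8 * s := by
    have := hN k hk
    rw [Real.dist_eq, sub_zero] at this
    exact (le_abs_self _).trans_lt this
  rw [dist_eq_norm]
  set d := gradient (V k) x - gradient U x with hd_def
  by_cases hd0 : d = 0
  · rw [hd0, norm_zero]; exact hη
  have hdn : 0 < ‖d‖ := norm_pos_iff.2 hd0
  -- Semiconcavity bounds increments from above only, so the test direction is opposite to the
  -- gradient defect `d`: then `s‖d‖ = -⟨d,h⟩` is at most the sum of the three errors.
  set h : Space n := -(s / ‖d‖) • d with hh
  have hnorm : ‖h‖ = s := by
    rw [hh, norm_smul, norm_neg, Real.norm_of_nonneg (by positivity)]; field_simp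
  have h3 := hs (y := h) (by rw [dist_zero_right, hnorm]; exact hs1)
  rw [InnerProductSpace.toDual_apply_apply, hnorm, Real.norm_eq_abs] at h3
  have h4 := (hV k).sub_le_inner (hd k).hasGradientAt h
  have h5 := abs_le.1 (hVU k (x + h))
  have h6 := abs_le.1 (hVU k x)
  have h7 := abs_le.1 h3
  have h8 : inner ℝ d h = -(s * ‖d‖) := by
    rw [hh, inner_smul_right, real_inner_self_eq_norm_sq]; field_simp
  rw [hd_def, inner_sub_left, ← hd_def] at h8
  rw [hnorm] at h4
  have h9 : s * ‖d‖ ≤ s * (3 / 4 * η) := by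
    have : c / 2 * s ^ 2 ≤ η / 4 * s := by rw [pow_two, ← mul_assoc]; gcongr
    nlinarith
  have := le_of_mul_le_mul_left h9 hs_pos
  linarith

/-! ### The Hamiltonian at a fixed time -/

theorem gradient_eq_comp (v : Space n → ℝ) :
    gradient v = (InnerProductSpace.toDual ℝ (Space n)).symm ∘ fderiv ℝ v := rfl

theorem contDiff_gradient {v : Space n → ℝ} {m k : WithTop ℕ∞} (hv : ContDiff ℝ m v)
    (hk : k + 1 ≤ m) : ContDiff ℝ k (gradient v) :=
  (InnerProductSpace.toDual ℝ (Space n)).symm.toContinuousLinearEquiv.contDiff.comp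
    (hv.fderiv_right hk)

/-- Regularity of a Hamiltonian `h(x,p)` at a fixed time. -/
structure IsSliceHamiltonian (R C Λ : ℝ≥0) (h : Space n → Space n → ℝ) : Prop where
  periodic : ∀ p, LatticePeriodic fun x => h x p
  contDiff : ∀ x, ContDiff ℝ 2 (h x)
  continuous_gradient : ∀ p, Continuous fun x => gradient (h x) p
  norm_gradient_le : ∀ p, ‖p‖ ≤ R → ∀ x, ‖gradient (h x) p‖ ≤ C
  lipschitz_gradient : ∀ p, ‖p‖ ≤ R → LipschitzWith C fun x => gradient (h x) p
  hessian_nonneg : ∀ x p ξ, 0 ≤ iteratedFDeriv ℝ 2 (h x) p ![ξ, ξ]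
  hessian_le : ∀ x p ξ, iteratedFDeriv ℝ 2 (h x) p ![ξ, ξ] ≤ Λ * ‖ξ‖ ^ 2

namespace IsSliceHamiltonian

variable {R C Λ : ℝ≥0} {h : Space n → Space n → ℝ}

theorem contDiff_gradient (hh : IsSliceHamiltonian R C Λ h) (x : Space n) :
    ContDiff ℝ 1 (gradient (h x)) :=
  HJTorus.contDiff_gradient (hh.contDiff x) (by norm_num)

theorem inner_fderiv_gradient (hh : IsSliceHamiltonian R C Λ h) (x p ξ ζ : Space n) :
    inner ℝ (fderiv ℝ (gradient (h x)) p ξ) ζ = iteratedFDeriv ℝ 2 (h x) p ![ξ, ζ] := by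
  rw [iteratedFDeriv_two_apply, gradient_eq_comp]
  have hd : DifferentiableAt ℝ (fderiv ℝ (h x)) p :=
    (((hh.contDiff x).fderiv_right (m := 1) (by norm_num)).differentiable (by norm_num)) p
  have h1 := ((InnerProductSpace.toDual ℝ (Space n)).symm.toContinuousLinearEquiv.hasFDerivAt.comp
    p hd.hasFDerivAt).fderiv
  have h2 : fderiv ℝ ((InnerProductSpace.toDual ℝ (Space n)).symm ∘ fderiv ℝ (h x)) p ξ =
      (InnerProductSpace.toDual ℝ (Space n)).symm (fderiv ℝ (fderiv ℝ (h x)) p ξ) :=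
    DFunLike.congr_fun h1 ξ
  rw [h2, InnerProductSpace.toDual_symm_apply]
  rfl

theorem inner_fderiv_symm (hh : IsSliceHamiltonian R C Λ h) (x p ξ ζ : Space n) :
    inner ℝ (fderiv ℝ (gradient (h x)) p ξ) ζ = inner ℝ ξ (fderiv ℝ (gradient (h x)) p ζ) := by
  rw [hh.inner_fderiv_gradient, real_inner_comm, hh.inner_fderiv_gradient,
    iteratedFDeriv_two_apply, iteratedFDeriv_two_apply]
  exact ((hh.contDiff x).contDiffAt.isSymmSndFDerivAt (by simp)) ξ ζ

/-- A symmetric positive semidefinite operator is bounded in norm by the supremum of its quadratic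
form. -/
theorem norm_fderiv_gradient_le (hh : IsSliceHamiltonian R C Λ h) (x p : Space n) :
    ‖fderiv ℝ (gradient (h x)) p‖ ≤ Λ := by
  set A := fderiv ℝ (gradient (h x)) p
  have h0 : ∀ ξ, 0 ≤ inner ℝ (A ξ) ξ := fun ξ => by
    rw [hh.inner_fderiv_gradient]; exact hh.hessian_nonneg x p ξ
  have h1 : ∀ ξ, inner ℝ (A ξ) ξ ≤ Λ * ‖ξ‖ ^ 2 := fun ξ => by
    rw [hh.inner_fderiv_gradient]; exact hh.hessian_le x p ξ
  have hs : (A : Space n →ₗ[ℝ] Space n).IsSymmetric := fun ξ ζ => hh.inner_fderiv_symm x p ξ ζ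
  refine ContinuousLinearMap.opNorm_le_bound _ Λ.2 fun ξ => ?_
  -- Cauchy–Schwarz for the semidefinite form `⟨A·,·⟩` applied to `ξ` and `Aξ`, obtained from the
  -- discriminant of a nonnegative quadratic.
  have h2 : ‖A ξ‖ ^ 2 * ‖A ξ‖ ^ 2 ≤ inner ℝ (A ξ) ξ * inner ℝ (A (A ξ)) (A ξ) := by
    have hq : ∀ t : ℝ, 0 ≤ inner ℝ (A (A ξ)) (A ξ) * (t * t) + 2 * ‖A ξ‖ ^ 2 * t
        + inner ℝ (A ξ) ξ := fun t => by
      have := h0 (ξ + t • A ξ)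
      have h3 : inner ℝ (A (A ξ)) ξ = ‖A ξ‖ ^ 2 := by
        rw [← real_inner_self_eq_norm_sq]; exact hs (A ξ) ξ
      simp only [map_add, map_smul, inner_add_left, inner_add_right, inner_smul_left,
        inner_smul_right, conj_trivial, h3, real_inner_self_eq_norm_sq] at this
      linarith
    have := discrim_le_zero hq
    rw [discrim] at this
    nlinarith
  have h3 := h1 ξ
  have h4 := h1 (A ξ)
  have h5 : ‖A ξ‖ ^ 2 * ‖A ξ‖ ^ 2 ≤ (Λ * ‖ξ‖ ^ 2) * (Λ * ‖A ξ‖ ^ 2) :=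
    h2.trans (mul_le_mul h3 h4 (h0 _) (by positivity))
  by_cases hz : ‖A ξ‖ = 0
  · rw [hz]; positivity
  have hpos : 0 < ‖A ξ‖ ^ 2 := by positivity
  have h6 : ‖A ξ‖ ^ 2 ≤ (Λ * ‖ξ‖) ^ 2 := by
    refine le_of_mul_le_mul_right ?_ hpos
    calc _ ≤ _ := h5
      _ = _ := by ring
  exact abs_le_of_sq_le_sq' h6 (by positivity) |>.2

theorem lipschitzWith_gradient (hh : IsSliceHamiltonian R C Λ h) (x : Space n) :
    LipschitzWith Λ (gradient (h x)) :=
  lipschitzWith_of_nnnorm_fderiv_le ((hh.contDiff_gradient x).differentiable (by norm_num))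
    fun p => hh.norm_fderiv_gradient_le x p

theorem gradient_periodic (hh : IsSliceHamiltonian R C Λ h) (k : Fin n → ℤ) (x : Space n) :
    gradient (h (x + latticePoint k)) = gradient (h x) := by
  congr 1; ext p; exact hh.periodic p k x

/-- A Carathéodory argument: the gradient is continuous in `p` for each `x` and measurable in `x`
for each `p`. -/
theorem measurable_gradient (hh : IsSliceHamiltonian R C Λ h) :
    Measurable fun z : Space n × Space n => gradient (h z.2) z.1 :=
  measurable_uncurry_of_continuous_of_measurable (u := fun p x => gradient (h x) p)
    (fun x => (hh.lipschitzWith_gradient x).continuous)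
    (fun p => (hh.continuous_gradient p).measurable)

theorem integral_sub_inner_eq_integral (hh : IsSliceHamiltonian R C Λ h) (x p₁ p₂ : Space n) :
    h x p₁ - h x p₂ =
      ∫ θ in (0 : ℝ)..1, inner ℝ (gradient (h x) (θ • p₁ + (1 - θ) • p₂)) (p₁ - p₂) := by
  have hd : ∀ θ : ℝ, HasDerivAt (fun θ : ℝ => h x (θ • p₁ + (1 - θ) • p₂))
      (inner ℝ (gradient (h x) (θ • p₁ + (1 - θ) • p₂)) (p₁ - p₂)) θ := fun θ => by
    have h1 : HasDerivAt (fun θ : ℝ => θ • p₁ + (1 - θ) • p₂) (p₁ - p₂) θ := by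
      refine (((hasDerivAt_id' θ).smul_const p₁).add
        (((hasDerivAt_id' θ).const_sub 1).smul_const p₂)).congr_deriv ?_
      rw [one_smul, neg_one_smul, sub_eq_add_neg]
    have h2 := ((hh.contDiff x).differentiable (by norm_num)
      (θ • p₁ + (1 - θ) • p₂)).hasGradientAt.hasFDerivAt.comp_hasDerivAt θ h1
    exact h2
  have hcont : Continuous fun θ : ℝ =>
      inner ℝ (gradient (h x) (θ • p₁ + (1 - θ) • p₂)) (p₁ - p₂) := by
    have := (hh.lipschitzWith_gradient x).continuous
    fun_prop
  rw [intervalIntegral.integral_eq_sub_of_hasDerivAt (fun θ _ => hd θ)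
    (hcont.intervalIntegrable _ _)]
  simp

end IsSliceHamiltonian

/-! ### Upper bounds for the divergence of the drift -/

theorem abs_inner_basisFun_le (i : Fin n) (y : Space n) :
    |inner ℝ y (EuclideanSpace.basisFun (Fin n) ℝ i)| ≤ ‖y‖ := by
  have := abs_real_inner_le_norm y (EuclideanSpace.basisFun (Fin n) ℝ i)
  rwa [OrthonormalBasis.norm_eq_one, mul_one] at this

theorem sum_inner_mul_inner_basisFun (y z : Space n) :
    ∑ i, inner ℝ y (EuclideanSpace.basisFun (Fin n) ℝ i) *
      inner ℝ z (EuclideanSpace.basisFun (Fin n) ℝ i) = inner ℝ y z := by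
  rw [← (EuclideanSpace.basisFun (Fin n) ℝ).sum_inner_mul_inner y z]
  exact Finset.sum_congr rfl fun i _ => by rw [real_inner_comm z]

theorem tendsto_norm_natCast_add_one : Tendsto (fun k : ℕ => ‖(k : ℝ) + 1‖) atTop atTop := by
  simp only [Real.norm_eq_abs]
  exact tendsto_abs_atTop_atTop.comp (tendsto_atTop_add_const_right _ _
    tendsto_natCast_atTop_atTop)

/-- The distributional divergence of `b` is bounded above by the limit of its difference
quotients. -/
theorem neg_integral_inner_gradient_le {b : Space n → Space n} (hb : LatticePeriodic b)
    (hbm : Measurable b) {C M : ℝ} (hC : ∀ x, ‖b x‖ ≤ C) {G : ℕ → Space n → ℝ}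
    (hG : ∀ k, Measurable (G k))
    (hbG : ∀ (k : ℕ) x, ∑ i, ((k : ℝ) + 1) * inner ℝ (b (x + ((k : ℝ) + 1)⁻¹ •
      EuclideanSpace.basisFun (Fin n) ℝ i) - b x) (EuclideanSpace.basisFun (Fin n) ℝ i) ≤ G k x)
    (hGM : ∀ k x, |G k x| ≤ M) {g : Space n → ℝ} (hg : ∀ x, Tendsto (fun k => G k x) atTop (𝓝 (g x)))
    {K : ℝ} (hgK : ∀ x, g x ≤ K) {v : Space n → ℝ} (hv : LatticePeriodic v) {L : ℝ≥0}
    (hL : LipschitzWith L v) (hv0 : ∀ x, 0 ≤ v x) :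
    -∫ x, inner ℝ (b x) (gradient v x) ∂torusMeasure n ≤ K * ∫ x, v x ∂torusMeasure n := by
  set e := EuclideanSpace.basisFun (Fin n) ℝ
  obtain ⟨V, hV0, hV⟩ := hv.exists_bound hL.continuous
  have hC0 : 0 ≤ C := (norm_nonneg _).trans (hC 0)
  have hk0 : ∀ k : ℕ, (0 : ℝ) < (k : ℝ) + 1 := fun k => by positivity
  -- Backward quotients are taken on `v`, so that translation invariance of the integral turns them
  -- into the forward quotients on `b` that the hypothesis controls.
  set D : ℕ → Space n → ℝ := fun k x => ∑ i, inner ℝ (b x) (e i) *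
    (((k : ℝ) + 1) * (v x - v (x - ((k : ℝ) + 1)⁻¹ • e i)))
  have hvm : Measurable v := hL.continuous.measurable
  have hDm : ∀ k, Measurable (D k) := fun k => by
    refine Finset.measurable_sum _ fun i _ => ?_
    refine Measurable.mul (by fun_prop) (((hvm.sub
      (hvm.comp (measurable_sub_const _)))).const_mul _)
  have hDb : ∀ k x, ‖D k x‖ ≤ n * (C * L) := fun k x => by
    refine (norm_sum_le _ _).trans ?_
    calc _ ≤ ∑ i : Fin n, C * L := Finset.sum_le_sum fun i _ => by
          rw [norm_mul, norm_mul, Real.norm_of_nonneg (hk0 k).le]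
          have h1 := hL.norm_sub_le x (x - ((k : ℝ) + 1)⁻¹ • e i)
          rw [sub_sub_cancel, norm_smul, OrthonormalBasis.norm_eq_one, mul_one, norm_inv,
            Real.norm_of_nonneg (hk0 k).le] at h1
          refine mul_le_mul ((abs_inner_basisFun_le i _).trans (hC x)) ?_ (by positivity) hC0
          calc _ ≤ ((k : ℝ) + 1) * (L * ((k : ℝ) + 1)⁻¹) :=
                mul_le_mul_of_nonneg_left h1 (hk0 k).le
            _ = L := by rw [mul_left_comm, mul_inv_cancel₀ (hk0 k).ne', mul_one]
      _ = _ := by simp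
  have hDlim : ∀ᵐ x ∂torusMeasure n, Tendsto (fun k => D k x) atTop
      (𝓝 (inner ℝ (b x) (gradient v x))) := by
    filter_upwards [ae_torus_of_ae hL.ae_differentiableAt] with x hx
    rw [← sum_inner_mul_inner_basisFun]
    refine tendsto_finsetSum _ fun i _ => Tendsto.const_mul _ ?_
    have h1 := (hx.hasGradientAt.hasFDerivAt.lim (-e i) tendsto_norm_natCast_add_one).neg
    rw [map_neg, neg_neg, InnerProductSpace.toDual_apply_apply] at h1
    refine h1.congr fun k => ?_
    rw [smul_eq_mul, smul_neg, ← sub_eq_add_neg]; ring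
  have hlim1 := tendsto_integral_of_dominated_convergence (μ := torusMeasure n)
    (fun _ => n * (C * L)) (fun k => (hDm k).aestronglyMeasurable) (integrable_const _)
    (fun k => ae_of_all _ (hDb k)) hDlim
  have hlim2 : Tendsto (fun k => ∫ x, v x * G k x ∂torusMeasure n) atTop
      (𝓝 (∫ x, v x * g x ∂torusMeasure n)) :=
    tendsto_integral_of_dominated_convergence (fun _ => V * M)
      (fun k => (hvm.mul (hG k)).aestronglyMeasurable) (integrable_const _)
      (fun k => ae_of_all _ fun x => by
        rw [norm_mul]; exact mul_le_mul (hV x) (hGM k x) (norm_nonneg _) hV0)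
      (ae_of_all _ fun x => (hg x).const_mul _)
  have hgm : Measurable g := measurable_of_tendsto_metrizable hG (tendsto_pi_nhds.2 hg)
  have hgM : ∀ x, |g x| ≤ M := fun x =>
    le_of_tendsto' (hg x).abs fun k => hGM k x
  have hstep : ∀ k, -∫ x, D k x ∂torusMeasure n ≤ ∫ x, v x * G k x ∂torusMeasure n := fun k => by
    have hint : ∀ (i : Fin n) (y z : Space n),
        Integrable (fun x => inner ℝ (b (x + y)) (e i) * (((k : ℝ) + 1) * v (x + z)))
          (torusMeasure n) := fun i y z => by
      refine integrable_torus_of_bounded (C := C * (((k : ℝ) + 1) * V)) ?_ fun x => ?_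
      · exact (Measurable.mul ((hbm.comp (measurable_add_const y)).inner_const)
          ((hvm.comp (measurable_add_const z)).const_mul _)).aestronglyMeasurable
      · rw [norm_mul, norm_mul, Real.norm_of_nonneg (hk0 k).le]
        exact mul_le_mul ((abs_inner_basisFun_le i _).trans (hC _))
          (mul_le_mul_of_nonneg_left (hV _) (hk0 k).le) (by positivity) hC0
    have h1 : ∫ x, D k x ∂torusMeasure n = ∑ i, (∫ x, inner ℝ (b x) (e i) *
        (((k : ℝ) + 1) * v x) ∂torusMeasure n - ∫ x, inner ℝ (b (x + ((k : ℝ) + 1)⁻¹ • e i)) (e i) *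
        (((k : ℝ) + 1) * v x) ∂torusMeasure n) := by
      have h00 := fun i => hint i 0 0
      simp only [add_zero] at h00
      have h01 := fun i => hint i 0 (-(((k : ℝ) + 1)⁻¹ • e i))
      simp only [add_zero, ← sub_eq_add_neg] at h01
      have h2 : ∀ x, D k x = ∑ i, (inner ℝ (b x) (e i) * (((k : ℝ) + 1) * v x) -
          inner ℝ (b x) (e i) * (((k : ℝ) + 1) * v (x - ((k : ℝ) + 1)⁻¹ • e i))) := fun x =>
        Finset.sum_congr rfl fun i _ => by ring
      simp only [h2]
      have h3 : ∀ i, Integrable (fun x => inner ℝ (b x) (e i) * (((k : ℝ) + 1) * v x) -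
          inner ℝ (b x) (e i) * (((k : ℝ) + 1) * v (x - ((k : ℝ) + 1)⁻¹ • e i)))
          (torusMeasure n) := fun i => (h00 i).sub (h01 i)
      rw [integral_finsetSum _ fun i _ => h3 i]
      refine Finset.sum_congr rfl fun i _ => ?_
      rw [integral_sub (h00 i) (h01 i)]
      congr 1
      have hp : LatticePeriodic fun x => inner ℝ (b x) (e i) *
          (((k : ℝ) + 1) * v (x - ((k : ℝ) + 1)⁻¹ • e i)) := fun j x => by
        simp only [hb j x, add_sub_right_comm x, hv j]
      rw [← hp.integral_add (((k : ℝ) + 1)⁻¹ • e i)]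
      simp
    have h00 := fun i => hint i 0 0
    simp only [add_zero] at h00
    have h10 := fun i => hint i (((k : ℝ) + 1)⁻¹ • e i) 0
    simp only [add_zero] at h10
    have h3 : ∀ i, Integrable (fun x => inner ℝ (b (x + ((k : ℝ) + 1)⁻¹ • e i)) (e i) *
        (((k : ℝ) + 1) * v x) - inner ℝ (b x) (e i) * (((k : ℝ) + 1) * v x))
        (torusMeasure n) := fun i => (h10 i).sub (h00 i)
    rw [h1, ← Finset.sum_neg_distrib]
    simp only [neg_sub, ← integral_sub (h10 _) (h00 _)]
    rw [← integral_finsetSum _ fun i _ => h3 i]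
    refine integral_mono (integrable_finsetSum _ fun i _ => h3 i)
      (integrable_torus_of_bounded (C := V * M) (hvm.mul (hG k)).aestronglyMeasurable
        fun x => ?_) fun x => ?_
    · rw [norm_mul]; exact mul_le_mul (hV x) (hGM k x) (norm_nonneg _) hV0
    · refine le_of_eq_of_le ?_ (mul_le_mul_of_nonneg_left (hbG k x) (hv0 x))
      rw [Finset.mul_sum]
      refine Finset.sum_congr rfl fun i _ => ?_
      rw [inner_sub_left]; ring
  have hfin : ∫ x, v x * g x ∂torusMeasure n ≤ K * ∫ x, v x ∂torusMeasure n := by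
    rw [mul_comm, ← integral_mul_const]
    refine integral_mono (integrable_torus_of_bounded (C := V * M)
      (hvm.mul hgm).aestronglyMeasurable fun x => ?_)
      ((integrable_torus_of_continuous hL.continuous).mul_const _)
      fun x => mul_le_mul_of_nonneg_left (hgK x) (hv0 x)
    rw [norm_mul]; exact mul_le_mul (hV x) (hgM x) (norm_nonneg _) hV0
  exact (le_of_tendsto_of_tendsto' hlim1.neg hlim2 hstep).trans hfin

namespace IsSliceHamiltonian

variable {R C Λ : ℝ≥0} {h : Space n → Space n → ℝ}

theorem measurable_gradient_comp (hh : IsSliceHamiltonian R C Λ h) {q : Space n → Space n}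
    (hq : Measurable q) : Measurable fun x => gradient (h x) (q x) :=
  hh.measurable_gradient.comp (hq.prodMk measurable_id)

/-- The divergence bound for the drift `D_pH(x,DU)` along a smooth semiconcave function `U`. -/
theorem neg_integral_drift_le_of_smooth (hh : IsSliceHamiltonian R C Λ h) {U : Space n → ℝ}
    (hU : ContDiff ℝ ((⊤ : ℕ∞) : WithTop ℕ∞) U) (hUp : LatticePeriodic U) (hUL : LipschitzWith R U)
    {c : ℝ} (hc : 0 ≤ c) (hUc : SemiconcaveWith c U) {v : Space n → ℝ} (hv : LatticePeriodic v)
    {L : ℝ≥0} (hL : LipschitzWith L v) (hv0 : ∀ x, 0 ≤ v x) :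
    -∫ x, inner ℝ (gradient (h x) (gradient U x)) (gradient v x) ∂torusMeasure n ≤
      (n * C + n * (Λ * c)) * ∫ x, v x ∂torusMeasure n := by
  set e := EuclideanSpace.basisFun (Fin n) ℝ
  set q := gradient U
  have hq1 : ContDiff ℝ 1 q := HJTorus.contDiff_gradient (contDiff_infty.1 hU 2) (by norm_num)
  have hqd : Differentiable ℝ q := hq1.differentiable (by norm_num)
  have hqR : ∀ x, ‖q x‖ ≤ R := norm_gradient_le_of_lipschitz hUL
  have hqp : LatticePeriodic q := hUp.gradient
  obtain ⟨M, hM0, hM⟩ : ∃ M : ℝ, 0 ≤ M ∧ ∀ x, ‖fderiv ℝ q x‖ ≤ M := by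
    refine LatticePeriodic.exists_bound (fun k x => ?_) (hq1.continuous_fderiv (by norm_num))
    have : (fun y => q (y + latticePoint k)) = q := funext fun y => hqp k y
    rw [← fderiv_comp_add_right, this]
  have hqL : LipschitzWith ⟨M, hM0⟩ q := lipschitzWith_of_nnnorm_fderiv_le hqd hM
  have hk0 : ∀ k : ℕ, (0 : ℝ) < (k : ℝ) + 1 := fun k => by positivity
  -- The increment of the drift is split at `D_pH(x, q(y))`, where `y = x + eᵢ/(k+1)`. The variation
  -- in `x` is only Lipschitz, so its quotient need not converge and is replaced by the bound `C`
  -- for each coordinate; the variation in `p` converges by the chain rule. `M` serves only for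
  -- dominated convergence and does not enter the final constant.
  refine neg_integral_inner_gradient_le (b := fun x => gradient (h x) (q x)) (C := C)
    (M := n * C + n * (Λ * M))
    (G := fun k x => n * C + ∑ i, inner ℝ (((k : ℝ) + 1) • (gradient (h x)
      (q (x + ((k : ℝ) + 1)⁻¹ • e i)) - gradient (h x) (q x))) (e i))
    (g := fun x => n * C + ∑ i, inner ℝ (fderiv ℝ (gradient (h x)) (q x) (fderiv ℝ q x (e i)))
      (e i)) (fun k x => ?_) (hh.measurable_gradient_comp hq1.continuous.measurable)
    (fun x => hh.norm_gradient_le _ (hqR x) x) (fun k => ?_) (fun k x => ?_) (fun k x => ?_)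
    (fun x => ?_) (fun x => ?_) hv hL hv0
  · simp only [hqp k x]
    exact congrFun (hh.gradient_periodic k x) _
  · refine measurable_const.add (Finset.measurable_sum _ fun i _ => ?_)
    have h1 : Measurable fun x => gradient (h x) (q (x + ((k : ℝ) + 1)⁻¹ • e i)) :=
      hh.measurable_gradient_comp (hq1.continuous.measurable.comp (measurable_add_const _))
    have h2 : Measurable fun x => gradient (h x) (q x) :=
      hh.measurable_gradient_comp hq1.continuous.measurable
    exact Measurable.inner ((h1.sub h2).const_smul ((k : ℝ) + 1)) measurable_const
  · have h1 : (n : ℝ) * C = ∑ i : Fin n, (C : ℝ) := by simp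
    rw [h1, ← Finset.sum_add_distrib]
    refine Finset.sum_le_sum fun i _ => ?_
    set y := x + ((k : ℝ) + 1)⁻¹ • e i with hy
    have h2 := (hh.lipschitz_gradient _ (hqR y)).norm_sub_le y x
    rw [hy, add_sub_cancel_left, ← hy, norm_smul, OrthonormalBasis.norm_eq_one, mul_one, norm_inv,
      Real.norm_of_nonneg (hk0 k).le] at h2
    have h3 := (le_abs_self _).trans (abs_inner_basisFun_le i
      (gradient (h y) (q y) - gradient (h x) (q y)))
    have h4 : ((k : ℝ) + 1) * inner ℝ (gradient (h y) (q y) - gradient (h x) (q y)) (e i) ≤ C := by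
      calc _ ≤ ((k : ℝ) + 1) * (C * ((k : ℝ) + 1)⁻¹) :=
            mul_le_mul_of_nonneg_left (h3.trans h2) (hk0 k).le
        _ = C := by rw [mul_left_comm, mul_inv_cancel₀ (hk0 k).ne', mul_one]
    rw [inner_smul_left, conj_trivial]
    simp only [inner_sub_left] at h4 ⊢
    linarith
  · refine (abs_add_le _ _).trans ?_
    rw [abs_of_nonneg (by positivity)]
    gcongr
    refine (Finset.abs_sum_le_sum_abs _ _).trans ?_
    calc _ ≤ ∑ i : Fin n, (Λ : ℝ) * M := Finset.sum_le_sum fun i _ => by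
          refine (abs_inner_basisFun_le i _).trans ?_
          rw [norm_smul, Real.norm_of_nonneg (hk0 k).le]
          have h1 := (hh.lipschitzWith_gradient x).norm_sub_le (q (x + ((k : ℝ) + 1)⁻¹ • e i)) (q x)
          have h2 := hqL.norm_sub_le (x + ((k : ℝ) + 1)⁻¹ • e i) x
          rw [add_sub_cancel_left, norm_smul, OrthonormalBasis.norm_eq_one, mul_one, norm_inv,
            Real.norm_of_nonneg (hk0 k).le] at h2
          calc _ ≤ ((k : ℝ) + 1) * (Λ * (M * ((k : ℝ) + 1)⁻¹)) :=
                mul_le_mul_of_nonneg_left (h1.trans (mul_le_mul_of_nonneg_left h2 Λ.2)) (hk0 k).le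
            _ = Λ * M * (((k : ℝ) + 1) * ((k : ℝ) + 1)⁻¹) := by ring
            _ = Λ * M := by rw [mul_inv_cancel₀ (hk0 k).ne', mul_one]
      _ = _ := by simp
  · refine (tendsto_finsetSum _ fun i _ => ?_).const_add _
    have h1 : HasFDerivAt (fun y => gradient (h x) (q y))
        ((fderiv ℝ (gradient (h x)) (q x)).comp (fderiv ℝ q x)) x :=
      (((hh.contDiff_gradient x).differentiable (by norm_num)) (q x)).hasFDerivAt.comp x
        (hqd x).hasFDerivAt
    have h2 := h1.lim (e i) tendsto_norm_natCast_add_one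
    rw [ContinuousLinearMap.comp_apply] at h2
    exact Tendsto.inner h2 tendsto_const_nhds
  · gcongr
    refine sum_inner_comp_le _ _ hc (hh.inner_fderiv_symm x (q x)) (fun ξ => ?_) (fun ξ => ?_)
      fun ξ => hUc.inner_fderiv_gradient_le (hU.differentiable (by norm_num)) (hqd x) ξ
    · rw [hh.inner_fderiv_gradient]; exact hh.hessian_nonneg x _ ξ
    · rw [hh.inner_fderiv_gradient]; exact hh.hessian_le x _ ξ

/-- The divergence bound for the drift `D_pH(x,DU)` along a semiconcave function `U`. -/
theorem neg_integral_drift_le (hh : IsSliceHamiltonian R C Λ h) {U : Space n → ℝ}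
    (hUp : LatticePeriodic U) (hUL : LipschitzWith R U)
    {c : ℝ} (hc : 0 ≤ c) (hUc : SemiconcaveWith c U) {v : Space n → ℝ} (hv : LatticePeriodic v)
    {L : ℝ≥0} (hL : LipschitzWith L v) (hv0 : ∀ x, 0 ≤ v x) :
    -∫ x, inner ℝ (gradient (h x) (gradient U x)) (gradient v x) ∂torusMeasure n ≤
      (n * C + n * (Λ * c)) * ∫ x, v x ∂torusMeasure n := by
  have hδ : ∀ k : ℕ, (0 : ℝ) < 1 / ((k : ℝ) + 1) := fun k => by positivity
  choose ρ hρ using fun k => exists_isMollifier n (hδ k)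
  have hUkL : ∀ k, LipschitzWith R (moll (ρ k) U) := fun k => (hρ k).lipschitz_moll hUL
  have hsm : ∀ k, ContDiff ℝ ((⊤ : ℕ∞) : WithTop ℕ∞) (moll (ρ k) U) := fun k =>
    (hρ k).contDiff_moll hUL.continuous hUp
  have hUkc : ∀ k, SemiconcaveWith c (moll (ρ k) U) := fun k => hUc.moll hUL.continuous (hρ k)
  have hlim := tendsto_integral_of_dominated_convergence (μ := torusMeasure n)
    (F := fun k x => inner ℝ (gradient (h x) (gradient (moll (ρ k) U) x)) (gradient v x))
    (f := fun x => inner ℝ (gradient (h x) (gradient U x)) (gradient v x))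
    (fun _ => C * L)
    (fun k => ((hh.measurable_gradient_comp (HJTorus.measurable_gradient _)).inner
      (HJTorus.measurable_gradient v)).aestronglyMeasurable) (integrable_const _)
    (fun k => ae_of_all _ fun x => (norm_inner_le_norm _ _).trans (mul_le_mul
      (hh.norm_gradient_le _ (norm_gradient_le_of_lipschitz (hUkL k) x) x)
      (norm_gradient_le_of_lipschitz hL x) (norm_nonneg _) C.2))
    (by
      filter_upwards [ae_torus_of_ae hUL.ae_differentiableAt] with x hx
      refine Tendsto.inner ?_ tendsto_const_nhds
      -- The drift is nonlinear in the gradient, so weak convergence would not do; the common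
      -- semiconcavity constant gives pointwise convergence wherever `U` is differentiable.
      refine ((hh.lipschitzWith_gradient x).continuous.tendsto _).comp ?_
      refine tendsto_gradient_of_semiconcave hc hUkc
        (r := fun k : ℕ => R * (1 / ((k : ℝ) + 1))) ?_
        (fun k y => (hρ k).norm_moll_sub_le hUp hUL y)
        (fun k => (hsm k).differentiable (by norm_num) x) hx
      simpa using (tendsto_one_div_add_atTop_nhds_zero_nat (𝕜 := ℝ)).const_mul (R : ℝ))
  exact le_of_tendsto' hlim.neg fun k =>
    hh.neg_integral_drift_le_of_smooth (hsm k) hUp.moll (hUkL k) hc (hUkc k) hv hL hv0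

/-- The divergence bound for the linearized transport term of two semiconcave functions. -/
theorem neg_integral_sub_mul_le (hh : IsSliceHamiltonian R C Λ h) {u₁ u₂ : Space n → ℝ}
    (h1p : LatticePeriodic u₁) (h2p : LatticePeriodic u₂)
    (h1L : LipschitzWith R u₁) (h2L : LipschitzWith R u₂) {c : ℝ} (hc : 0 ≤ c)
    (h1c : SemiconcaveWith c u₁) (h2c : SemiconcaveWith c u₂) {Φ Φ' : ℝ → ℝ}
    (hΦ : ∀ s, HasDerivAt Φ (Φ' s) s) (hΦ1 : ∀ s, |Φ' s| ≤ 1) (hΦ0 : ∀ s, 0 ≤ Φ s) :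
    -∫ x, (h x (gradient u₁ x) - h x (gradient u₂ x)) * Φ' (u₁ x - u₂ x) ∂torusMeasure n ≤
      (n * C + n * (Λ * c)) * ∫ x, Φ (u₁ x - u₂ x) ∂torusMeasure n := by
  set v : Space n → ℝ := fun x => Φ (u₁ x - u₂ x) with hv
  have hΦL : LipschitzWith 1 Φ := lipschitzWith_of_nnnorm_deriv_le
    (fun s => (hΦ s).differentiableAt) fun s => by rw [(hΦ s).deriv]; exact hΦ1 s
  have hvL : LipschitzWith (1 * (R + R)) v := hΦL.comp (h1L.sub h2L)
  have hvp : LatticePeriodic v := fun k x => by simp only [hv, h1p k x, h2p k x]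
  set f : Space n → ℝ → ℝ := fun x θ => inner ℝ
    (gradient (h x) (θ • gradient u₁ x + (1 - θ) • gradient u₂ x)) (gradient v x) with hf
  have hqR : ∀ θ ∈ Icc (0 : ℝ) 1, ∀ x, ‖θ • gradient u₁ x + (1 - θ) • gradient u₂ x‖ ≤ R := by
    intro θ hθ x
    refine (norm_add_le _ _).trans ?_
    rw [norm_smul, norm_smul, Real.norm_of_nonneg hθ.1, Real.norm_of_nonneg (sub_nonneg.2 hθ.2)]
    have h1 := mul_le_mul_of_nonneg_left (norm_gradient_le_of_lipschitz h1L x) hθ.1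
    have h2 := mul_le_mul_of_nonneg_left (norm_gradient_le_of_lipschitz h2L x)
      (sub_nonneg.2 hθ.2)
    linarith
  have hd : ∀ᵐ x ∂torusMeasure n, DifferentiableAt ℝ u₁ x ∧ DifferentiableAt ℝ u₂ x :=
    ae_torus_of_ae (h1L.ae_differentiableAt.and h2L.ae_differentiableAt)
  -- The factor `Φ'(w)` is absorbed by the chain rule, `Φ'(w)Dw = D(Φ(w))`. The transport term
  -- becomes an average over `θ` of drifts tested against the gradient of one nonnegative function.
  have hstep1 : ∫ x, (h x (gradient u₁ x) - h x (gradient u₂ x)) * Φ' (u₁ x - u₂ x)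
      ∂torusMeasure n = ∫ x, (∫ θ in Icc (0 : ℝ) 1, f x θ) ∂torusMeasure n := by
    refine integral_congr_ae ?_
    filter_upwards [hd] with x ⟨hx1, hx2⟩
    have hg : gradient v x = Φ' (u₁ x - u₂ x) • (gradient u₁ x - gradient u₂ x) := by
      refine HasGradientAt.gradient ?_
      rw [hasGradientAt_iff_hasFDerivAt, map_smul, map_sub]
      exact (hΦ _).comp_hasFDerivAt x
        (hx1.hasGradientAt.hasFDerivAt.sub hx2.hasGradientAt.hasFDerivAt)
    rw [hh.integral_sub_inner_eq_integral, integral_Icc_eq_integral_Ioc,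
      ← intervalIntegral.integral_of_le zero_le_one, ← intervalIntegral.integral_mul_const]
    refine intervalIntegral.integral_congr fun θ _ => ?_
    simp only [hf, hg, inner_smul_right]
    ring
  have hmeas : Measurable (Function.uncurry f) := by
    refine Measurable.inner ?_ ((HJTorus.measurable_gradient v).comp measurable_fst)
    refine hh.measurable_gradient.comp (Measurable.prodMk ?_ measurable_fst)
    exact (measurable_snd.smul ((HJTorus.measurable_gradient u₁).comp measurable_fst)).add
      ((measurable_const.sub measurable_snd).smul
        ((HJTorus.measurable_gradient u₂).comp measurable_fst))
  have hint : Integrable (Function.uncurry f)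
      ((torusMeasure n).prod (volume.restrict (Icc (0 : ℝ) 1))) := by
    refine Integrable.of_bound hmeas.aestronglyMeasurable (C * (1 * (R + R) : ℝ≥0)) ?_
    have : ∀ᵐ z ∂((torusMeasure n).prod (volume.restrict (Icc (0 : ℝ) 1))), z.2 ∈ Icc (0 : ℝ) 1 :=
      Measure.quasiMeasurePreserving_snd.ae (ae_restrict_mem measurableSet_Icc)
    filter_upwards [this] with z hz
    exact (norm_inner_le_norm _ _).trans (mul_le_mul
      (hh.norm_gradient_le _ (hqR _ hz _) _)
      (norm_gradient_le_of_lipschitz hvL _) (norm_nonneg _) C.2)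
  rw [hstep1, integral_integral_swap hint, ← integral_neg]
  -- For fixed `θ` the argument of `D_pH` is the gradient of a single function, the convex
  -- combination of `u₁` and `u₂`, which inherits the Lipschitz and semiconcavity constants.
  have hstep2 : ∀ θ ∈ Icc (0 : ℝ) 1, -∫ x, f x θ ∂torusMeasure n ≤
      (n * C + n * (Λ * c)) * ∫ x, v x ∂torusMeasure n := fun θ hθ => by
    set U : Space n → ℝ := fun x => θ * u₁ x + (1 - θ) * u₂ x with hU
    have hUL : LipschitzWith R U := by
      refine LipschitzWith.of_dist_le_mul fun x y => ?_
      have h1 := mul_le_mul_of_nonneg_left (h1L.dist_le_mul x y) hθ.1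
      have h2 := mul_le_mul_of_nonneg_left (h2L.dist_le_mul x y) (sub_nonneg.2 hθ.2)
      rw [Real.dist_eq] at h1 h2 ⊢
      calc |U x - U y| = |θ * (u₁ x - u₁ y) + (1 - θ) * (u₂ x - u₂ y)| := by
            congr 1; simp only [hU]; ring
        _ ≤ θ * |u₁ x - u₁ y| + (1 - θ) * |u₂ x - u₂ y| := by
            refine (abs_add_le _ _).trans ?_
            rw [abs_mul, abs_mul, abs_of_nonneg hθ.1, abs_of_nonneg (sub_nonneg.2 hθ.2)]
        _ ≤ _ := by linarith
    have hUp : LatticePeriodic U := fun k x => by simp only [hU, h1p k x, h2p k x]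
    refine le_of_eq_of_le ?_ (hh.neg_integral_drift_le hUp hUL hc
      (h1c.convexComb h2c hθ.1 hθ.2) hvp hvL fun x => hΦ0 _)
    congr 1
    refine integral_congr_ae ?_
    filter_upwards [hd] with x ⟨hx1, hx2⟩
    have hg : gradient U x = θ • gradient u₁ x + (1 - θ) • gradient u₂ x := by
      refine HasGradientAt.gradient ?_
      rw [hasGradientAt_iff_hasFDerivAt, map_add, map_smul, map_smul]
      exact (hx1.hasGradientAt.hasFDerivAt.const_mul θ).add
        (hx2.hasGradientAt.hasFDerivAt.const_mul (1 - θ))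
    simp only [hf, hg]
  have hswap := hint.integral_prod_right.neg
  calc _ ≤ ∫ θ in Icc (0 : ℝ) 1, (n * C + n * (Λ * c)) * ∫ x, v x ∂torusMeasure n :=
        setIntegral_mono_on hswap (integrable_const _) measurableSet_Icc hstep2
    _ = _ := by simp

end IsSliceHamiltonian

/-! ### Continuous functions of time with an integrable weak derivative -/

section WeakDerivative

theorem deriv_smoothTransition_eq_zero {y : ℝ} (hy : y ∉ Icc (0 : ℝ) 1) :
    deriv Real.smoothTransition y = 0 := by
  rw [mem_Icc, not_and_or, not_le, not_le] at hy
  have : Real.smoothTransition =ᶠ[𝓝 y] fun _ => (if y < 0 then 0 else 1 : ℝ) := by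
    rcases hy with hy | hy
    · filter_upwards [Iio_mem_nhds hy] with z hz
      rw [if_pos hy, Real.smoothTransition.zero_of_nonpos (le_of_lt hz)]
    · filter_upwards [Ioi_mem_nhds hy] with z hz
      rw [if_neg (by linarith), Real.smoothTransition.one_of_one_le (le_of_lt hz)]
  rw [this.deriv_eq, deriv_const]

theorem hasDerivAt_smoothTransition (y : ℝ) :
    HasDerivAt Real.smoothTransition (deriv Real.smoothTransition y) y :=
  ((Real.smoothTransition.contDiff (n := 1)).differentiable (by norm_num) y).hasDerivAt

theorem continuous_deriv_smoothTransition : Continuous (deriv Real.smoothTransition) :=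
  (Real.smoothTransition.contDiff (n := 1)).continuous_deriv (by norm_num)

theorem hasDerivAt_smoothTransition_rescale (k s r : ℝ) :
    HasDerivAt (fun r => Real.smoothTransition (k * (r - s)))
      (k * deriv Real.smoothTransition (k * (r - s))) r := by
  have h1 : HasDerivAt (fun r => k * (r - s)) k r := by
    simpa using ((hasDerivAt_id r).sub_const s).const_mul k
  rw [mul_comm]
  exact (hasDerivAt_smoothTransition _).comp r h1

/-- The derivative of the steep smooth step is an approximate identity supported in `[s, s +
1/(k+1)]`; rescaling this interval to `[0,1]` reduces the limit to continuity of `m` at `s`. -/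
theorem tendsto_integral_mul_deriv_smoothTransition {T : ℝ} {m : ℝ → ℝ}
    (hm : ContinuousOn m (Icc 0 T)) {s : ℝ} (hs : s ∈ Ioo 0 T) :
    Tendsto (fun k : ℕ => ∫ r in Ioo 0 T,
      m r * (((k : ℝ) + 1) * deriv Real.smoothTransition (((k : ℝ) + 1) * (r - s)))) atTop
      (𝓝 (m s)) := by
  have hk0 : ∀ k : ℕ, (0 : ℝ) < (k : ℝ) + 1 := fun k => by positivity
  obtain ⟨A, hA⟩ := isCompact_Icc.exists_bound_of_continuousOn hm
  obtain ⟨B, hB⟩ := isCompact_Icc.exists_bound_of_continuousOn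
    (continuous_deriv_smoothTransition.continuousOn (s := Icc (0 : ℝ) 1))
  have hinv : Tendsto (fun k : ℕ => ((k : ℝ) + 1)⁻¹) atTop (𝓝 0) := by
    simpa using tendsto_one_div_add_atTop_nhds_zero_nat (𝕜 := ℝ)
  have hev : ∀ᶠ k : ℕ in atTop, s + ((k : ℝ) + 1)⁻¹ < T := by
    filter_upwards [hinv.eventually (gt_mem_nhds (sub_pos.2 hs.2))] with k hk
    linarith
  obtain ⟨N, hN⟩ := eventually_atTop.1 hev
  have hmem : ∀ k ≥ N, ∀ y ∈ Icc (0 : ℝ) 1, ((k : ℝ) + 1)⁻¹ * y + s ∈ Icc 0 T := fun k hk y hy => by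
    have h1 := hN k hk
    have h2 : 0 < ((k : ℝ) + 1)⁻¹ := inv_pos.2 (hk0 k)
    have h3 : ((k : ℝ) + 1)⁻¹ * y ≤ ((k : ℝ) + 1)⁻¹ := mul_le_of_le_one_right h2.le hy.2
    have h4 := mul_nonneg h2.le hy.1
    exact ⟨by linarith [hs.1], by linarith⟩
  have heq : ∀ k ≥ N, ∫ r in Ioo 0 T,
      m r * (((k : ℝ) + 1) * deriv Real.smoothTransition (((k : ℝ) + 1) * (r - s))) =
      ∫ y in Icc (0 : ℝ) 1, m (((k : ℝ) + 1)⁻¹ * y + s) * deriv Real.smoothTransition y := by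
    intro k hk
    have h2 : 0 < ((k : ℝ) + 1)⁻¹ := inv_pos.2 (hk0 k)
    have h3 : ∫ r in Ioo 0 T,
        m r * (((k : ℝ) + 1) * deriv Real.smoothTransition (((k : ℝ) + 1) * (r - s))) =
        ∫ r in Icc s (((k : ℝ) + 1)⁻¹ + s),
          m r * (((k : ℝ) + 1) * deriv Real.smoothTransition (((k : ℝ) + 1) * (r - s))) := by
      refine setIntegral_eq_of_subset_of_forall_sdiff_eq_zero measurableSet_Ioo
        (fun r hr => ⟨hs.1.trans_le hr.1, by linarith [hr.2, hN k hk]⟩) fun r hr => ?_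
      rw [deriv_smoothTransition_eq_zero, mul_zero, mul_zero]
      intro hy
      refine hr.2 ⟨?_, ?_⟩
      · have := nonneg_of_mul_nonneg_right hy.1 (hk0 k); linarith
      · have : r - s ≤ ((k : ℝ) + 1)⁻¹ := by
          rw [← one_div, le_div_iff₀ (hk0 k), mul_comm]; exact hy.2
        linarith
    rw [h3, integral_Icc_eq_integral_Ioc, ← intervalIntegral.integral_of_le (by linarith),
      integral_Icc_eq_integral_Ioc, ← intervalIntegral.integral_of_le zero_le_one]
    have h4 := intervalIntegral.smul_integral_comp_mul_add (a := 0) (b := 1) (fun r =>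
      m r * (((k : ℝ) + 1) * deriv Real.smoothTransition (((k : ℝ) + 1) * (r - s))))
      ((k : ℝ) + 1)⁻¹ s
    rw [mul_zero, zero_add, mul_one] at h4
    rw [← h4, smul_eq_mul, ← intervalIntegral.integral_const_mul]
    refine intervalIntegral.integral_congr fun y _ => ?_
    have h5 : ((k : ℝ) + 1) * (((k : ℝ) + 1)⁻¹ * y + s - s) = y := by
      rw [add_sub_cancel_right, mul_inv_cancel_left₀ (hk0 k).ne']
    simp only [h5]
    field_simp
  have hlim : Tendsto (fun k : ℕ => ∫ y in Icc (0 : ℝ) 1,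
      m ((((k + N : ℕ) : ℝ) + 1)⁻¹ * y + s) * deriv Real.smoothTransition y) atTop
      (𝓝 (∫ y in Icc (0 : ℝ) 1, m s * deriv Real.smoothTransition y)) := by
    refine tendsto_integral_of_dominated_convergence (fun _ => A * B) (fun k => ?_)
      (integrable_const _) (fun k => ?_) ?_
    · refine ContinuousOn.aestronglyMeasurable ?_ measurableSet_Icc
      exact (hm.comp (by fun_prop) fun y hy => hmem _ (Nat.le_add_left _ _) y hy).mul
        continuous_deriv_smoothTransition.continuousOn
    · filter_upwards [ae_restrict_mem measurableSet_Icc] with y hy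
      have h1 := hA _ (hmem _ (Nat.le_add_left N k) y hy)
      rw [norm_mul]
      exact mul_le_mul h1 (hB y hy) (norm_nonneg _) ((norm_nonneg _).trans h1)
    · filter_upwards with y
      refine Tendsto.mul_const _ ?_
      have hms : ContinuousAt m s := hm.continuousAt (Icc_mem_nhds hs.1 hs.2)
      refine hms.tendsto.comp ?_
      have := ((hinv.comp (tendsto_add_atTop_nat N)).mul_const y).add_const s
      simpa using this
  have hone : ∫ y in Icc (0 : ℝ) 1, m s * deriv Real.smoothTransition y = m s := by
    rw [integral_const_mul, integral_Icc_eq_integral_Ioc,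
      ← intervalIntegral.integral_of_le zero_le_one,
      intervalIntegral.integral_eq_sub_of_hasDerivAt (fun y _ => hasDerivAt_smoothTransition y)
      (continuous_deriv_smoothTransition.intervalIntegrable _ _)]
    simp
  rw [hone] at hlim
  rw [← tendsto_add_atTop_iff_nat N]
  exact hlim.congr fun k => (heq _ (Nat.le_add_left _ _)).symm

theorem tendsto_smoothTransition_sub (s t r : ℝ) (hst : s < t) :
    Tendsto (fun k : ℕ => Real.smoothTransition (((k : ℝ) + 1) * (r - s)) -
      Real.smoothTransition (((k : ℝ) + 1) * (r - t))) atTop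
      (𝓝 ((Ioc s t).indicator (fun _ => 1) r)) := by
  have hk0 : ∀ k : ℕ, (0 : ℝ) < (k : ℝ) + 1 := fun k => by positivity
  have hle : ∀ a : ℝ, r ≤ a → ∀ k : ℕ, Real.smoothTransition (((k : ℝ) + 1) * (r - a)) = 0 :=
    fun a ha k => Real.smoothTransition.zero_of_nonpos
      (mul_nonpos_of_nonneg_of_nonpos (hk0 k).le (by linarith))
  have hgt : ∀ a : ℝ, a < r →
      ∀ᶠ k : ℕ in atTop, Real.smoothTransition (((k : ℝ) + 1) * (r - a)) = 1 := fun a ha => by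
    have h1 : Tendsto (fun k : ℕ => ((k : ℝ) + 1) * (r - a)) atTop atTop :=
      (tendsto_atTop_add_const_right _ _ tendsto_natCast_atTop_atTop).atTop_mul_const
        (sub_pos.2 ha)
    filter_upwards [h1.eventually_ge_atTop 1] with k hk
    exact Real.smoothTransition.one_of_one_le hk
  refine tendsto_const_nhds.congr' ?_
  rcases le_or_gt r s with h | h
  · filter_upwards with k
    rw [indicator_of_notMem (fun hr => absurd hr.1 h.not_gt), hle s h, hle t (h.trans hst.le),
      sub_zero]
  · rcases le_or_gt r t with h' | h'
    · filter_upwards [hgt s h] with k hk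
      rw [indicator_of_mem (show r ∈ Ioc s t from ⟨h, h'⟩), hk, hle t h', sub_zero]
    · filter_upwards [hgt s h, hgt t h'] with k hk hk'
      rw [indicator_of_notMem (fun hr => absurd hr.2 h'.not_ge), hk, hk', sub_self]

/-- A continuous function with an integrable weak derivative is its primitive. -/
theorem sub_eq_integral_of_weak_deriv {T : ℝ} (hT : 0 < T) {m G : ℝ → ℝ}
    (hm : ContinuousOn m (Icc 0 T))
    (hG : IntegrableOn G (Ioo 0 T))
    (h : ∀ η : ℝ → ℝ, ContDiff ℝ ((⊤ : ℕ∞) : WithTop ℕ∞) η →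
      (∃ a b : ℝ, 0 < a ∧ b < T ∧ ∀ t, t ∉ Icc a b → η t = 0) →
      ∫ t in Ioo 0 T, (m t * deriv η t + G t * η t) = 0)
    {s t : ℝ} (hs : s ∈ Icc 0 T) (ht : t ∈ Icc 0 T) : m t - m s = ∫ r in s..t, G r := by
  have hk0 : ∀ k : ℕ, (0 : ℝ) < (k : ℝ) + 1 := fun k => by positivity
  have main : ∀ s t, s ∈ Ioo 0 T → t ∈ Ioo 0 T → s < t → m t - m s = ∫ r in s..t, G r := by
    intro s t hs ht hst
    -- Smooth approximations of the indicator of `(s,t]`, whose derivatives tend to the difference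
    -- of the point masses at `s` and `t`. The ramps lie to the right of `s` and `t`, so they are
    -- admissible once `t + 1/(k+1) < T`.
    set η : ℕ → ℝ → ℝ := fun k r => Real.smoothTransition (((k : ℝ) + 1) * (r - s)) -
      Real.smoothTransition (((k : ℝ) + 1) * (r - t)) with hη
    have hηs : ∀ k, ContDiff ℝ ((⊤ : ℕ∞) : WithTop ℕ∞) (η k) := fun k =>
      (Real.smoothTransition.contDiff.comp (by fun_prop)).sub
        (Real.smoothTransition.contDiff.comp (by fun_prop))
    have hηd : ∀ k r, deriv (η k) r =
        ((k : ℝ) + 1) * deriv Real.smoothTransition (((k : ℝ) + 1) * (r - s)) -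
        ((k : ℝ) + 1) * deriv Real.smoothTransition (((k : ℝ) + 1) * (r - t)) := fun k r =>
      ((hasDerivAt_smoothTransition_rescale _ s r).sub
        (hasDerivAt_smoothTransition_rescale _ t r)).deriv
    have hη1 : ∀ k r, ‖η k r‖ ≤ 1 := fun k r => by
      rw [Real.norm_eq_abs, abs_le]
      constructor <;> simp only [hη] <;>
        linarith [Real.smoothTransition.nonneg (((k : ℝ) + 1) * (r - s)),
          Real.smoothTransition.nonneg (((k : ℝ) + 1) * (r - t)),
          Real.smoothTransition.le_one (((k : ℝ) + 1) * (r - s)),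
          Real.smoothTransition.le_one (((k : ℝ) + 1) * (r - t))]
    have hlimG : Tendsto (fun k => ∫ r in Ioo 0 T, G r * η k r) atTop
        (𝓝 (∫ r in Ioo 0 T, G r * (Ioc s t).indicator (fun _ => 1) r)) := by
      refine tendsto_integral_of_dominated_convergence (fun r => ‖G r‖) (fun k => ?_) hG.norm
        (fun k => ?_) ?_
      · exact hG.aestronglyMeasurable.mul (hηs k).continuous.aestronglyMeasurable
      · filter_upwards with r
        rw [norm_mul]
        exact mul_le_of_le_one_right (norm_nonneg _) (hη1 k r)
      · filter_upwards with r
        exact (tendsto_smoothTransition_sub s t r hst).const_mul _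
    have hlimm := (tendsto_integral_mul_deriv_smoothTransition hm hs).sub
      (tendsto_integral_mul_deriv_smoothTransition hm ht)
    have hsum := hlimm.add hlimG
    have hIoc : ∫ r in Ioo 0 T, G r * (Ioc s t).indicator (fun _ => 1) r = ∫ r in s..t, G r := by
      have : ∀ r, G r * (Ioc s t).indicator (fun _ => 1) r = (Ioc s t).indicator G r := fun r => by
        by_cases hr : r ∈ Ioc s t <;> simp [hr]
      simp only [this]
      rw [setIntegral_indicator measurableSet_Ioc, intervalIntegral.integral_of_le hst.le,
        inter_eq_right.2 (show Ioc s t ⊆ Ioo 0 T from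
          fun r hr => ⟨hs.1.trans hr.1, hr.2.trans_lt ht.2⟩)]
    rw [hIoc] at hsum
    have hinv : Tendsto (fun k : ℕ => ((k : ℝ) + 1)⁻¹) atTop (𝓝 0) := by
      simpa using tendsto_one_div_add_atTop_nhds_zero_nat (𝕜 := ℝ)
    have hzero : ∀ᶠ k : ℕ in atTop, (∫ r in Ioo 0 T,
        m r * (((k : ℝ) + 1) * deriv Real.smoothTransition (((k : ℝ) + 1) * (r - s)))) -
        (∫ r in Ioo 0 T,
        m r * (((k : ℝ) + 1) * deriv Real.smoothTransition (((k : ℝ) + 1) * (r - t)))) +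
        ∫ r in Ioo 0 T, G r * η k r = 0 := by
      filter_upwards [hinv.eventually (gt_mem_nhds (sub_pos.2 ht.2))] with k hk
      have h1 := h (η k) (hηs k) ⟨s, t + ((k : ℝ) + 1)⁻¹, hs.1, by linarith, fun r hr => by
        rw [mem_Icc, not_and_or, not_le, not_le] at hr
        rcases hr with hr | hr
        · simp only [hη]
          rw [Real.smoothTransition.zero_of_nonpos, Real.smoothTransition.zero_of_nonpos, sub_zero]
          · exact mul_nonpos_of_nonneg_of_nonpos (hk0 k).le (by linarith)
          · exact mul_nonpos_of_nonneg_of_nonpos (hk0 k).le (by linarith)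
        · have hrt : 1 ≤ ((k : ℝ) + 1) * (r - t) := by
            calc (1 : ℝ) = ((k : ℝ) + 1) * ((k : ℝ) + 1)⁻¹ := (mul_inv_cancel₀ (hk0 k).ne').symm
              _ ≤ _ := mul_le_mul_of_nonneg_left (by linarith) (hk0 k).le
          have hrs : 1 ≤ ((k : ℝ) + 1) * (r - s) :=
            hrt.trans (mul_le_mul_of_nonneg_left (by linarith) (hk0 k).le)
          simp only [hη]
          rw [Real.smoothTransition.one_of_one_le hrt, Real.smoothTransition.one_of_one_le hrs,
            sub_self]⟩
      have hi : ∀ a, IntegrableOn (fun r => m r * (((k : ℝ) + 1) *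
          deriv Real.smoothTransition (((k : ℝ) + 1) * (r - a)))) (Ioo 0 T) := fun a => by
        refine (ContinuousOn.integrableOn_compact isCompact_Icc (hm.mul ?_)).mono_set
          Ioo_subset_Icc_self
        have := continuous_deriv_smoothTransition
        exact (by fun_prop : Continuous fun r => ((k : ℝ) + 1) *
          deriv Real.smoothTransition (((k : ℝ) + 1) * (r - a))).continuousOn
      have hiG : IntegrableOn (fun r => G r * η k r) (Ioo 0 T) :=
        Integrable.mul_bdd (c := 1) hG (hηs k).continuous.aestronglyMeasurable (ae_of_all _ (hη1 k))
      have h2 : ∀ r, m r * deriv (η k) r + G r * η k r =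
          (m r * (((k : ℝ) + 1) * deriv Real.smoothTransition (((k : ℝ) + 1) * (r - s))) -
          m r * (((k : ℝ) + 1) * deriv Real.smoothTransition (((k : ℝ) + 1) * (r - t)))) +
          G r * η k r := fun r => by rw [hηd]; ring
      simp only [h2] at h1
      have h3 := integral_add ((hi s).sub (hi t)) hiG
      simp only [Pi.sub_apply] at h3
      rw [h3, integral_sub (hi s) (hi t)] at h1
      exact h1
    have := tendsto_nhds_unique (hsum.congr' hzero) tendsto_const_nhds
    linarith
  have hGi : IntervalIntegrable G volume 0 T :=
    (intervalIntegrable_iff_integrableOn_Ioo_of_le hT.le).2 hG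
  have hGsub : ∀ {a b}, a ∈ Icc 0 T → b ∈ Icc 0 T → IntervalIntegrable G volume a b :=
    fun ha hb => hGi.mono_set (by
      rw [uIcc_of_le hT.le]; exact uIcc_subset_Icc ha hb)
  have h0 : (0 : ℝ) ∈ Icc 0 T := ⟨le_rfl, hT.le⟩
  -- Test functions see only the open interval; the endpoints are reached because `Q` is constant
  -- inside and continuous on the closed interval.
  set Q : ℝ → ℝ := fun t => m t - ∫ r in (0 : ℝ)..t, G r with hQ
  have hQc : ContinuousOn Q (Icc 0 T) := by
    refine hm.sub ?_
    have := intervalIntegral.continuousOn_primitive_interval (f := G) (a := 0) (b := T)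
      (μ := volume) (by rw [uIcc_of_le hT.le, integrableOn_Icc_iff_integrableOn_Ioo]; exact hG)
    rwa [uIcc_of_le hT.le] at this
  have hmid : T / 2 ∈ Ioo 0 T := ⟨by linarith, by linarith⟩
  have hQ1 : ∀ s t, s ∈ Ioo 0 T → t ∈ Ioo 0 T → s < t → Q t = Q s := fun s t hs ht hst => by
    have h1 := main s t hs ht hst
    have h2 := intervalIntegral.integral_add_adjacent_intervals
      (hGsub h0 (Ioo_subset_Icc_self hs)) (hGsub (Ioo_subset_Icc_self hs) (Ioo_subset_Icc_self ht))
    simp only [hQ]; linarith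
  have hQ2 : EqOn Q (fun _ => Q (T / 2)) (Ioo 0 T) := fun t ht => by
    rcases lt_trichotomy t (T / 2) with h1 | h1 | h1
    · exact (hQ1 _ _ ht hmid h1).symm
    · rw [h1]
    · exact hQ1 _ _ hmid ht h1
  have hQ3 : EqOn Q (fun _ => Q (T / 2)) (Icc 0 T) :=
    hQ2.of_subset_closure hQc continuousOn_const Ioo_subset_Icc_self
      (by rw [closure_Ioo hT.ne])
  have h1 := (hQ3 hs).trans (hQ3 ht).symm
  have h2 := intervalIntegral.integral_add_adjacent_intervals (hGsub h0 hs) (hGsub hs ht)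
  simp only [hQ] at h1
  linarith

end WeakDerivative

/-! ### The equation tested with functions of space alone -/

theorem cylMeasure_eq_prod (n : ℕ) (τ T : ℝ) :
    cylMeasure n τ T = (volume.restrict (Ioo τ T)).prod (torusMeasure n) := by
  rw [cylMeasure, torusMeasure, Measure.prod_restrict, Measure.volume_eq_prod]

theorem integrable_cyl_of_continuousOn {T : ℝ} {F : ℝ × Space n → ℝ}
    (hF : ContinuousOn F (Icc 0 T ×ˢ univ)) : Integrable F (cylMeasure n 0 T) := by
  refine IntegrableOn.mono_set (t := Icc 0 T ×ˢ Metric.closedBall 0 (Real.sqrt n)) ?_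
    (prod_mono Ioo_subset_Icc_self unitCube_subset_closedBall)
  exact (hF.mono (prod_mono_right (subset_univ _))).integrableOn_compact
    (isCompact_Icc.prod (isCompact_closedBall _ _))

theorem exists_bound_of_continuousOn_of_periodic {T : ℝ} {u : ℝ → Space n → ℝ}
    (hp : ∀ t ∈ Icc 0 T, IsPeriodic (u t))
    (hc : ContinuousOn (fun z : ℝ × Space n => u z.1 z.2) (Icc 0 T ×ˢ univ)) :
    ∃ A : ℝ≥0, ∀ t ∈ Icc 0 T, ∀ x, |u t x| ≤ A := by
  obtain ⟨A, hA⟩ := (isCompact_Icc.prod (isCompact_closedBall (0 : Space n)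
    (Real.sqrt n))).exists_bound_of_continuousOn (hc.mono (prod_mono_right (subset_univ _)))
  refine ⟨A.toNNReal, fun t ht x => ?_⟩
  obtain ⟨k, hk⟩ := exists_latticePoint_add_mem x
  rw [← (hp t ht).latticePeriodic k x]
  exact (hA (t, x + latticePoint k) ⟨ht, unitCube_subset_closedBall hk⟩).trans
    (Real.le_coe_toNNReal A)

/-- The equation tested with a smooth periodic function of `x`. -/
noncomputable def testedRHS (ε : ℝ) (H : ℝ → Space n → Space n → ℝ) (f u : ℝ → Space n → ℝ)
    (ψ : Space n → ℝ) (t : ℝ) : ℝ :=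
  ∫ x, (ε * inner ℝ (gradient (u t) x) (gradient ψ x) +
    (H t x (gradient (u t) x) - f t x) * ψ x) ∂torusMeasure n

namespace IsLipschitzSolution

variable {T ε : ℝ} {H : ℝ → Space n → Space n → ℝ} {f : ℝ → Space n → ℝ} {g : Space n → ℝ}
  {R : ℝ≥0} {u : ℝ → Space n → ℝ}

theorem continuous_slice (hu : IsLipschitzSolution T ε H f g R u) {t : ℝ} (ht : t ∈ Icc 0 T) :
    Continuous (u t) := (hu.lipschitz t ht).continuous

theorem aestronglyMeasurable_gradient (hu : IsLipschitzSolution T ε H f g R u) (hT : 0 < T) :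
    AEStronglyMeasurable (fun z : ℝ × Space n => gradient (u z.1) z.2) (cylMeasure n 0 T) := by
  -- Clamping time to `[0,T]` extends `u` to a jointly continuous function, for which measurability
  -- of the parametrized derivative is available.
  set p : ℝ → ℝ := fun t => max 0 (min t T) with hp
  have hpm : ∀ t, p t ∈ Icc 0 T := fun t => ⟨le_max_left _ _, max_le hT.le (min_le_right _ _)⟩
  have hcont : Continuous (Function.uncurry fun t x => u (p t) x) := by
    have h1 : Continuous fun z : ℝ × Space n => (p z.1, z.2) := by fun_prop
    exact hu.continuousOn.comp_continuous h1 fun z => ⟨hpm _, mem_univ _⟩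
  have hm : Measurable fun z : ℝ × Space n => gradient (u (p z.1)) z.2 :=
    (InnerProductSpace.toDual ℝ (Space n)).symm.continuous.measurable.comp
      (measurable_fderiv_with_param ℝ hcont)
  refine hm.aestronglyMeasurable.congr ?_
  filter_upwards [ae_restrict_mem (measurableSet_Ioo.prod measurableSet_unitCube)] with z hz
  have : p z.1 = z.1 := by
    rw [hp]; simp only; rw [min_eq_left hz.1.2.le, max_eq_right hz.1.1.le]
  rw [this]

/-- Integrability of the terms of the weak formulation. -/
theorem integrable_terms (hu : IsLipschitzSolution T ε H f g R u) (hT : 0 < T)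
    (hf : MemL1Cyl T f) {ψ : Space n → ℝ} (hψ : ContDiff ℝ ((⊤ : ℕ∞) : WithTop ℕ∞) ψ)
    (hψp : LatticePeriodic ψ) :
    Integrable (fun z : ℝ × Space n => ε * inner ℝ (gradient (u z.1) z.2) (gradient ψ z.2) +
      (H z.1 z.2 (gradient (u z.1) z.2) - f z.1 z.2) * ψ z.2) (cylMeasure n 0 T) := by
  obtain ⟨L, hL⟩ := hψp.exists_lipschitz (contDiff_infty.1 hψ 1)
  obtain ⟨A, hA0, hA⟩ := hψp.exists_bound hψ.continuous
  have hfin : IsFiniteMeasure (cylMeasure n 0 T) := by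
    rw [cylMeasure_eq_prod]; infer_instance
  refine Integrable.add (Integrable.const_mul ?_ ε) ?_
  · refine Integrable.of_bound ((hu.aestronglyMeasurable_gradient hT).inner
      ((measurable_gradient ψ).comp measurable_snd).aestronglyMeasurable) (R * L) ?_
    filter_upwards [ae_restrict_mem (measurableSet_Ioo.prod measurableSet_unitCube)] with z hz
    exact (norm_inner_le_norm _ _).trans (mul_le_mul
      (norm_gradient_le_of_lipschitz (hu.lipschitz _ (Ioo_subset_Icc_self hz.1)) _)
      (norm_gradient_le_of_lipschitz hL _) (norm_nonneg _) R.2)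
  · exact (hu.integrable_H.sub hf.2).mul_bdd (c := A)
      (hψ.continuous.comp continuous_snd).aestronglyMeasurable (ae_of_all _ fun z => hA _)

theorem integrableOn_testedRHS (hu : IsLipschitzSolution T ε H f g R u) (hT : 0 < T)
    (hf : MemL1Cyl T f) {ψ : Space n → ℝ} (hψ : ContDiff ℝ ((⊤ : ℕ∞) : WithTop ℕ∞) ψ)
    (hψp : LatticePeriodic ψ) : IntegrableOn (testedRHS ε H f u ψ) (Ioo 0 T) := by
  have h := hu.integrable_terms hT hf hψ hψp
  rw [cylMeasure_eq_prod] at h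
  exact h.integral_prod_left

theorem continuousOn_integral_mul (hu : IsLipschitzSolution T ε H f g R u)
    {ψ : Space n → ℝ} (hψ : Continuous ψ) (hψp : LatticePeriodic ψ) :
    ContinuousOn (fun t => ∫ x, u t x * ψ x ∂torusMeasure n) (Icc 0 T) := by
  obtain ⟨A, hA0, hA⟩ := hψp.exists_bound hψ
  obtain ⟨B, hB⟩ := exists_bound_of_continuousOn_of_periodic hu.periodic hu.continuousOn
  refine continuousOn_of_dominated (bound := fun _ => B * A) (fun t ht => ?_) (fun t ht => ?_)
    (integrable_const _) ?_
  · exact ((hu.continuous_slice ht).mul hψ).aestronglyMeasurable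
  · refine ae_of_all _ fun x => ?_
    rw [norm_mul]
    exact mul_le_mul (hB t ht x) (hA x) (norm_nonneg _) B.2
  · refine ae_of_all _ fun x => ContinuousOn.mul ?_ continuousOn_const
    have hx : ContinuousOn (fun t : ℝ => (t, x)) (Icc 0 T) := by fun_prop
    exact hu.continuousOn.comp hx fun t ht => ⟨ht, mem_univ _⟩

/-- Products `η(t)ψ(x)` in the weak formulation and Fubini show that `testedRHS` is the weak time
derivative of `∫ uψ`. The increment form holds up to `t = T`, and so reaches the terminal data. -/
theorem integral_mul_sub_eq (hu : IsLipschitzSolution T ε H f g R u) (hT : 0 < T)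
    (hf : MemL1Cyl T f) {ψ : Space n → ℝ} (hψ : ContDiff ℝ ((⊤ : ℕ∞) : WithTop ℕ∞) ψ)
    (hψp : LatticePeriodic ψ) {s t : ℝ} (hs : s ∈ Icc 0 T) (ht : t ∈ Icc 0 T) :
    ∫ x, u t x * ψ x ∂torusMeasure n - ∫ x, u s x * ψ x ∂torusMeasure n =
      ∫ r in s..t, testedRHS ε H f u ψ r := by
  refine sub_eq_integral_of_weak_deriv hT (hu.continuousOn_integral_mul hψ.continuous hψp)
    (hu.integrableOn_testedRHS hT hf hψ hψp) (fun η hη hηs => ?_) hs ht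
  have hηd : Continuous (deriv η) := hη.continuous_deriv (by simp)
  have hηb : ∃ A, ∀ t ∈ Ioo 0 T, ‖η t‖ ≤ A :=
    (isCompact_Icc.exists_bound_of_continuousOn (hη.continuous.continuousOn (s := Icc 0 T))).imp
      fun A hA t ht => hA t (Ioo_subset_Icc_self ht)
  obtain ⟨A, hA⟩ := hηb
  obtain ⟨a, b, ha, hb, hab⟩ := hηs
  have htest : IsTest T fun t x => η t * ψ x :=
    ⟨(hη.comp contDiff_fst).mul (hψ.comp contDiff_snd), fun t k x => by
      have := hψp k x
      rw [latticePoint] at this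
      simp only [this], a, b, ha, hb, fun t ht x => by rw [hab t ht, zero_mul]⟩
  have hweak := hu.weak_eq _ htest
  have hgrad : ∀ t x, gradient (fun x => η t * ψ x) x = η t • gradient ψ x := fun t x => by
    refine HasGradientAt.gradient ?_
    rw [hasGradientAt_iff_hasFDerivAt, map_smul]
    exact ((hψ.differentiable (by simp)) x).hasGradientAt.hasFDerivAt.const_mul (η t)
  have hder : ∀ t x, deriv (fun s => η s * ψ x) t = deriv η t * ψ x := fun t x =>
    deriv_mul_const ((hη.differentiable (by simp)) t) _
  have hint1 : Integrable (fun z : ℝ × Space n => u z.1 z.2 * (deriv η z.1 * ψ z.2))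
      (cylMeasure n 0 T) := by
    have := hψ.continuous
    exact integrable_cyl_of_continuousOn (hu.continuousOn.mul (by fun_prop))
  have hηae : ∀ᵐ z ∂cylMeasure n 0 T, ‖η z.1‖ ≤ A := by
    filter_upwards [ae_restrict_mem (measurableSet_Ioo.prod measurableSet_unitCube)] with z hz
    exact hA _ hz.1
  have hηm : AEStronglyMeasurable (fun z : ℝ × Space n => η z.1) (cylMeasure n 0 T) :=
    (hη.continuous.comp continuous_fst).aestronglyMeasurable
  have hint2 : Integrable (fun z : ℝ × Space n => (ε * inner ℝ (gradient (u z.1) z.2)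
      (gradient ψ z.2) + (H z.1 z.2 (gradient (u z.1) z.2) - f z.1 z.2) * ψ z.2) * η z.1)
      (cylMeasure n 0 T) :=
    (hu.integrable_terms hT hf hψ hψp).mul_bdd hηm hηae
  have hint3 : Integrable (fun z : ℝ × Space n => f z.1 z.2 * (η z.1 * ψ z.2))
      (cylMeasure n 0 T) := by
    obtain ⟨B, hB0, hB⟩ := hψp.exists_bound hψ.continuous
    refine hf.2.mul_bdd (c := A * B)
      (hηm.mul (hψ.continuous.comp continuous_snd).aestronglyMeasurable) ?_
    filter_upwards [hηae] with z hz
    rw [norm_mul]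
    exact mul_le_mul hz (hB _) (norm_nonneg _) ((norm_nonneg _).trans hz)
  have hsum : ∫ z : ℝ × Space n, (u z.1 z.2 * (deriv η z.1 * ψ z.2) +
      (ε * inner ℝ (gradient (u z.1) z.2) (gradient ψ z.2) +
        (H z.1 z.2 (gradient (u z.1) z.2) - f z.1 z.2) * ψ z.2) * η z.1) ∂cylMeasure n 0 T = 0 := by
    have h1 : ∀ z : ℝ × Space n, u z.1 z.2 * (deriv η z.1 * ψ z.2) +
        (ε * inner ℝ (gradient (u z.1) z.2) (gradient ψ z.2) +
        (H z.1 z.2 (gradient (u z.1) z.2) - f z.1 z.2) * ψ z.2) * η z.1 =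
        (u z.1 z.2 * deriv (fun s => η s * ψ z.2) z.1
        + ε * inner ℝ (gradient (u z.1) z.2) (gradient (fun x => η z.1 * ψ x) z.2)
        + H z.1 z.2 (gradient (u z.1) z.2) * (η z.1 * ψ z.2)) - f z.1 z.2 * (η z.1 * ψ z.2) :=
      fun z => by
        rw [hgrad, hder, inner_smul_right]; ring
    have h2 : Integrable (fun z : ℝ × Space n => u z.1 z.2 * deriv (fun s => η s * ψ z.2) z.1
        + ε * inner ℝ (gradient (u z.1) z.2) (gradient (fun x => η z.1 * ψ x) z.2)
        + H z.1 z.2 (gradient (u z.1) z.2) * (η z.1 * ψ z.2)) (cylMeasure n 0 T) := by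
      refine ((hint1.add hint2).add hint3).congr (ae_of_all _ fun z => ?_)
      simp only [Pi.add_apply]
      rw [h1]; ring
    rw [integral_congr_ae (ae_of_all _ h1), integral_sub h2 hint3]
    exact sub_eq_zero.2 hweak
  have hint := hint1.add hint2
  rw [cylMeasure_eq_prod] at hsum hint hint1 hint2
  have hF := integral_prod (μ := volume.restrict (Ioo 0 T)) (ν := torusMeasure n) _ hint
  simp only [Pi.add_apply] at hF
  rw [hsum] at hF
  refine Eq.trans (integral_congr_ae ?_) hF.symm
  filter_upwards [hint1.prod_right_ae, hint2.prod_right_ae] with t h1 h2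
  have e1 : ∫ x, u t x * (deriv η t * ψ x) ∂torusMeasure n =
      (∫ x, u t x * ψ x ∂torusMeasure n) * deriv η t := by
    rw [← integral_mul_const]
    exact integral_congr_ae (ae_of_all _ fun x => by ring)
  refine Eq.symm ((integral_add h1 h2).trans ?_)
  rw [e1, testedRHS, integral_mul_const]

end IsLipschitzSolution

/-! ### Telescoping and a backward Grönwall inequality -/

section Telescoping

/-- An increment estimate that holds up to a small error on short intervals holds globally. -/
theorem sub_le_integral_of_local {P U a : ℝ → ℝ} {α β : ℝ} (hαβ : α ≤ β)
    (hU : IntervalIntegrable U volume α β) (ha : IntervalIntegrable a volume α β)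
    (h : ∀ η > 0, ∃ δ > 0, ∀ s t, α ≤ s → s ≤ t → t ≤ β → t - s ≤ δ →
      P s - P t ≤ (∫ r in s..t, U r) + η * ∫ r in s..t, a r) :
    P α - P β ≤ ∫ r in α..β, U r := by
  have key : ∀ η > 0, P α - P β ≤ (∫ r in α..β, U r) + η * ∫ r in α..β, a r := by
    intro η hη
    obtain ⟨δ, hδ, hd⟩ := h η hη
    -- A uniform partition of mesh below `δ`. The errors are weighted by integrals of `a`, so they
    -- add up to `η ∫ a` independently of the number of pieces.
    obtain ⟨N, hN⟩ := exists_nat_gt ((β - α) / δ)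
    have hN0 : (0 : ℝ) < N := lt_of_le_of_lt (by have := sub_nonneg.2 hαβ; positivity) hN
    set τ : ℕ → ℝ := fun i => α + i * ((β - α) / N) with hτ
    have hstep : 0 ≤ (β - α) / N := div_nonneg (sub_nonneg.2 hαβ) hN0.le
    have hτ0 : τ 0 = α := by simp [hτ]
    have hτN : τ N = β := by simp only [hτ]; field_simp; ring
    have hmono : Monotone τ := fun i j hij => by
      simp only [hτ]; gcongr
    have hmem : ∀ i ≤ N, τ i ∈ Icc α β := fun i hi =>
      ⟨hτ0 ▸ hmono (Nat.zero_le i), hτN ▸ hmono hi⟩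
    have hint : ∀ {f : ℝ → ℝ}, IntervalIntegrable f volume α β → ∀ i < N,
        IntervalIntegrable f volume (τ i) (τ (i + 1)) := fun hf i hi =>
      hf.mono_set (by
        rw [uIcc_of_le hαβ]; exact uIcc_subset_Icc (hmem i hi.le) (hmem (i + 1) hi))
    have hUs := intervalIntegral.sum_integral_adjacent_intervals (n := N) (hint hU)
    have has := intervalIntegral.sum_integral_adjacent_intervals (n := N) (hint ha)
    rw [hτ0, hτN] at hUs has
    have hPs : P α - P β = ∑ i ∈ Finset.range N, (P (τ i) - P (τ (i + 1))) := by
      rw [Finset.sum_range_sub', hτ0, hτN]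
    rw [hPs, ← hUs, ← has, Finset.mul_sum, ← Finset.sum_add_distrib]
    refine Finset.sum_le_sum fun i hi => ?_
    have hi' := Finset.mem_range.1 hi
    refine hd _ _ (hmem i hi'.le).1 (hmono (Nat.le_succ i)) (hmem (i + 1) hi').2 ?_
    have : τ (i + 1) - τ i = (β - α) / N := by simp only [hτ]; push_cast; ring
    rw [this, div_le_iff₀ hN0]
    rw [div_lt_iff₀ hδ] at hN
    linarith
  have hlim : Tendsto (fun η : ℝ => (∫ r in α..β, U r) + η * ∫ r in α..β, a r) (𝓝[>] 0)
      (𝓝 ((∫ r in α..β, U r) + 0 * ∫ r in α..β, a r)) :=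
    Tendsto.mono_left ((by fun_prop : Continuous fun η : ℝ =>
      (∫ r in α..β, U r) + η * ∫ r in α..β, a r).tendsto 0) nhdsWithin_le_nhds
  rw [zero_mul, add_zero] at hlim
  exact ge_of_tendsto hlim (eventually_nhdsWithin_of_forall key)

/-- Backward Grönwall inequality with integrable coefficients. -/
theorem le_exp_integral_mul_of_sub_le {E K F : ℝ → ℝ} {α β : ℝ} (hαβ : α ≤ β)
    (hE : ContinuousOn E (Icc α β)) (hE0 : ∀ t ∈ Icc α β, 0 ≤ E t)
    (hK : IntervalIntegrable K volume α β) (hK0 : ∀ t, 0 ≤ K t)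
    (hF : IntervalIntegrable F volume α β) (hF0 : ∀ t, 0 ≤ F t)
    (h : ∀ s t, α ≤ s → s ≤ t → t ≤ β → E s - E t ≤ ∫ r in s..t, (K r * E r + F r)) :
    E α ≤ Real.exp (∫ r in α..β, K r) * (E β + ∫ r in α..β, F r) := by
  have hsub : ∀ {f : ℝ → ℝ}, IntervalIntegrable f volume α β → ∀ {s t}, α ≤ s → s ≤ t → t ≤ β →
      IntervalIntegrable f volume s t := fun hf s t hs hst ht =>
    hf.mono_set (by
      rw [uIcc_of_le hαβ]; exact uIcc_subset_Icc ⟨hs, hst.trans ht⟩ ⟨hs.trans hst, ht⟩)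
  set κ : ℝ → ℝ := fun s => ∫ r in s..β, K r
  have hκ0 : ∀ s, s ≤ β → 0 ≤ κ s := fun s hs =>
    intervalIntegral.integral_nonneg hs fun r _ => hK0 r
  have huc := isCompact_Icc.uniformContinuousOn_of_continuous hE
  -- The integrating factor is handled without differentiation: on a short interval `E r ≤ E t + ω`
  -- by uniform continuity, and `(1 + k)e^{-k} ≤ 1` for `k = ∫ K` absorbs the growth.
  have key := sub_le_integral_of_local (P := fun s => E s * Real.exp (-κ s)) hαβ hF hK
    (fun ω hω => by
      obtain ⟨δ, hδ, hd⟩ := Metric.uniformContinuousOn_iff.1 huc ω hω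
      refine ⟨δ / 2, by positivity, fun s t hs hst ht hts => ?_⟩
      have hk0 : 0 ≤ ∫ r in s..t, K r := intervalIntegral.integral_nonneg hst fun r _ => hK0 r
      have hF1 : 0 ≤ ∫ r in s..t, F r := intervalIntegral.integral_nonneg hst fun r _ => hF0 r
      have hKE : IntervalIntegrable (fun r => K r * E r) volume s t :=
        (hsub hK hs hst ht).mul_continuousOn (hE.mono (by
          rw [uIcc_of_le hst]; exact Icc_subset_Icc hs ht))
      have h1 : ∫ r in s..t, (K r * E r + F r) ≤
          (∫ r in s..t, K r) * (E t + ω) + ∫ r in s..t, F r := by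
        rw [intervalIntegral.integral_add hKE (hsub hF hs hst ht),
          ← intervalIntegral.integral_mul_const]
        gcongr
        refine intervalIntegral.integral_mono_on hst hKE ((hsub hK hs hst ht).mul_const _)
          fun r hr => mul_le_mul_of_nonneg_left ?_ (hK0 r)
        have := hd r ⟨hs.trans hr.1, hr.2.trans ht⟩ t ⟨hs.trans hst, ht⟩ (by
          rw [Real.dist_eq, abs_sub_comm, abs_of_nonneg (by linarith [hr.2])]; linarith [hr.1])
        rw [Real.dist_eq] at this
        linarith [(abs_lt.1 this).2]
      have h2 := (h s t hs hst ht).trans h1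
      have hκs : κ s = (∫ r in s..t, K r) + κ t :=
        (intervalIntegral.integral_add_adjacent_intervals (hsub hK hs hst ht)
          (hsub hK (hs.trans hst) ht le_rfl)).symm
      set k := ∫ r in s..t, K r
      set φ := ∫ r in s..t, F r
      have h3 : E s ≤ E t * (1 + k) + (k * ω + φ) := by linarith
      have h4 : (1 + k) * Real.exp (-k) ≤ 1 := by
        rw [Real.exp_neg, ← div_eq_mul_inv, div_le_one (Real.exp_pos k)]
        linarith [Real.add_one_le_exp k]
      have h5 : Real.exp (-κ s) ≤ 1 := Real.exp_le_one_iff.2 (by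
        linarith [hκ0 s (hst.trans ht)])
      have h6 : Real.exp (-κ s) = Real.exp (-k) * Real.exp (-κ t) := by
        rw [hκs, neg_add, Real.exp_add]
      have h7 : E s * Real.exp (-κ s) ≤ E t * Real.exp (-κ t) + (k * ω + φ) := by
        calc E s * Real.exp (-κ s) ≤ (E t * (1 + k) + (k * ω + φ)) * Real.exp (-κ s) :=
              mul_le_mul_of_nonneg_right h3 (Real.exp_pos _).le
          _ = E t * Real.exp (-κ t) * ((1 + k) * Real.exp (-k)) +
              (k * ω + φ) * Real.exp (-κ s) := by rw [h6]; ring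
          _ ≤ E t * Real.exp (-κ t) * 1 + (k * ω + φ) * 1 := by
              have := hE0 t ⟨hs.trans hst, ht⟩
              gcongr
          _ = _ := by ring
      linarith)
  have hβ : κ β = 0 := intervalIntegral.integral_same
  rw [hβ, neg_zero, Real.exp_zero, mul_one] at key
  have h1 : E α * Real.exp (-κ α) ≤ E β + ∫ r in α..β, F r := by linarith
  calc E α = Real.exp (κ α) * (E α * Real.exp (-κ α)) := by
        rw [mul_left_comm, ← Real.exp_add, add_neg_cancel, Real.exp_zero, mul_one]
    _ ≤ _ := mul_le_mul_of_nonneg_left h1 (Real.exp_pos _).le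

end Telescoping

/-! ### A smooth approximation of the absolute value -/

section SmoothAbs

/-- A smooth convex approximation of the absolute value. -/
noncomputable def smoothAbs (η s : ℝ) : ℝ := Real.sqrt (s ^ 2 + η ^ 2)

/-- The derivative of `smoothAbs`. -/
noncomputable def smoothSign (η s : ℝ) : ℝ := s / smoothAbs η s

variable {η : ℝ}

theorem smoothAbs_pos (hη : 0 < η) (s : ℝ) : 0 < smoothAbs η s :=
  Real.sqrt_pos.2 (by positivity)

theorem smoothAbs_sq (η s : ℝ) : smoothAbs η s ^ 2 = s ^ 2 + η ^ 2 :=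
  Real.sq_sqrt (by positivity)

theorem abs_le_smoothAbs (η s : ℝ) : |s| ≤ smoothAbs η s :=
  Real.abs_le_sqrt (by nlinarith [sq_nonneg η])

theorem le_smoothAbs (η s : ℝ) : η ≤ smoothAbs η s :=
  Real.le_sqrt_of_sq_le (by nlinarith [sq_nonneg s])

theorem smoothAbs_le (hη : 0 < η) (s : ℝ) : smoothAbs η s ≤ |s| + η := by
  refine Real.sqrt_le_iff.2 ⟨by positivity, ?_⟩
  nlinarith [sq_abs s, abs_nonneg s]

theorem abs_smoothSign_le (hη : 0 < η) (s : ℝ) : |smoothSign η s| ≤ 1 := by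
  rw [smoothSign, abs_div, abs_of_pos (smoothAbs_pos hη s), div_le_one (smoothAbs_pos hη s)]
  exact abs_le_smoothAbs η s

theorem hasDerivAt_smoothAbs (hη : 0 < η) (s : ℝ) :
    HasDerivAt (smoothAbs η) (smoothSign η s) s := by
  have h1 : HasDerivAt (fun s : ℝ => s ^ 2 + η ^ 2) (2 * s) s := by
    simpa using (hasDerivAt_pow 2 s).add_const (η ^ 2)
  refine (h1.sqrt (by positivity)).congr_deriv ?_
  rw [smoothSign, smoothAbs]
  field_simp

theorem hasDerivAt_smoothSign (hη : 0 < η) (s : ℝ) :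
    HasDerivAt (smoothSign η) (η ^ 2 / smoothAbs η s ^ 3) s := by
  have hp := smoothAbs_pos hη s
  refine ((hasDerivAt_id' s).div (hasDerivAt_smoothAbs hη s) hp.ne').congr_deriv ?_
  rw [smoothSign, eq_comm, div_eq_div_iff (by positivity) (by positivity)]
  have := smoothAbs_sq η s
  field_simp
  rw [this]; ring

theorem lipschitzWith_smoothAbs (hη : 0 < η) : LipschitzWith 1 (smoothAbs η) :=
  lipschitzWith_of_nnnorm_deriv_le (fun s => (hasDerivAt_smoothAbs hη s).differentiableAt)
    fun s => by rw [(hasDerivAt_smoothAbs hη s).deriv]; exact abs_smoothSign_le hη s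

theorem lipschitzWith_smoothSign (hη : 0 < η) : LipschitzWith (Real.toNNReal η⁻¹) (smoothSign η) :=
  lipschitzWith_of_nnnorm_deriv_le (fun s => (hasDerivAt_smoothSign hη s).differentiableAt)
    fun s => by
      have hp := smoothAbs_pos hη s
      rw [(hasDerivAt_smoothSign hη s).deriv, ← NNReal.coe_le_coe, coe_nnnorm,
        Real.coe_toNNReal _ (by positivity), Real.norm_of_nonneg (by positivity),
        div_le_iff₀ (by positivity), ← div_eq_inv_mul, le_div_iff₀ hη, ← pow_succ]
      exact pow_le_pow_left₀ hη.le (le_smoothAbs η s) 3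

/-- This is the tangent inequality of a convex function, here reduced to Cauchy–Schwarz for the
plane vectors `(a,η)` and `(b,η)`. -/
theorem smoothAbs_sub_le (hη : 0 < η) (a b : ℝ) :
    smoothAbs η a - smoothAbs η b ≤ smoothSign η a * (a - b) := by
  have hA := smoothAbs_pos hη a
  have hB := smoothAbs_pos hη b
  rw [smoothSign, div_mul_eq_mul_div, le_div_iff₀ hA]
  have h1 : a * b + η ^ 2 ≤ smoothAbs η a * smoothAbs η b := by
    refine (abs_le_of_sq_le_sq' ?_ (by positivity)).2
    rw [mul_pow, smoothAbs_sq, smoothAbs_sq]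
    nlinarith [mul_nonneg (sq_nonneg η) (sq_nonneg (a - b))]
  have h2 := smoothAbs_sq η a
  nlinarith

end SmoothAbs

/-! ### Regularized signs as test functions -/

/-- A smooth approximation of the sign of `w`: mollify, apply `smoothSign`, mollify again. -/
noncomputable def regSign (ρ : Space n → ℝ) (η : ℝ) (w : Space n → ℝ) : Space n → ℝ :=
  moll ρ fun x => smoothSign η (moll ρ w x)

section RegSign

variable {δ η : ℝ} {ρ : Space n → ℝ} {w : Space n → ℝ}

theorem smoothSign_moll_periodic (hw : LatticePeriodic w) :
    LatticePeriodic fun x => smoothSign η (moll ρ w x) := fun k x => by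
  simp only [hw.moll k x]

theorem regSign_periodic (hw : LatticePeriodic w) : LatticePeriodic (regSign ρ η w) :=
  (smoothSign_moll_periodic hw).moll

theorem lipschitz_smoothSign_moll (hρ : IsMollifier δ ρ) (hη : 0 < η) {L : ℝ≥0}
    (hL : LipschitzWith L w) :
    LipschitzWith (Real.toNNReal η⁻¹ * L) fun x => smoothSign η (moll ρ w x) :=
  (lipschitzWith_smoothSign hη).comp (hρ.lipschitz_moll hL)

theorem contDiff_regSign (hρ : IsMollifier δ ρ) (hη : 0 < η) (hw : LatticePeriodic w) {L : ℝ≥0}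
    (hL : LipschitzWith L w) : ContDiff ℝ ((⊤ : ℕ∞) : WithTop ℕ∞) (regSign ρ η w) :=
  hρ.contDiff_moll (lipschitz_smoothSign_moll hρ hη hL).continuous (smoothSign_moll_periodic hw)

/-- The viscosity term has a sign. -/
theorem integral_inner_gradient_regSign_nonneg (hρ : IsMollifier δ ρ) (hη : 0 < η)
    (hw : LatticePeriodic w) {L : ℝ≥0} (hL : LipschitzWith L w) :
    0 ≤ ∫ x, inner ℝ (gradient w x) (gradient (regSign ρ η w) x) ∂torusMeasure n := by
  have hZ := lipschitz_smoothSign_moll hρ hη hL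
  have hint : ∀ {v : Space n → ℝ} {L : ℝ≥0}, LipschitzWith L v →
      Integrable (gradient v) (torusMeasure n) := fun hv =>
    integrable_torus_of_bounded (measurable_gradient _).aestronglyMeasurable
      (norm_gradient_le_of_lipschitz hv)
  -- The outer mollification is moved onto `Dw`, leaving `Φ''(ρ * w)|D(ρ * w)|²` under the integral.
  rw [regSign, hρ.gradient_moll hZ, hρ.integral_inner_moll (hint hL) (hint hZ) hw.gradient
    (smoothSign_moll_periodic hw).gradient, ← hρ.gradient_moll hL]
  refine integral_nonneg fun x => ?_
  have hW := hρ.hasGradientAt_moll hL x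
  have hg : gradient (fun x => smoothSign η (moll ρ w x)) x =
      (η ^ 2 / smoothAbs η (moll ρ w x) ^ 3) • gradient (moll ρ w) x := by
    refine HasGradientAt.gradient ?_
    rw [hasGradientAt_iff_hasFDerivAt, map_smul, hW.gradient]
    exact (hasDerivAt_smoothSign hη _).comp_hasFDerivAt x hW.hasFDerivAt
  rw [hg, inner_smul_right, real_inner_self_eq_norm_sq]
  have := smoothAbs_pos hη (moll ρ w x)
  positivity

/-- Each of the two mollifications costs `η⁻¹Lδ`, which vanishes as `δ → 0` with `η` fixed. -/
theorem abs_regSign_sub_le (hρ : IsMollifier δ ρ) (hη : 0 < η)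
    (hw : LatticePeriodic w) {L : ℝ≥0} (hL : LipschitzWith L w) (x : Space n) :
    |regSign ρ η w x - smoothSign η (w x)| ≤ 2 * η⁻¹ * (L * δ) := by
  have h1 := hρ.norm_moll_sub_le (smoothSign_moll_periodic hw)
    (lipschitz_smoothSign_moll hρ hη hL) x
  have h2 := (lipschitzWith_smoothSign hη).norm_sub_le (moll ρ w x) (w x)
  have h3 := hρ.norm_moll_sub_le hw hL x
  have hη' : 0 ≤ η⁻¹ := by positivity
  rw [Real.coe_toNNReal _ hη'] at h2
  rw [NNReal.coe_mul, Real.coe_toNNReal _ hη'] at h1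
  have h4 := mul_le_mul_of_nonneg_left h3 hη'
  calc |regSign ρ η w x - smoothSign η (w x)|
      ≤ |regSign ρ η w x - smoothSign η (moll ρ w x)| +
        |smoothSign η (moll ρ w x) - smoothSign η (w x)| := abs_sub_le _ _ _
    _ ≤ η⁻¹ * L * δ + η⁻¹ * (L * δ) := add_le_add h1 (h2.trans h4)
    _ = _ := by ring

/-- This controls the freezing of the test function in time. The constant degenerates with the
mollifier through `Lρ`, which is harmless since the time step tends to zero first. -/
theorem regSign_sub_le (hρ : IsMollifier δ ρ) (hη : 0 < η) {Lρ : ℝ≥0} (hLρ : LipschitzWith Lρ ρ)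
    (hw : LatticePeriodic w) {L : ℝ≥0} (hL : LipschitzWith L w) {w' : Space n → ℝ}
    (hw' : LatticePeriodic w') {L' : ℝ≥0} (hL' : LipschitzWith L' w') {d : ℝ≥0}
    (hd : ∀ x, |w x - w' x| ≤ d) (x : Space n) :
    |regSign ρ η w x - regSign ρ η w' x| ≤ (1 + Lρ) * (η⁻¹ * d) ∧
      ‖gradient (regSign ρ η w) x - gradient (regSign ρ η w') x‖ ≤ (1 + Lρ) * (η⁻¹ * d) := by
  have hη' : 0 ≤ η⁻¹ := by positivity
  have hZ := lipschitz_smoothSign_moll hρ hη hL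
  have hZ' := lipschitz_smoothSign_moll hρ hη hL'
  have hp := smoothSign_moll_periodic (η := η) (ρ := ρ) hw
  have hp' := smoothSign_moll_periodic (η := η) (ρ := ρ) hw'
  set Z := fun x => smoothSign η (moll ρ w x)
  set Z' := fun x => smoothSign η (moll ρ w' x)
  have hsub : ∀ y, moll ρ (fun x => Z x - Z' x) y = regSign ρ η w y - regSign ρ η w' y :=
    fun y => hρ.moll_sub hZ.continuous hZ'.continuous y
  have hb : ∀ y, |Z y - Z' y| ≤ (Real.toNNReal η⁻¹ * d : ℝ≥0) := fun y => by
    refine ((lipschitzWith_smoothSign hη).norm_sub_le _ _).trans ?_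
    rw [NNReal.coe_mul]
    refine mul_le_mul_of_nonneg_left ?_ (NNReal.coe_nonneg _)
    rw [← hρ.moll_sub hL.continuous hL'.continuous]
    exact hρ.norm_moll_le hd y
  have hbe : ((Real.toNNReal η⁻¹ * d : ℝ≥0) : ℝ) = η⁻¹ * d := by
    rw [NNReal.coe_mul, Real.coe_toNNReal _ hη']
  have h0 : 0 ≤ η⁻¹ * d := by positivity
  constructor
  · rw [← hsub]
    refine (hρ.norm_moll_le (v := fun x => Z x - Z' x) hb x).trans ?_
    rw [hbe]
    nlinarith [Lρ.2, mul_nonneg Lρ.2 h0]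
  · have h1 := hρ.lipschitz_moll_of_bound hLρ (hZ.continuous.sub hZ'.continuous)
      (fun k x => by simp only [Pi.sub_apply, hp k x, hp' k x]) hb
    have h2 := norm_gradient_le_of_lipschitz h1 x
    have h3 : gradient (moll ρ fun x => Z x - Z' x) x =
        gradient (regSign ρ η w) x - gradient (regSign ρ η w') x := by
      refine HasGradientAt.gradient ?_
      rw [hasGradientAt_iff_hasFDerivAt, map_sub, show (moll ρ fun x => Z x - Z' x) =
        fun y => regSign ρ η w y - regSign ρ η w' y from funext hsub]
      exact ((contDiff_regSign hρ hη hw hL).differentiable (by simp)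
        x).hasGradientAt.hasFDerivAt.sub ((contDiff_regSign hρ hη hw' hL').differentiable (by simp)
        x).hasGradientAt.hasFDerivAt
    rw [← h3]
    refine h2.trans ?_
    rw [NNReal.coe_mul, hbe]
    nlinarith [Lρ.2, mul_nonneg Lρ.2 h0]

end RegSign

/-! ### Estimates for the tested equation at a fixed time -/

/-- Integrability of the integrand of the tested equation at a fixed time. -/
theorem integrable_slice {u ψ F : Space n → ℝ} {R L : ℝ≥0} (hu : LipschitzWith R u)
    (hψ : LipschitzWith L ψ) (hψp : LatticePeriodic ψ) (hF : Integrable F (torusMeasure n))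
    (ε : ℝ) :
    Integrable (fun x => ε * inner ℝ (gradient u x) (gradient ψ x)) (torusMeasure n) ∧
      Integrable (fun x => F x * ψ x) (torusMeasure n) := by
  obtain ⟨A, hA0, hA⟩ := hψp.exists_bound hψ.continuous
  refine ⟨Integrable.const_mul ?_ ε, hF.mul_bdd (c := A) hψ.continuous.aestronglyMeasurable
    (ae_of_all _ hA)⟩
  exact integrable_torus_of_bounded (C := R * L) ((measurable_gradient u).inner
    (measurable_gradient ψ)).aestronglyMeasurable fun x => (norm_inner_le_norm _ _).trans
      (mul_le_mul (norm_gradient_le_of_lipschitz hu x) (norm_gradient_le_of_lipschitz hψ x)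
        (norm_nonneg _) R.2)

/-- Continuous dependence of the tested equation on the test function. -/
theorem abs_integral_tested_sub_le {u F ψ ψ' : Space n → ℝ} {R L L' : ℝ≥0} (hu : LipschitzWith R u)
    (hF : Integrable F (torusMeasure n)) (hψ : LipschitzWith L ψ) (hψp : LatticePeriodic ψ)
    (hψ' : LipschitzWith L' ψ') (hψp' : LatticePeriodic ψ') {D ε : ℝ} (hε : 0 ≤ ε)
    (hD : ∀ x, |ψ x - ψ' x| ≤ D ∧ ‖gradient ψ x - gradient ψ' x‖ ≤ D) :
    |∫ x, (ε * inner ℝ (gradient u x) (gradient ψ x) + F x * ψ x) ∂torusMeasure n -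
      ∫ x, (ε * inner ℝ (gradient u x) (gradient ψ' x) + F x * ψ' x) ∂torusMeasure n| ≤
      D * (ε * R + ∫ x, |F x| ∂torusMeasure n) := by
  have h1 := integrable_slice hu hψ hψp hF ε
  have h2 := integrable_slice hu hψ' hψp' hF ε
  have h3 := integral_sub (h1.1.add h1.2) (h2.1.add h2.2)
  simp only [Pi.add_apply] at h3
  rw [← h3, ← Real.norm_eq_abs]
  have hb : Integrable (fun x => ε * R * D + |F x| * D) (torusMeasure n) :=
    (integrable_const _).add (hF.abs.mul_const _)
  refine (norm_integral_le_of_norm_le hb (ae_of_all _ fun x => ?_)).trans ?_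
  · have h4 : ε * inner ℝ (gradient u x) (gradient ψ x) + F x * ψ x -
        (ε * inner ℝ (gradient u x) (gradient ψ' x) + F x * ψ' x) =
        ε * inner ℝ (gradient u x) (gradient ψ x - gradient ψ' x) + F x * (ψ x - ψ' x) := by
      rw [inner_sub_right]; ring
    rw [h4]
    refine (norm_add_le _ _).trans (add_le_add ?_ ?_)
    · rw [norm_mul, Real.norm_of_nonneg hε, mul_assoc]
      refine mul_le_mul_of_nonneg_left ((norm_inner_le_norm _ _).trans ?_) hε
      exact mul_le_mul (norm_gradient_le_of_lipschitz hu x) (hD x).2 (norm_nonneg _) R.2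
    · rw [norm_mul]
      exact mul_le_mul_of_nonneg_left (hD x).1 (norm_nonneg _)
  · rw [integral_add (integrable_const _) (hF.abs.mul_const _), integral_const, probReal_univ,
      one_smul, integral_mul_const]
    exact le_of_eq (by ring)

/-- The dissipation estimate at a fixed time. -/
theorem neg_integral_tested_sub_le {R C Λ : ℝ≥0} {h : Space n → Space n → ℝ}
    (hh : IsSliceHamiltonian R C Λ h) {u₁ u₂ : Space n → ℝ}
    (h1p : LatticePeriodic u₁) (h2p : LatticePeriodic u₂)
    (h1L : LipschitzWith R u₁) (h2L : LipschitzWith R u₂) {c : ℝ} (hc : 0 ≤ c)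
    (h1c : SemiconcaveWith c u₁) (h2c : SemiconcaveWith c u₂) {f₁ f₂ : Space n → ℝ}
    (hf1 : Integrable f₁ (torusMeasure n)) (hf2 : Integrable f₂ (torusMeasure n))
    (hh1 : Integrable (fun x => h x (gradient u₁ x)) (torusMeasure n))
    (hh2 : Integrable (fun x => h x (gradient u₂ x)) (torusMeasure n))
    {ε δ η : ℝ} (hε : 0 ≤ ε) (hη : 0 < η) {ρ : Space n → ℝ} (hρ : IsMollifier δ ρ) :
    -(∫ x, (ε * inner ℝ (gradient u₁ x) (gradient (regSign ρ η fun x => u₁ x - u₂ x) x) +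
        (h x (gradient u₁ x) - f₁ x) * regSign ρ η (fun x => u₁ x - u₂ x) x) ∂torusMeasure n -
      ∫ x, (ε * inner ℝ (gradient u₂ x) (gradient (regSign ρ η fun x => u₁ x - u₂ x) x) +
        (h x (gradient u₂ x) - f₂ x) * regSign ρ η (fun x => u₁ x - u₂ x) x) ∂torusMeasure n) ≤
      (n * C + n * (Λ * c)) * ∫ x, smoothAbs η (u₁ x - u₂ x) ∂torusMeasure n +
      ∫ x, |f₁ x - f₂ x| ∂torusMeasure n +
      2 * η⁻¹ * ((R + R : ℝ≥0) * δ) * ((∫ x, |h x (gradient u₁ x) - f₁ x| ∂torusMeasure n) +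
        ∫ x, |h x (gradient u₂ x) - f₂ x| ∂torusMeasure n) := by
  set w : Space n → ℝ := fun x => u₁ x - u₂ x with hw
  have hwp : LatticePeriodic w := fun k x => by simp only [hw, h1p k x, h2p k x]
  have hwL : LipschitzWith (R + R) w := h1L.sub h2L
  set ψ := regSign ρ η w
  have hψp : LatticePeriodic ψ := regSign_periodic hwp
  obtain ⟨L, hψL⟩ := hψp.exists_lipschitz (contDiff_infty.1 (contDiff_regSign hρ hη hwp hwL) 1)
  have hF1 := hh1.sub hf1
  have hF2 := hh2.sub hf2
  simp only [Pi.sub_def] at hF1 hF2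
  have hi1 := integrable_slice h1L hψL hψp hF1 ε
  have hi2 := integrable_slice h2L hψL hψp hF2 ε
  have hiw := (integrable_slice hwL hψL hψp hF2 ε).1
  set D := 2 * η⁻¹ * ((R + R : ℝ≥0) * δ)
  -- The viscosity term is signed with the mollified test function, whereas the transport bound
  -- needs the exact derivative `Φ'(w)`. Hence the exchange at cost `D`, made only in the
  -- zeroth-order terms.
  have hsψ : ∀ x, |ψ x - smoothSign η (w x)| ≤ D := abs_regSign_sub_le hρ hη hwp hwL
  have hσm : AEStronglyMeasurable (fun x => smoothSign η (w x)) (torusMeasure n) :=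
    ((lipschitzWith_smoothSign hη).continuous.comp hwL.continuous).aestronglyMeasurable
  have hσ : ∀ {F : Space n → ℝ}, Integrable F (torusMeasure n) →
      Integrable (fun x => F x * smoothSign η (w x)) (torusMeasure n) := fun hF =>
    hF.mul_bdd (c := 1) hσm (ae_of_all _ fun x => abs_smoothSign_le hη _)
  have hF12 := hF1.sub hF2
  simp only [Pi.sub_def] at hF12
  have hiF := (integrable_slice hwL hψL hψp hF12 ε).2
  have e1 : ∫ x, (ε * inner ℝ (gradient u₁ x) (gradient ψ x) +
        (h x (gradient u₁ x) - f₁ x) * ψ x) ∂torusMeasure n -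
      ∫ x, (ε * inner ℝ (gradient u₂ x) (gradient ψ x) +
        (h x (gradient u₂ x) - f₂ x) * ψ x) ∂torusMeasure n =
      ε * ∫ x, inner ℝ (gradient w x) (gradient ψ x) ∂torusMeasure n +
      ∫ x, (h x (gradient u₁ x) - f₁ x - (h x (gradient u₂ x) - f₂ x)) * ψ x ∂torusMeasure n := by
    have h3 := integral_sub (hi1.1.add hi1.2) (hi2.1.add hi2.2)
    simp only [Pi.add_apply] at h3
    rw [← h3, ← integral_const_mul, ← integral_add hiw hiF]
    refine integral_congr_ae ?_
    filter_upwards [ae_torus_of_ae (h1L.ae_differentiableAt.and h2L.ae_differentiableAt)] with x hx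
    have hg : gradient w x = gradient u₁ x - gradient u₂ x := by
      refine HasGradientAt.gradient ?_
      rw [hasGradientAt_iff_hasFDerivAt, map_sub]
      exact hx.1.hasGradientAt.hasFDerivAt.sub hx.2.hasGradientAt.hasFDerivAt
    rw [hg, inner_sub_left]; ring
  have h1 : 0 ≤ ε * ∫ x, inner ℝ (gradient w x) (gradient ψ x) ∂torusMeasure n :=
    mul_nonneg hε (integral_inner_gradient_regSign_nonneg hρ hη hwp hwL)
  have h2 : -∫ x, (h x (gradient u₁ x) - f₁ x - (h x (gradient u₂ x) - f₂ x)) * ψ x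
      ∂torusMeasure n ≤ -∫ x, (h x (gradient u₁ x) - f₁ x - (h x (gradient u₂ x) - f₂ x)) *
      smoothSign η (w x) ∂torusMeasure n +
      D * ((∫ x, |h x (gradient u₁ x) - f₁ x| ∂torusMeasure n) +
        ∫ x, |h x (gradient u₂ x) - f₂ x| ∂torusMeasure n) := by
    have n1 : Integrable (fun x => -((h x (gradient u₁ x) - f₁ x - (h x (gradient u₂ x) - f₂ x)) *
      smoothSign η (w x))) (torusMeasure n) := (hσ hF12).neg
    have n2 : Integrable (fun x => D * (|h x (gradient u₁ x) - f₁ x| +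
      |h x (gradient u₂ x) - f₂ x|)) (torusMeasure n) := (hF1.abs.add hF2.abs).const_mul D
    rw [← integral_add hF1.abs hF2.abs, ← integral_const_mul, ← integral_neg, ← integral_neg,
      ← integral_add n1 n2]
    refine integral_mono hiF.neg (n1.add n2) fun x => ?_
    simp only
    set a := h x (gradient u₁ x) - f₁ x
    set b := h x (gradient u₂ x) - f₂ x
    have h3 : -((a - b) * (ψ x - smoothSign η (w x))) ≤ (|a| + |b|) * D := by
      refine (neg_le_abs _).trans ?_
      rw [abs_mul]
      exact mul_le_mul (abs_sub _ _) (hsψ x) (abs_nonneg _) (by positivity)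
    linarith
  have h3 : -∫ x, (h x (gradient u₁ x) - f₁ x - (h x (gradient u₂ x) - f₂ x)) *
      smoothSign η (w x) ∂torusMeasure n =
      -∫ x, (h x (gradient u₁ x) - h x (gradient u₂ x)) * smoothSign η (w x) ∂torusMeasure n +
      ∫ x, (f₁ x - f₂ x) * smoothSign η (w x) ∂torusMeasure n := by
    have hb := hσ (hh1.sub hh2)
    have hfs := hσ (hf1.sub hf2)
    simp only [Pi.sub_apply] at hb hfs
    have n1 : Integrable (fun x => -((h x (gradient u₁ x) - h x (gradient u₂ x)) *
      smoothSign η (w x))) (torusMeasure n) := hb.neg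
    rw [← integral_neg, ← integral_neg, ← integral_add n1 hfs]
    refine integral_congr_ae (ae_of_all _ fun x => ?_)
    ring
  have h4 := hh.neg_integral_sub_mul_le h1p h2p h1L h2L hc h1c h2c (hasDerivAt_smoothAbs hη)
    (abs_smoothSign_le hη) fun s => (smoothAbs_pos hη s).le
  have h5 : ∫ x, (f₁ x - f₂ x) * smoothSign η (w x) ∂torusMeasure n ≤
      ∫ x, |f₁ x - f₂ x| ∂torusMeasure n := by
    refine integral_mono (hσ (hf1.sub hf2)) (hf1.sub hf2).abs fun x => ?_
    refine (le_abs_self _).trans ?_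
    simp only
    rw [abs_mul]
    exact mul_le_of_le_one_right (abs_nonneg _) (abs_smoothSign_le hη _)
  rw [e1]
  linarith

/-! ### Increments in time and the comparison of two solutions -/

theorem exists_forall_abs_sub_le_of_continuousOn {T : ℝ} {u : ℝ → Space n → ℝ}
    (hp : ∀ t ∈ Icc 0 T, IsPeriodic (u t))
    (hc : ContinuousOn (fun z : ℝ × Space n => u z.1 z.2) (Icc 0 T ×ˢ univ)) {d : ℝ} (hd : 0 < d) :
    ∃ δ > 0, ∀ s ∈ Icc 0 T, ∀ t ∈ Icc 0 T, |s - t| ≤ δ → ∀ x, |u s x - u t x| ≤ d := by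
  have huc := (isCompact_Icc.prod (isCompact_closedBall (0 : Space n)
    (Real.sqrt n))).uniformContinuousOn_of_continuous (hc.mono (prod_mono_right (subset_univ _)))
  obtain ⟨δ, hδ, h⟩ := Metric.uniformContinuousOn_iff.1 huc d hd
  refine ⟨δ / 2, by positivity, fun s hs t ht hst x => ?_⟩
  obtain ⟨k, hk⟩ := exists_latticePoint_add_mem x
  rw [← (hp s hs).latticePeriodic k x, ← (hp t ht).latticePeriodic k x]
  have hk' := unitCube_subset_closedBall hk
  refine (h (s, x + latticePoint k) ⟨hs, hk'⟩ (t, x + latticePoint k) ⟨ht, hk'⟩ ?_).le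
  rw [Prod.dist_eq, dist_self, max_eq_left dist_nonneg, Real.dist_eq]
  linarith

/-- Convexity replaces a chain rule in time: the tangent is taken at `ρ * w`, and self-adjointness
moves the mollification from `w - w'` to the test function. -/
theorem integral_smoothAbs_moll_sub_le {δ η : ℝ} {ρ : Space n → ℝ} (hρ : IsMollifier δ ρ)
    (hη : 0 < η) {w w' : Space n → ℝ} (hw : LatticePeriodic w) {L : ℝ≥0} (hL : LipschitzWith L w)
    (hw' : LatticePeriodic w') {L' : ℝ≥0} (hL' : LipschitzWith L' w') :
    ∫ x, smoothAbs η (moll ρ w x) ∂torusMeasure n - ∫ x, smoothAbs η (moll ρ w' x) ∂torusMeasure n ≤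
      ∫ x, (w x - w' x) * regSign ρ η w x ∂torusMeasure n := by
  have hZ := lipschitz_smoothSign_moll hρ hη hL
  have hc := (lipschitzWith_smoothAbs hη).continuous
  have hW := (hρ.lipschitz_moll hL).continuous
  have hW' := (hρ.lipschitz_moll hL').continuous
  have hi := integrable_torus_of_continuous (hc.comp hW)
  have hi' := integrable_torus_of_continuous (hc.comp hW')
  have h1 := hρ.integral_inner_moll (E := ℝ)
    (integrable_torus_of_continuous (hL.continuous.sub hL'.continuous))
    (integrable_torus_of_continuous hZ.continuous)
    (fun k x => by simp only [Pi.sub_apply, hw k x, hw' k x]) (smoothSign_moll_periodic hw)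
  have h2 : ∫ x, (w x - w' x) * regSign ρ η w x ∂torusMeasure n =
      ∫ x, smoothSign η (moll ρ w x) * (moll ρ w x - moll ρ w' x) ∂torusMeasure n := by
    simp only [← hρ.moll_sub hL.continuous hL'.continuous]
    refine Eq.trans (integral_congr_ae (ae_of_all _ fun x => ?_))
      (h1.trans (integral_congr_ae (ae_of_all _ fun x => ?_)))
    · simp [regSign, mul_comm]
    · simp only [RCLike.inner_apply, conj_trivial]
      rfl
  rw [h2]
  refine le_of_eq_of_le (integral_sub hi hi').symm ?_
  exact integral_mono (hi.sub hi') (integrable_torus_of_continuous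
    (hZ.continuous.mul (hW.sub hW'))) fun x => smoothAbs_sub_le hη _ _

section Comparison

variable {T ε : ℝ} {H : ℝ → Space n → Space n → ℝ} {f₁ f₂ : ℝ → Space n → ℝ}
  {g₁ g₂ : Space n → ℝ} {R C Λ : ℝ≥0} {u₁ u₂ : ℝ → Space n → ℝ} {c : ℝ → ℝ}

theorem integral_abs_cyl {T : ℝ} {F : ℝ → Space n → ℝ}
    (hF : Integrable (fun z : ℝ × Space n => F z.1 z.2) (cylMeasure n 0 T)) :
    IntegrableOn (fun t => ∫ x, |F t x| ∂torusMeasure n) (Ioo 0 T) ∧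
      ∀ᵐ t ∂volume.restrict (Ioo 0 T), Integrable (F t) (torusMeasure n) := by
  have h1 := hF.abs
  rw [cylMeasure_eq_prod] at h1 hF
  exact ⟨h1.integral_prod_left, hF.prod_right_ae⟩

theorem intervalIntegrable_of_integrableOn_Ioo {T : ℝ} {F : ℝ → ℝ} (hF : IntegrableOn F (Ioo 0 T))
    {a b : ℝ} (ha : 0 ≤ a) (hab : a ≤ b) (hb : b ≤ T) : IntervalIntegrable F volume a b :=
  (intervalIntegrable_iff_integrableOn_Ioo_of_le hab).2 (hF.mono_set (Ioo_subset_Ioo ha hb))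

theorem ae_imp_of_ae_restrict_Ioo {T : ℝ} {p : ℝ → Prop}
    (h : ∀ᵐ t ∂volume.restrict (Ioo 0 T), p t) {a b : ℝ} (ha : 0 ≤ a) (hb : b ≤ T) :
    ∀ᵐ t ∂volume.restrict (Icc a b), p t := by
  rw [Measure.restrict_congr_set Ioo_ae_eq_Icc.symm]
  exact ae_restrict_of_ae_restrict_of_subset (Ioo_subset_Ioo ha hb) h

theorem continuousOn_integral_smoothAbs {η : ℝ} (hη : 0 < η)
    (h₁ : IsLipschitzSolution T ε H f₁ g₁ R u₁) (h₂ : IsLipschitzSolution T ε H f₂ g₂ R u₂) :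
    ContinuousOn (fun t => ∫ x, smoothAbs η (u₁ t x - u₂ t x) ∂torusMeasure n) (Icc 0 T) := by
  obtain ⟨A, hA⟩ := exists_bound_of_continuousOn_of_periodic h₁.periodic h₁.continuousOn
  obtain ⟨B, hB⟩ := exists_bound_of_continuousOn_of_periodic h₂.periodic h₂.continuousOn
  have hc := (lipschitzWith_smoothAbs hη).continuous
  refine continuousOn_of_dominated (bound := fun _ => A + B + η) (fun t ht => ?_)
    (fun t ht => ae_of_all _ fun x => ?_) (integrable_const _) (ae_of_all _ fun x => ?_)
  · exact (hc.comp ((h₁.continuous_slice ht).sub (h₂.continuous_slice ht))).aestronglyMeasurable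
  · rw [Real.norm_of_nonneg (smoothAbs_pos hη _).le]
    have h3 := smoothAbs_le hη (u₁ t x - u₂ t x)
    have h4 := abs_sub (u₁ t x) (u₂ t x)
    linarith [hA t ht x, hB t ht x]
  · have hx : ContinuousOn (fun t : ℝ => (t, x)) (Icc 0 T) := by fun_prop
    exact hc.comp_continuousOn
      ((h₁.continuousOn.comp hx fun t ht => ⟨ht, mem_univ _⟩).sub
        (h₂.continuousOn.comp hx fun t ht => ⟨ht, mem_univ _⟩))

/-- The increment estimate for the mollified difference. -/
theorem integral_smoothAbs_moll_sub_le_integral (hT : 0 < T)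
    (hH : ∀ t ∈ Ioo 0 T, IsSliceHamiltonian R C Λ (H t)) (hε : 0 ≤ ε)
    (hf₁ : MemL1Cyl T f₁) (hf₂ : MemL1Cyl T f₂)
    (h₁ : IsLipschitzSolution T ε H f₁ g₁ R u₁) (h₂ : IsLipschitzSolution T ε H f₂ g₂ R u₂)
    (hc : IntegrableOn c (Ioo 0 T))
    (hs₁ : IsSemiconcave T c u₁) (hs₂ : IsSemiconcave T c u₂) {η δ : ℝ} (hη : 0 < η)
    {ρ : Space n → ℝ} (hρ : IsMollifier δ ρ) {α β : ℝ} (hα : 0 ≤ α) (hαβ : α ≤ β) (hβ : β ≤ T) :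
    ∫ x, smoothAbs η (moll ρ (fun y => u₁ α y - u₂ α y) x) ∂torusMeasure n -
      ∫ x, smoothAbs η (moll ρ (fun y => u₁ β y - u₂ β y) x) ∂torusMeasure n ≤
    (∫ r in α..β, ((n * C + n * (Λ * max (c r) 0)) *
      ∫ x, smoothAbs η (u₁ r x - u₂ r x) ∂torusMeasure n +
      ∫ x, |f₁ r x - f₂ r x| ∂torusMeasure n)) +
    2 * η⁻¹ * ((R + R : ℝ≥0) * δ) * ∫ r in α..β,
      ((∫ x, |H r x (gradient (u₁ r) x) - f₁ r x| ∂torusMeasure n) +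
        ∫ x, |H r x (gradient (u₂ r) x) - f₂ r x| ∂torusMeasure n) := by
  set w : ℝ → Space n → ℝ := fun t x => u₁ t x - u₂ t x with hw
  have hwp : ∀ t ∈ Icc 0 T, LatticePeriodic (w t) := fun t ht k x => by
    simp only [hw, (h₁.periodic t ht).latticePeriodic k x, (h₂.periodic t ht).latticePeriodic k x]
  have hwL : ∀ t ∈ Icc 0 T, LipschitzWith (R + R) (w t) := fun t ht =>
    (h₁.lipschitz t ht).sub (h₂.lipschitz t ht)
  set E : ℝ → ℝ := fun r => ∫ x, smoothAbs η (w r x) ∂torusMeasure n with hE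
  set F : ℝ → ℝ := fun r => ∫ x, |f₁ r x - f₂ r x| ∂torusMeasure n with hF
  set b₁ : ℝ → ℝ := fun r => ∫ x, |H r x (gradient (u₁ r) x) - f₁ r x| ∂torusMeasure n with hb₁
  set b₂ : ℝ → ℝ := fun r => ∫ x, |H r x (gradient (u₂ r) x) - f₂ r x| ∂torusMeasure n with hb₂
  set K : ℝ → ℝ := fun r => n * C + n * (Λ * max (c r) 0) with hK
  set D := 2 * η⁻¹ * ((R + R : ℝ≥0) * δ) with hD
  have hKi : IntegrableOn K (Ioo 0 T) :=
    (integrable_const _).add ((hc.pos_part.const_mul _).const_mul _)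
  have hEc : ContinuousOn E (Icc 0 T) := continuousOn_integral_smoothAbs hη h₁ h₂
  have hFi := integral_abs_cyl (F := fun r x => f₁ r x - f₂ r x) (hf₁.2.sub hf₂.2)
  have hb₁i := integral_abs_cyl (F := fun r x => H r x (gradient (u₁ r) x) - f₁ r x)
    (h₁.integrable_H.sub hf₁.2)
  have hb₂i := integral_abs_cyl (F := fun r x => H r x (gradient (u₂ r) x) - f₂ r x)
    (h₂.integrable_H.sub hf₂.2)
  have hII : ∀ {G : ℝ → ℝ}, IntegrableOn G (Ioo 0 T) → ∀ {s t}, α ≤ s → s ≤ t → t ≤ β →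
      IntervalIntegrable G volume s t := fun hG s t hs hst ht =>
    intervalIntegrable_of_integrableOn_Ioo hG (hα.trans hs) hst (ht.trans hβ)
  have hKE : ∀ {s t}, α ≤ s → s ≤ t → t ≤ β →
      IntervalIntegrable (fun r => K r * E r + F r) volume s t := fun hs hst ht =>
    ((hII hKi hs hst ht).mul_continuousOn (hEc.mono (by
      rw [uIcc_of_le hst]; exact Icc_subset_Icc (hα.trans hs) (ht.trans hβ)))).add
      (hII hFi.1 hs hst ht)
  have hB : ∀ {s t}, α ≤ s → s ≤ t → t ≤ β →
      IntervalIntegrable (fun r => b₁ r + b₂ r) volume s t := fun hs hst ht =>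
    (hII hb₁i.1 hs hst ht).add (hII hb₂i.1 hs hst ht)
  have hA : ∀ {s t}, α ≤ s → s ≤ t → t ≤ β →
      IntervalIntegrable (fun r => ε * R + b₁ r + (ε * R + b₂ r)) volume s t := fun hs hst ht =>
    (intervalIntegrable_const.add (hII hb₁i.1 hs hst ht)).add
      (intervalIntegrable_const.add (hII hb₂i.1 hs hst ht))
  obtain ⟨Lρ, hLρ⟩ := hρ.periodic.exists_lipschitz (contDiff_infty.1 hρ.smooth 1)
  rw [← intervalIntegral.integral_const_mul, ← intervalIntegral.integral_add
    (hKE le_rfl hαβ le_rfl) ((hB le_rfl hαβ le_rfl).const_mul D)]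
  refine sub_le_integral_of_local
    (P := fun s => ∫ x, smoothAbs η (moll ρ (w s) x) ∂torusMeasure n) hαβ
    ((hKE le_rfl hαβ le_rfl).add ((hB le_rfl hαβ le_rfl).const_mul D)) (hA le_rfl hαβ le_rfl)
    fun ω hω => ?_
  -- Chosen so that the bound of `regSign_sub_le` is exactly `ω`; each of the two solutions is
  -- allowed half of `d`.
  set d : ℝ≥0 := Real.toNNReal (ω * η / (1 + Lρ)) with hd
  have hdpos : 0 < ω * η / (1 + Lρ) := by positivity
  have hde : (1 + Lρ) * (η⁻¹ * d) = ω := by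
    rw [hd, Real.coe_toNNReal _ hdpos.le]; field_simp
  obtain ⟨δ₁, hδ₁, hu₁⟩ := exists_forall_abs_sub_le_of_continuousOn h₁.periodic h₁.continuousOn
    (half_pos hdpos)
  obtain ⟨δ₂, hδ₂, hu₂⟩ := exists_forall_abs_sub_le_of_continuousOn h₂.periodic h₂.continuousOn
    (half_pos hdpos)
  refine ⟨min δ₁ δ₂, lt_min hδ₁ hδ₂, fun s t hs hst ht hts => ?_⟩
  have hsT : s ∈ Icc 0 T := ⟨hα.trans hs, hst.trans (ht.trans hβ)⟩
  have htT : t ∈ Icc 0 T := ⟨hα.trans (hs.trans hst), ht.trans hβ⟩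
  -- The test function is frozen at the earlier time `s`, which is where the tangent inequality
  -- bounding `P s - P t` is based.
  set ψ := regSign ρ η (w s) with hψ
  have hψp : LatticePeriodic ψ := regSign_periodic (hwp s hsT)
  have hψs : ContDiff ℝ ((⊤ : ℕ∞) : WithTop ℕ∞) ψ := contDiff_regSign hρ hη (hwp s hsT) (hwL s hsT)
  obtain ⟨L, hψL⟩ := hψp.exists_lipschitz (contDiff_infty.1 hψs 1)
  have hJ₁ := hII (h₁.integrableOn_testedRHS hT hf₁ hψs hψp) hs hst ht
  have hJ₂ := hII (h₂.integrableOn_testedRHS hT hf₂ hψs hψp) hs hst ht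
  have hinc : ∫ x, (w s x - w t x) * ψ x ∂torusMeasure n =
      ∫ r in s..t, -(testedRHS ε H f₁ u₁ ψ r - testedRHS ε H f₂ u₂ ψ r) := by
    have hi : ∀ {u : Space n → ℝ}, Continuous u →
        Integrable (fun x => u x * ψ x) (torusMeasure n) := fun hu =>
      integrable_torus_of_continuous (hu.mul hψL.continuous)
    have e1 := hi (h₁.continuous_slice hsT)
    have e2 := hi (h₂.continuous_slice hsT)
    have e3 := hi (h₁.continuous_slice htT)
    have e4 := hi (h₂.continuous_slice htT)
    have e5 : Integrable (fun x => u₁ s x * ψ x - u₁ t x * ψ x) (torusMeasure n) := e1.sub e3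
    have e6 : Integrable (fun x => u₂ s x * ψ x - u₂ t x * ψ x) (torusMeasure n) := e2.sub e4
    rw [intervalIntegral.integral_neg, intervalIntegral.integral_sub hJ₁ hJ₂,
      ← h₁.integral_mul_sub_eq hT hf₁ hψs hψp hsT htT,
      ← h₂.integral_mul_sub_eq hT hf₂ hψs hψp hsT htT]
    calc _ = ∫ x, ((u₁ s x * ψ x - u₁ t x * ψ x) - (u₂ s x * ψ x - u₂ t x * ψ x))
          ∂torusMeasure n := integral_congr_ae (ae_of_all _ fun x => by simp only [hw]; ring)
      _ = _ := by
        rw [integral_sub e5 e6, integral_sub e1 e3, integral_sub e2 e4]; ring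
  refine (integral_smoothAbs_moll_sub_le hρ hη (hwp s hsT) (hwL s hsT) (hwp t htT)
    (hwL t htT)).trans ?_
  rw [hinc, ← intervalIntegral.integral_const_mul, ← intervalIntegral.integral_add
    ((hKE hs hst ht).add ((hB hs hst ht).const_mul D)) ((hA hs hst ht).const_mul ω)]
  refine intervalIntegral.integral_mono_ae_restrict hst (hJ₁.sub hJ₂).neg
    (((hKE hs hst ht).add ((hB hs hst ht).const_mul D)).add ((hA hs hst ht).const_mul ω)) ?_
  have hHs₁ := (integral_abs_cyl (F := fun r x => H r x (gradient (u₁ r) x)) h₁.integrable_H).2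
  have hHs₂ := (integral_abs_cyl (F := fun r x => H r x (gradient (u₂ r) x)) h₂.integrable_H).2
  have hfs₁ := (integral_abs_cyl hf₁.2).2
  have hfs₂ := (integral_abs_cyl hf₂.2).2
  have hmem : ∀ᵐ r ∂volume.restrict (Ioo 0 T), r ∈ Ioo 0 T := ae_restrict_mem measurableSet_Ioo
  filter_upwards [ae_imp_of_ae_restrict_Ioo (hHs₁.and (hHs₂.and (hfs₁.and (hfs₂.and
    (hs₁.and (hs₂.and hmem)))))) hsT.1 htT.2, ae_restrict_mem measurableSet_Icc]
    with r ⟨hr1, hr2, hr3, hr4, hr5, hr6, hr7⟩ hrst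
  have hrT : r ∈ Icc 0 T := Ioo_subset_Icc_self hr7
  -- At almost every `r` the frozen `ψ` is exchanged for the test function built from `w r`, with
  -- error `ω` times an integrable function of `r`; the fixed-time dissipation estimate then
  -- applies.
  set φ := regSign ρ η (w r) with hφ
  have hφp : LatticePeriodic φ := regSign_periodic (hwp r hrT)
  obtain ⟨L', hφL⟩ := hφp.exists_lipschitz
    (contDiff_infty.1 (contDiff_regSign hρ hη (hwp r hrT) (hwL r hrT)) 1)
  have hsr : |s - r| ≤ min δ₁ δ₂ := by
    rw [abs_sub_comm, abs_of_nonneg (by linarith [hrst.1])]; linarith [hrst.2]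
  have hwd : ∀ x, |w s x - w r x| ≤ d := fun x => by
    have q1 := hu₁ s hsT r hrT (hsr.trans (min_le_left _ _)) x
    have q2 := hu₂ s hsT r hrT (hsr.trans (min_le_right _ _)) x
    rw [hd, Real.coe_toNNReal _ hdpos.le]
    have q3 : w s x - w r x = (u₁ s x - u₁ r x) - (u₂ s x - u₂ r x) := by simp only [hw]; ring
    rw [q3]
    exact (abs_sub _ _).trans (by linarith)
  have hψφ := regSign_sub_le hρ hη hLρ (hwp s hsT) (hwL s hsT) (hwp r hrT) (hwL r hrT) hwd
  rw [hde] at hψφ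
  have p1 := abs_integral_tested_sub_le (h₁.lipschitz r hrT) (hr1.sub hr3) hψL hψp hφL hφp hε hψφ
  have p2 := abs_integral_tested_sub_le (h₂.lipschitz r hrT) (hr2.sub hr4) hψL hψp hφL hφp hε hψφ
  have p3 := neg_integral_tested_sub_le (hH r hr7) (h₁.periodic r hrT).latticePeriodic
    (h₂.periodic r hrT).latticePeriodic (h₁.lipschitz r hrT) (h₂.lipschitz r hrT)
    (le_max_right (c r) 0) ((semiconcaveWith_of_concaveOn hr5).mono (le_max_left _ _))
    ((semiconcaveWith_of_concaveOn hr6).mono (le_max_left _ _)) hr3 hr4 hr1 hr2 hε hη hρ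
  have p1' := (abs_le.1 p1).1
  have p2' := (abs_le.1 p2).2
  simp only [Pi.sub_apply] at p1' p2'
  simp only [testedRHS, hE, hF, hb₁, hb₂, hK, hD, hw, hψ, hφ] at p1' p2' p3 ⊢
  linarith

/-- The increment estimate for the difference of two solutions. -/
theorem integral_smoothAbs_sub_le_integral (hT : 0 < T)
    (hH : ∀ t ∈ Ioo 0 T, IsSliceHamiltonian R C Λ (H t)) (hε : 0 ≤ ε)
    (hf₁ : MemL1Cyl T f₁) (hf₂ : MemL1Cyl T f₂)
    (h₁ : IsLipschitzSolution T ε H f₁ g₁ R u₁) (h₂ : IsLipschitzSolution T ε H f₂ g₂ R u₂)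
    (hc : IntegrableOn c (Ioo 0 T))
    (hs₁ : IsSemiconcave T c u₁) (hs₂ : IsSemiconcave T c u₂) {η : ℝ} (hη : 0 < η)
    {α β : ℝ} (hα : 0 ≤ α) (hαβ : α ≤ β) (hβ : β ≤ T) :
    ∫ x, smoothAbs η (u₁ α x - u₂ α x) ∂torusMeasure n -
      ∫ x, smoothAbs η (u₁ β x - u₂ β x) ∂torusMeasure n ≤
    ∫ r in α..β, ((n * C + n * (Λ * max (c r) 0)) *
      ∫ x, smoothAbs η (u₁ r x - u₂ r x) ∂torusMeasure n +
      ∫ x, |f₁ r x - f₂ r x| ∂torusMeasure n) := by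
  set w : ℝ → Space n → ℝ := fun t x => u₁ t x - u₂ t x with hw
  have hδ : ∀ k : ℕ, (0 : ℝ) < 1 / ((k : ℝ) + 1) := fun k => by positivity
  choose ρ hρ using fun k => exists_isMollifier n (hδ k)
  have hδ0 : Tendsto (fun k : ℕ => 1 / ((k : ℝ) + 1)) atTop (𝓝 0) :=
    tendsto_one_div_add_atTop_nhds_zero_nat
  have hlim : ∀ t ∈ Icc 0 T, Tendsto (fun k => ∫ x, smoothAbs η (moll (ρ k) (w t) x)
      ∂torusMeasure n) atTop (𝓝 (∫ x, smoothAbs η (w t x) ∂torusMeasure n)) := fun t ht => by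
    have hwp : LatticePeriodic (w t) := fun k x => by
      simp only [hw, (h₁.periodic t ht).latticePeriodic k x,
        (h₂.periodic t ht).latticePeriodic k x]
    have hwL : LipschitzWith (R + R) (w t) := (h₁.lipschitz t ht).sub (h₂.lipschitz t ht)
    have hcΦ := (lipschitzWith_smoothAbs hη).continuous
    rw [tendsto_iff_norm_sub_tendsto_zero]
    have hz : Tendsto (fun k : ℕ => (R + R : ℝ≥0) * (1 / ((k : ℝ) + 1))) atTop (𝓝 0) := by
      simpa using hδ0.const_mul ((R + R : ℝ≥0) : ℝ)
    refine squeeze_zero (fun k => norm_nonneg _) (fun k => ?_) hz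
    have e1 : Integrable (fun x => smoothAbs η (moll (ρ k) (w t) x)) (torusMeasure n) :=
      integrable_torus_of_continuous (hcΦ.comp ((hρ k).lipschitz_moll hwL).continuous)
    have e2 : Integrable (fun x => smoothAbs η (w t x)) (torusMeasure n) :=
      integrable_torus_of_continuous (hcΦ.comp hwL.continuous)
    rw [← integral_sub e1 e2]
    refine (norm_integral_le_of_norm_le_const (C := (R + R : ℝ≥0) * (1 / ((k : ℝ) + 1)))
      (ae_of_all _ fun x => ((lipschitzWith_smoothAbs hη).norm_sub_le _ _).trans ?_)).trans
      (le_of_eq ?_)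
    · rw [NNReal.coe_one, one_mul]
      exact (hρ k).norm_moll_sub_le hwp hwL x
    · simp
  have hαT : α ∈ Icc 0 T := ⟨hα, hαβ.trans hβ⟩
  have hβT : β ∈ Icc 0 T := ⟨hα.trans hαβ, hβ⟩
  -- The mollification error is `δ` times a quantity independent of the mollifier, so it disappears
  -- with `η` fixed.
  have hrhs := ((hδ0.const_mul ((R + R : ℝ≥0) : ℝ)).const_mul (2 * η⁻¹)).mul_const
    (∫ r in α..β, ((∫ x, |H r x (gradient (u₁ r) x) - f₁ r x| ∂torusMeasure n) +
        ∫ x, |H r x (gradient (u₂ r) x) - f₂ r x| ∂torusMeasure n))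
  have hrhs' := hrhs.const_add (∫ r in α..β, ((n * C + n * (Λ * max (c r) 0)) *
      ∫ x, smoothAbs η (u₁ r x - u₂ r x) ∂torusMeasure n +
      ∫ x, |f₁ r x - f₂ r x| ∂torusMeasure n))
  rw [mul_zero, mul_zero, zero_mul, add_zero] at hrhs'
  exact le_of_tendsto_of_tendsto' ((hlim α hαT).sub (hlim β hβT)) hrhs' fun k =>
    integral_smoothAbs_moll_sub_le_integral hT hH hε hf₁ hf₂ h₁ h₂ hc hs₁ hs₂ hη (hρ k) hα hαβ hβ

/-- `L¹` contraction up to an exponential factor. -/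
theorem integral_abs_sub_le (hT : 0 < T)
    (hH : ∀ t ∈ Ioo 0 T, IsSliceHamiltonian R C Λ (H t)) (hε : 0 ≤ ε)
    (hf₁ : MemL1Cyl T f₁) (hf₂ : MemL1Cyl T f₂)
    (h₁ : IsLipschitzSolution T ε H f₁ g₁ R u₁) (h₂ : IsLipschitzSolution T ε H f₂ g₂ R u₂)
    (hc : IntegrableOn c (Ioo 0 T))
    (hs₁ : IsSemiconcave T c u₁) (hs₂ : IsSemiconcave T c u₂) {τ : ℝ} (hτ : τ ∈ Icc 0 T) :
    ∫ x, |u₁ τ x - u₂ τ x| ∂torusMeasure n ≤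
      Real.exp (∫ r in τ..T, (n * C + n * (Λ * max (c r) 0))) *
        (∫ x, |u₁ T x - u₂ T x| ∂torusMeasure n +
          ∫ r in τ..T, ∫ x, |f₁ r x - f₂ r x| ∂torusMeasure n) := by
  have hTT : T ∈ Icc 0 T := ⟨hT.le, le_rfl⟩
  have hwc : ∀ t ∈ Icc 0 T, Continuous fun x => u₁ t x - u₂ t x := fun t ht =>
    (h₁.continuous_slice ht).sub (h₂.continuous_slice ht)
  have key : ∀ η > 0, ∫ x, |u₁ τ x - u₂ τ x| ∂torusMeasure n ≤
      Real.exp (∫ r in τ..T, (n * C + n * (Λ * max (c r) 0))) *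
        (∫ x, |u₁ T x - u₂ T x| ∂torusMeasure n + η +
          ∫ r in τ..T, ∫ x, |f₁ r x - f₂ r x| ∂torusMeasure n) := by
    intro η hη
    have hcΦ := (lipschitzWith_smoothAbs hη).continuous
    have hKi : IntegrableOn (fun r => n * C + n * (Λ * max (c r) 0)) (Ioo 0 T) :=
      (integrable_const _).add ((hc.pos_part.const_mul _).const_mul _)
    have hFi := (integral_abs_cyl (F := fun r x => f₁ r x - f₂ r x) (hf₁.2.sub hf₂.2)).1
    have hG := le_exp_integral_mul_of_sub_le hτ.2
      ((continuousOn_integral_smoothAbs hη h₁ h₂).mono (Icc_subset_Icc_left hτ.1))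
      (fun t _ => integral_nonneg fun x => (smoothAbs_pos hη _).le)
      (intervalIntegrable_of_integrableOn_Ioo hKi hτ.1 hτ.2 le_rfl)
      (fun t => by positivity)
      (intervalIntegrable_of_integrableOn_Ioo hFi hτ.1 hτ.2 le_rfl)
      (fun t => integral_nonneg fun x => abs_nonneg _)
      (fun s t hs hst ht => integral_smoothAbs_sub_le_integral hT hH hε hf₁ hf₂ h₁ h₂ hc hs₁ hs₂ hη
        (hτ.1.trans hs) hst ht)
    have hlow : ∫ x, |u₁ τ x - u₂ τ x| ∂torusMeasure n ≤
        ∫ x, smoothAbs η (u₁ τ x - u₂ τ x) ∂torusMeasure n :=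
      integral_mono (integrable_torus_of_continuous (hwc τ hτ).abs)
        (integrable_torus_of_continuous (hcΦ.comp (hwc τ hτ))) fun x => abs_le_smoothAbs _ _
    have hup : ∫ x, smoothAbs η (u₁ T x - u₂ T x) ∂torusMeasure n ≤
        ∫ x, |u₁ T x - u₂ T x| ∂torusMeasure n + η := by
      have hη1 : ∫ _ : Space n, η ∂torusMeasure n = η := by simp
      have hi := integrable_torus_of_continuous (hwc T hTT).abs
      calc _ ≤ ∫ x, (|u₁ T x - u₂ T x| + η) ∂torusMeasure n :=
            integral_mono (integrable_torus_of_continuous (hcΦ.comp (hwc T hTT)))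
              (hi.add (integrable_const _)) fun x => smoothAbs_le hη _
        _ = _ := by rw [integral_add hi (integrable_const _), hη1]
    refine hlow.trans (hG.trans ?_)
    gcongr
  have hlim : Tendsto (fun η : ℝ => Real.exp (∫ r in τ..T, (n * C + n * (Λ * max (c r) 0))) *
        (∫ x, |u₁ T x - u₂ T x| ∂torusMeasure n + η +
          ∫ r in τ..T, ∫ x, |f₁ r x - f₂ r x| ∂torusMeasure n)) (𝓝[>] 0)
      (𝓝 (Real.exp (∫ r in τ..T, (n * C + n * (Λ * max (c r) 0))) *
        (∫ x, |u₁ T x - u₂ T x| ∂torusMeasure n + 0 +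
          ∫ r in τ..T, ∫ x, |f₁ r x - f₂ r x| ∂torusMeasure n))) := by
    refine Tendsto.mono_left (Continuous.tendsto ?_ 0) nhdsWithin_le_nhds
    fun_prop
  rw [add_zero] at hlim
  exact ge_of_tendsto hlim (eventually_nhdsWithin_of_forall key)

end Comparison

/-! ### From the standing assumptions to the norm estimate -/

theorem isSliceHamiltonian_of_isHamiltonian {T : ℝ} {H : ℝ → Space n → Space n → ℝ}
    (hH : IsHamiltonian T H) {lam Lam : ℝ} (hlam : 0 ≤ lam) (hell : HessianBounds T H lam Lam)
    (R : ℝ≥0) : ∃ C : ℝ≥0, ∀ t ∈ Ioo 0 T, IsSliceHamiltonian R C Lam.toNNReal (H t) := by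
  obtain ⟨C, hC⟩ := hH.bounded_lipschitz R
  refine ⟨C, fun t ht => ⟨fun p => hH.periodic t ht p, hH.contDiff t ht, fun p => ?_,
    fun p hp => (hC t ht p hp).1, fun p hp => (hC t ht p hp).2, fun x p ξ => ?_, fun x p ξ => ?_⟩⟩
  -- Continuity in `x` is wanted for every `p`, beyond the ball of radius `R`, so the bound is
  -- invoked on the ball of radius `‖p‖`.
  · obtain ⟨C', hC'⟩ := hH.bounded_lipschitz ‖p‖₊
    exact (hC' t ht p le_rfl).2.continuous
  · exact le_trans (by positivity) (hell t ht x p ξ).1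
  · exact (hell t ht x p ξ).2.trans (by gcongr; exact Real.le_coe_toNNReal _)

theorem normL1_eq_ofReal {v : Space n → ℝ} (hv : Integrable v (torusMeasure n)) :
    normL1 v = ENNReal.ofReal (∫ x, |v x| ∂torusMeasure n) := by
  rw [normL1, eLpNorm_one_eq_lintegral_enorm, ← ofReal_integral_norm_eq_lintegral_enorm hv]
  rfl

theorem normL1Cyl_eq_ofReal {τ T : ℝ} (hτ0 : 0 ≤ τ) (hτT : τ ≤ T) {f : ℝ → Space n → ℝ}
    (hf : Integrable (fun z : ℝ × Space n => f z.1 z.2) (cylMeasure n 0 T)) :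
    normL1Cyl τ T f = ENNReal.ofReal (∫ r in τ..T, ∫ x, |f r x| ∂torusMeasure n) := by
  have hf' : Integrable (fun z : ℝ × Space n => f z.1 z.2) (cylMeasure n τ T) :=
    IntegrableOn.mono_set hf (prod_mono_left (Ioo_subset_Ioo_left hτ0))
  rw [normL1Cyl, eLpNorm_one_eq_lintegral_enorm, ← ofReal_integral_norm_eq_lintegral_enorm hf']
  have h1 := hf'.norm
  rw [cylMeasure_eq_prod] at h1 ⊢
  rw [integral_prod _ h1, intervalIntegral.integral_of_le hτT, integral_Ioc_eq_integral_Ioo]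
  rfl

end HJTorus

theorem mainTheorem9 (n : ℕ) (T : ℝ) (hT : 0 < T)
    (H : ℝ → HJTorus.Space n → HJTorus.Space n → ℝ) (hH : HJTorus.IsHamiltonian T H)
    (lam Lam : ℝ) (hlam : 0 ≤ lam) (hell : HJTorus.HessianBounds T H lam Lam)
    (c : ℝ → ℝ) (hc : IntegrableOn c (Ioo 0 T)) (R : ℝ≥0) :
    ∃ K : ℝ → ℝ, IntegrableOn K (Ioo 0 T) ∧
      ∀ (ε : ℝ) (_ : 0 ≤ ε)
        (f₁ f₂ : ℝ → HJTorus.Space n → ℝ) (g₁ g₂ : HJTorus.Space n → ℝ)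
        (u₁ u₂ : ℝ → HJTorus.Space n → ℝ),
        HJTorus.MemL1Cyl T f₁ → HJTorus.MemL1Cyl T f₂ →
        HJTorus.MemL1 g₁ → HJTorus.MemL1 g₂ →
        HJTorus.IsLipschitzSolution T ε H f₁ g₁ R u₁ →
        HJTorus.IsLipschitzSolution T ε H f₂ g₂ R u₂ →
        HJTorus.IsSemiconcave T c u₁ → HJTorus.IsSemiconcave T c u₂ →
        ∀ τ ∈ Ico 0 T,
          HJTorus.normLinftyL1 τ T (fun t x => u₁ t x - u₂ t x) ≤
            ENNReal.ofReal (Real.exp (∫ t in τ..T, K t)) *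
              (HJTorus.normL1 (fun x => g₁ x - g₂ x) +
                HJTorus.normL1Cyl τ T (fun t x => f₁ t x - f₂ t x)) := by
  obtain ⟨C, hC⟩ := HJTorus.isSliceHamiltonian_of_isHamiltonian hH hlam hell R
  -- The positive part of `c` is taken because both the trace inequality and Grönwall's argument
  -- need a nonnegative coefficient; enlarging `c` preserves semiconcavity.
  set K : ℝ → ℝ := fun t => n * C + n * (Lam.toNNReal * max (c t) 0)
  have hK0 : ∀ t, 0 ≤ K t := fun t => by positivity
  have hKi : IntegrableOn K (Ioo 0 T) :=
    (integrable_const _).add ((hc.pos_part.const_mul _).const_mul _)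
  refine ⟨K, hKi, fun ε hε f₁ f₂ g₁ g₂ u₁ u₂ hf₁ hf₂ _ _ h₁ h₂ hs₁ hs₂ τ hτ => ?_⟩
  have hTT : T ∈ Icc 0 T := ⟨hT.le, le_rfl⟩
  have hwi : ∀ t ∈ Icc 0 T, Integrable (fun x => u₁ t x - u₂ t x) (HJTorus.torusMeasure n) :=
    fun t ht => HJTorus.integrable_torus_of_continuous
      ((h₁.continuous_slice ht).sub (h₂.continuous_slice ht))
  have hg : HJTorus.normL1 (fun x => g₁ x - g₂ x) =
      HJTorus.normL1 (fun x => u₁ T x - u₂ T x) := by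
    refine eLpNorm_congr_ae (HJTorus.ae_torus_of_ae ?_)
    filter_upwards [h₁.terminal, h₂.terminal] with x hx₁ hx₂
    rw [hx₁, hx₂]
  have hFi := (HJTorus.integral_abs_cyl (F := fun r x => f₁ r x - f₂ r x) (hf₁.2.sub hf₂.2)).1
  have hFint : ∀ {a b : ℝ}, 0 ≤ a → a ≤ b → b ≤ T → IntervalIntegrable
      (fun r => ∫ x, |f₁ r x - f₂ r x| ∂HJTorus.torusMeasure n) volume a b := fun ha hab hb =>
    HJTorus.intervalIntegrable_of_integrableOn_Ioo hFi ha hab hb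
  have hKint : ∀ {a b : ℝ}, 0 ≤ a → a ≤ b → b ≤ T → IntervalIntegrable K volume a b :=
    fun ha hab hb => HJTorus.intervalIntegrable_of_integrableOn_Ioo hKi ha hab hb
  rw [hg, HJTorus.normL1_eq_ofReal (hwi T hTT), HJTorus.normL1Cyl_eq_ofReal hτ.1 hτ.2.le
    (hf₁.2.sub hf₂.2), ← ENNReal.ofReal_add (integral_nonneg fun x => abs_nonneg _)
    (intervalIntegral.integral_nonneg hτ.2.le fun r _ => integral_nonneg fun x => abs_nonneg _),
    ← ENNReal.ofReal_mul (Real.exp_pos _).le]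
  refine essSup_le_of_ae_le _ ?_
  filter_upwards [ae_restrict_mem measurableSet_Ioo] with s hs
  have hsT : s ∈ Icc 0 T := ⟨hτ.1.trans hs.1.le, hs.2.le⟩
  rw [HJTorus.normL1_eq_ofReal (hwi s hsT)]
  refine ENNReal.ofReal_le_ofReal ((HJTorus.integral_abs_sub_le hT hC hε hf₁ hf₂ h₁ h₂ hc hs₁ hs₂
    hsT).trans ?_)
  -- The estimate holds at each `s` in `(τ,T)` with integrals over `(s,T)`; since the integrands are
  -- nonnegative, passing to `(τ,T)` makes the bound uniform in `s`.
  have h3 : ∫ r in s..T, K r ≤ ∫ r in τ..T, K r := by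
    rw [← intervalIntegral.integral_add_adjacent_intervals (hKint hτ.1 hs.1.le hs.2.le)
      (hKint hsT.1 hs.2.le le_rfl)]
    exact le_add_of_nonneg_left (intervalIntegral.integral_nonneg hs.1.le fun r _ => hK0 r)
  have h4 : ∫ r in s..T, ∫ x, |f₁ r x - f₂ r x| ∂HJTorus.torusMeasure n ≤
      ∫ r in τ..T, ∫ x, |f₁ r x - f₂ r x| ∂HJTorus.torusMeasure n := by
    rw [← intervalIntegral.integral_add_adjacent_intervals (hFint hτ.1 hs.1.le hs.2.le)
      (hFint hsT.1 hs.2.le le_rfl)]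
    exact le_add_of_nonneg_left (intervalIntegral.integral_nonneg hs.1.le fun r _ =>
      integral_nonneg fun x => abs_nonneg _)
  have h5 : 0 ≤ ∫ r in s..T, ∫ x, |f₁ r x - f₂ r x| ∂HJTorus.torusMeasure n :=
    intervalIntegral.integral_nonneg hs.2.le fun r _ => integral_nonneg fun x => abs_nonneg _
  have h6 : 0 ≤ ∫ x, |u₁ T x - u₂ T x| ∂HJTorus.torusMeasure n :=
    integral_nonneg fun x => abs_nonneg _
  exact mul_le_mul (Real.exp_le_exp.2 h3) (by linarith) (by linarith) (Real.exp_pos _).le
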